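/- **The SZX-calculus.** Types are formal sums $1_{n_1}+\dots+1_{n_r}$ with $n_i\ge 1$ (the free monoid on the positive integers); $k_n$ is the sum of $k$ copies of $1_n$, and $1_0$ is the empty sum. Diagrams $D:a\to b$ are generated, under sequential and parallel composition, by identities, swaps, green and red spiders $k_n\to \ell_n$ with phase vector $\alpha\in\mathbb R^n$, Hadamard boxes $1_n\to 1_n$, cups $0\to 2_n$, caps $2_n\to 0$, dividers $1_{n+1}\to 1_1+1_n$, gatherers $1_1+1_n\to 1_{n+1}$, and matrix boxes $A:1_n\to 1_m$ for $A\in\mathbb F_2^{m\times n}$, where $n,m\ge 1$ and $k,\ell\ge 0$. $\mathrm{SZX}\vdash D=D'$ means that the equation $D=D'$ follows by equational reasoning, as a congruence for both compositions, from the following rules; the rules about spiders hold for both colours, i.e. also with green and red exchanged. 1. *Topology*: the laws of strict symmetric monoidal categories, the snake equations, symmetry of cups and caps, and the freedom to exchange and bend the legs of a spider. 2. *Registers*: a gatherer followed by a divider, and a divider followed by a gatherer, are identities; a divider or gatherer of size $n+1$ distributes over cups, caps, Hadamard boxes and spiders (a spider with phase vector $\alpha{::}\beta$ splits into a one-qubit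 spider with phase $\alpha$ and a spider of size $n$ with phase $\beta$). 3. *ZX rules*: spiders of the same colour joined by at least one wire fuse, adding their phases; a phase-free spider $1_n\to1_n$ is a wire; Hadamard boxes on all legs change the colour of a spider; and, writing $\langle\alpha|\beta\rangle$ for a one-qubit green state of phase $\alpha$ plugged into a red effect of phase $\beta$ (with the colours exchanged in the colour-swapped rules), on one-qubit wires: $\langle \frac\pi4|-\frac\pi4\rangle$ is the empty diagram; the phase-free red state is copied by the phase-free green spider $1\to2$, where the uncopied side carries the scalar $\langle0|0\rangle$; the bialgebra law between phase-free green copying and red merging, where the side with four spiders carries the scalar $\langle0|0\rangle$; and the Euler rule: the composite of green $\alpha_1$, Hadamard, green $\alpha_2$, with scalar $\langle 0|0\rangle$, equals the composite of red $\beta_1$, green $\beta_2$, red $\beta_3$, with scalar $\langle\gamma|\pi\rangle$, where $x^+=\frac{\alpha_1+\alpha_2}2$, $x^-=x^+-\alpha_2$, $z=-\sin x^++i\cos x^-$, $z'=\cos x^+-i\sin x^-$, $\beta_1=\arg z+\arg z'$, $\beta_2=2\arg(i+|z/z'|)$ (and $\beta_2=0$ if $z'=0$), $\beta_3=\arg z-\arg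 z'$, $\gamma=x^+-\arg z+\frac{\pi-\beta_2}2$, $\arg 0=0$. 4. *Matrices*: the $1\times1$ matrix $(1)$ is a wire; the $1\times1$ matrix $(0)$ is a green effect $1\to0$ followed by a red state $0\to1$, times the scalar $\frac1{\sqrt2}$ (the diagram of a phase-free green and a phase-free red dot joined by three wires); a block matrix $\binom AB$ followed by a divider is the green copy followed by $A$ and $B$ in parallel; a gatherer followed by a block matrix $(C\ D)$ with $m$ rows is $C$ and $D$ in parallel followed by the red spider $2_m\to1_m$, times the scalar $\sqrt2^{\,m}$ (a phase-free green state of size $m$ plugged into a phase-free red effect). **Graph state boxes.** Let $G$ be a finite simple graph with ordered vertices, of order $n\ge1$. A graph state box of $G$ is a diagram $0\to1_n$ defined inductively. For $n=1$ it is the phase-free green state $0\to 1_1$ times the scalar $\frac1{\sqrt2}$. For $n>1$, let $u$ be the first vertex, $N_u$ its neighbourhood, and let $\tau$ be any permutation of the list of vertices of $G\setminus u$ which puts $N_u$ first. Take a graph state box of $G\setminus u$, apply $\tau$ (as a permutation-matrix box), divide the register into $N_u$ and the remaining vertices; take a phase-free green spider $0\to 2$ for $u$, with one leg as output and the other leg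 going through the all-ones matrix $1_1\to1_{|N_u|}$ and a Hadamard box into a phase-free green spider merging it with the register of $N_u$; gather, apply $\tau^{-1}$, and gather with the output of $u$ as first qubit; multiply by the scalars $\frac1{\sqrt2}$ and $\sqrt2^{\,|N_u|}$. (If a part of the register is empty, its wires and boxes are absent; if $N_u=\emptyset$, the second leg of $u$'s spider ends in a phase-free green effect.) **Theorem (local complementation).** Let $G$ be a finite simple graph with ordered vertices, $u$ a vertex of $G$, and let $G\star u$ be the graph obtained from $G$ by complementing the edges between neighbours of $u$. Let $D$ be a graph state box of $G$ and $D'$ a graph state box of $G\star u$, and let $\varepsilon\in\{1,-1\}$. Then $$\mathrm{SZX}\ \vdash\ R_u\!\left(\varepsilon\tfrac{\pi}{2}\right)\circ Z_{N_u}\!\left(-\varepsilon\tfrac{\pi}{2}\right)\circ D \;=\; D',$$ where $Z_{N_u}(\theta)$ is the green spider $1_n\to1_n$ whose phase vector is $\theta$ on the neighbours of $u$ in $G$ and $0$ elsewhere, and $R_u(\theta)$ is the red spider $1_n\to 1_n$ whose phase vector is $\theta$ at $u$ and $0$ elsewhere. -/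

import Mathlib

open scoped Real

namespace SZX

/-- Types of the calculus: the free monoid over the positive integers.  The list `[n₁, …, n_r]` is
the formal sum `1_{n₁} + ⋯ + 1_{n_r}` (wires carrying registers of `nᵢ` qubits). -/
abbrev Ty : Type := List ℕ+

/-- The type `1_n`, with the convention that `1_0` is the empty sum. -/
def reg : ℕ → Ty
  | 0 => []
  | n + 1 => [n.succPNat]

theorem reg_coe (n : ℕ+) : reg (n : ℕ) = [n] := by
  obtain ⟨m, rfl⟩ : ∃ m : ℕ, n = m.succPNat := ⟨n.natPred, (PNat.succPNat_natPred n).symm⟩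
  rfl

inductive Colour : Type
  | green
  | red

def Colour.other : Colour → Colour
  | .green => .red
  | .red => .green

/-- The type `k_n`: a sum of `k` wires of type `1_n`. -/
abbrev copies (k : ℕ) (n : ℕ+) : Ty := List.replicate k n

/-- Diagrams `a ⟶ b`.  Sequential composition `comp f g h` (first `f`, then `g`) is available as soon
as the output type of `f` equals the input type of `g`; `wires []` is the empty diagram. -/
inductive Diag : Ty → Ty → Type
  | wires (a : Ty) : Diag a a
  | comp {a b b' c : Ty} (f : Diag a b) (g : Diag b' c) (h : b = b') : Diag a c
  | tensor {a b c d : Ty} (f : Diag a b) (g : Diag c d) : Diag (a ++ c) (b ++ d)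
  | swap (a b : Ty) : Diag (a ++ b) (b ++ a)
  | spider (x : Colour) (n : ℕ+) (k l : ℕ) (α : Fin n → ℝ) : Diag (copies k n) (copies l n)
  | had (n : ℕ+) : Diag [n] [n]
  | cup (n : ℕ+) : Diag [] [n, n]
  | cap (n : ℕ+) : Diag [n, n] []
  | divider (n : ℕ+) : Diag [n + 1] [1, n]
  | gatherer (n : ℕ+) : Diag [1, n] [n + 1]
  | matrix {m n : ℕ+} (A : Matrix (Fin m) (Fin n) (ZMod 2)) : Diag [n] [m]

/-- Sequential composition, first `f` and then `g`. -/
notation:60 f:60 " ⨟ " g:61 => Diag.comp f g (by rfl)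

/-- Parallel composition. -/
notation:70 f:71 " ⊠ " g:70 => Diag.tensor f g

open Diag

/-! ### Auxiliary diagrams -/

/-- A phase-free spider. -/
def spider₀ (x : Colour) (n : ℕ+) (k l : ℕ) : Diag (copies k n) (copies l n) :=
  spider x n k l 0

/-- A spider on single-qubit wires. -/
def spider₁ (x : Colour) (k l : ℕ) (α : ℝ) : Diag (copies k 1) (copies l 1) :=
  spider x 1 k l (fun _ => α)

/-- A state of colour `x` plugged into an effect of the other colour, on a wire of size `n`.
For `n = 1` its value is `(1 + e^{iα} + e^{iβ} - e^{i(α+β)}) / √2`; for zero phases it is `√2 ^ n`. -/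
def dumbbell (x : Colour) (n : ℕ+) (α β : Fin n → ℝ) : Diag [] [] :=
  spider x n 0 1 α ⨟ spider x.other n 1 0 β

/-- The scalar `(1/√2) ^ n`. -/
def tripleEdge (n : ℕ+) : Diag [] [] :=
  spider₀ .green n 0 3 ⨟ spider₀ .red n 3 0

/-- `k` Hadamard boxes of size `n` in parallel. -/
def hads (n : ℕ+) : (k : ℕ) → Diag (copies k n) (copies k n)
  | 0 => wires []
  | k + 1 => had n ⊠ hads n k

/-- Divide each of `k` wires of size `n + 1`; the `k` wires of size `1` come first, in order,
followed by the `k` wires of size `n`, in order. -/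
def dividers (n : ℕ+) : (k : ℕ) → Diag (copies k (n + 1)) (copies k 1 ++ copies k n)
  | 0 => wires []
  | k + 1 =>
      Diag.comp (divider n ⊠ dividers n k) (wires [1] ⊠ swap [n] (copies k 1) ⊠ wires (copies k n))
        (by simp) |>.comp (wires (copies (k + 1) 1 ++ copies (k + 1) n))
        (by simp [List.replicate_succ])

/-- The divider `1_{n+1} ⟶ 1 + 1_n`; it is the identity when `n = 0`. -/
def dividerReg : (n : ℕ) → Diag (reg (n + 1)) ([1] ++ reg n)
  | 0 => wires [1]
  | n + 1 => divider n.succPNat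

/-- The gatherer `1 + 1_n ⟶ 1_{n+1}`; it is the identity when `n = 0`. -/
def gathererReg : (n : ℕ) → Diag ([1] ++ reg n) (reg (n + 1))
  | 0 => wires [1]
  | n + 1 => gatherer n.succPNat

/-- Generalised divider `1_{k+s} ⟶ 1_k + 1_s`. -/
def divide : (k s : ℕ) → Diag (reg (k + s)) (reg k ++ reg s)
  | 0, s => Diag.comp (wires (reg (0 + s))) (wires (reg s)) (by rw [Nat.zero_add])
  | k + 1, s =>
      Diag.comp (wires (reg (k + 1 + s))) (dividerReg (k + s)) (by rw [Nat.add_right_comm])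
        ⨟ (wires [1] ⊠ divide k s)
        ⨟ (gathererReg k ⊠ wires (reg s))

/-- Generalised gatherer `1_k + 1_s ⟶ 1_{k+s}`. -/
def gather : (k s : ℕ) → Diag (reg k ++ reg s) (reg (k + s))
  | 0, s => Diag.comp (wires (reg s)) (wires (reg (0 + s))) (by rw [Nat.zero_add])
  | k + 1, s =>
      Diag.comp
        ((dividerReg k ⊠ wires (reg s)) ⨟ (wires [1] ⊠ gather k s) ⨟ gathererReg (k + s))
        (wires (reg (k + 1 + s))) (by rw [Nat.add_right_comm])

/-- The block matrix with `A` above `B`. -/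
def rowBlock {a b n : ℕ+} (A : Matrix (Fin a) (Fin n) (ZMod 2)) (B : Matrix (Fin b) (Fin n) (ZMod 2)) :
    Matrix (Fin (a + b : ℕ+)) (Fin n) (ZMod 2) :=
  Matrix.of fun i => Fin.append A B i

/-- The block matrix with `C` to the left of `D`. -/
def colBlock {m c d : ℕ+} (C : Matrix (Fin m) (Fin c) (ZMod 2)) (D : Matrix (Fin m) (Fin d) (ZMod 2)) :
    Matrix (Fin m) (Fin (c + d : ℕ+)) (ZMod 2) :=
  Matrix.of fun i => Fin.append (C i) (D i)

/-! ### The angles of the Euler rule -/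

noncomputable def eulerZ (α₁ α₂ : ℝ) : ℂ :=
  ⟨-Real.sin ((α₁ + α₂) / 2), Real.cos ((α₁ + α₂) / 2 - α₂)⟩

noncomputable def eulerZ' (α₁ α₂ : ℝ) : ℂ :=
  ⟨Real.cos ((α₁ + α₂) / 2), -Real.sin ((α₁ + α₂) / 2 - α₂)⟩

noncomputable def eulerβ₁ (α₁ α₂ : ℝ) : ℝ :=
  (eulerZ α₁ α₂).arg + (eulerZ' α₁ α₂).arg

open Classical in
noncomputable def eulerβ₂ (α₁ α₂ : ℝ) : ℝ :=
  if eulerZ' α₁ α₂ = 0 then 0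
  else 2 * (Complex.I + (‖eulerZ α₁ α₂ / eulerZ' α₁ α₂‖ : ℝ)).arg

noncomputable def eulerβ₃ (α₁ α₂ : ℝ) : ℝ :=
  (eulerZ α₁ α₂).arg - (eulerZ' α₁ α₂).arg

noncomputable def eulerγ (α₁ α₂ : ℝ) : ℝ :=
  (α₁ + α₂) / 2 - (eulerZ α₁ α₂).arg + (π - eulerβ₂ α₁ α₂) / 2

/-! ### The calculus -/

/-- `Derives D D'`: the equation `D = D'` is derivable in the SZX-calculus with matrices.

As types form a (strictly associative) free monoid, the relation is stated between diagrams whose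
types may be written differently; derivably equal diagrams have equal types, see `Derives.types_eq`.

Every rule with a colour `x` is thereby stated together with its colour-swapped version. -/
inductive Derives : {a b a' b' : Ty} → Diag a b → Diag a' b' → Prop
  -- equational reasoning
  | refl {a b : Ty} (f : Diag a b) : Derives f f
  | symm {a b a' b' : Ty} {f : Diag a b} {f' : Diag a' b'} : Derives f f' → Derives f' f
  | trans {a b a' b' a'' b'' : Ty} {f : Diag a b} {f' : Diag a' b'} {f'' : Diag a'' b''} :
      Derives f f' → Derives f' f'' → Derives f f''
  | comp_congr {a b b₁ c a' b' b₁' c' : Ty} {f : Diag a b} {g : Diag b₁ c}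
      {f' : Diag a' b'} {g' : Diag b₁' c'} (h : b = b₁) (h' : b' = b₁') :
      Derives f f' → Derives g g' → Derives (f.comp g h) (f'.comp g' h')
  | tensor_congr {a b c d a' b' c' d' : Ty} {f : Diag a b} {g : Diag c d}
      {f' : Diag a' b'} {g' : Diag c' d'} :
      Derives f f' → Derives g g' → Derives (f ⊠ g) (f' ⊠ g')
  -- strict symmetric monoidal structure
  | id_comp {a b c : Ty} (f : Diag b c) (h : a = b) : Derives ((wires a).comp f h) f
  | comp_id {a b c : Ty} (f : Diag a b) (h : b = c) : Derives (f.comp (wires c) h) f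
  | comp_assoc {a b b' c c' d : Ty} (f : Diag a b) (g : Diag b' c) (k : Diag c' d)
      (h₁ : b = b') (h₂ : c = c') :
      Derives ((f.comp g h₁).comp k h₂) (f.comp (g.comp k h₂) h₁)
  | id_tensor_id (a b : Ty) : Derives (wires a ⊠ wires b) (wires (a ++ b))
  | nil_tensor {a b : Ty} (f : Diag a b) : Derives (wires [] ⊠ f) f
  | tensor_nil {a b : Ty} (f : Diag a b) : Derives (f ⊠ wires []) f
  | tensor_assoc {a b c d e e' : Ty} (f : Diag a b) (g : Diag c d) (k : Diag e e') :
      Derives ((f ⊠ g) ⊠ k) (f ⊠ (g ⊠ k))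
  | interchange {a b b' c p q q' r : Ty} (f : Diag a b) (f' : Diag b' c) (g : Diag p q)
      (g' : Diag q' r) (h₁ : b = b') (h₂ : q = q') :
      Derives ((f ⊠ g).comp (f' ⊠ g') (by rw [h₁, h₂])) (f.comp f' h₁ ⊠ g.comp g' h₂)
  | swap_nil (a : Ty) : Derives (swap a []) (wires a)
  | swap_append (a b c : Ty) :
      Derives (swap a (b ++ c))
        ((swap a b ⊠ wires c).comp (wires b ⊠ swap a c) (List.append_assoc b a c))
  | swap_swap (a b : Ty) : Derives (swap a b ⨟ swap b a) (wires (a ++ b))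
  | swap_natural {a b c d : Ty} (f : Diag a b) (g : Diag c d) :
      Derives ((f ⊠ g) ⨟ swap b d) (swap a c ⨟ (g ⊠ f))
  -- only topology matters: cups, caps and the legs of spiders
  | cup_swap (n : ℕ+) : Derives (cup n ⨟ swap [n] [n]) (cup n)
  | swap_cap (n : ℕ+) : Derives (swap [n] [n] ⨟ cap n) (cap n)
  | snake_left (n : ℕ+) : Derives ((wires [n] ⊠ cup n) ⨟ (cap n ⊠ wires [n])) (wires [n])
  | snake_right (n : ℕ+) : Derives ((cup n ⊠ wires [n]) ⨟ (wires [n] ⊠ cap n)) (wires [n])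
  | spider_swap_out (x : Colour) (n : ℕ+) (k i j : ℕ) (α : Fin n → ℝ) :
      Derives
        ((spider x n k (i + 2 + j) α).comp
          (wires (copies i n) ⊠ swap [n] [n] ⊠ wires (copies j n))
          (by simp [copies, List.replicate_add]))
        (spider x n k (i + 2 + j) α)
  | spider_swap_in (x : Colour) (n : ℕ+) (i j l : ℕ) (α : Fin n → ℝ) :
      Derives
        ((wires (copies i n) ⊠ swap [n] [n] ⊠ wires (copies j n)).comp
          (spider x n (i + 2 + j) l α)
          (by simp [copies, List.replicate_add]))
        (spider x n (i + 2 + j) l α)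
  | spider_bend_in (x : Colour) (n : ℕ+) (k l : ℕ) (α : Fin n → ℝ) :
      Derives
        ((spider x n k (l + 1) α ⊠ wires [n]).comp (wires (copies l n) ⊠ cap n)
          (by simp [copies, List.replicate_add]))
        (spider x n (k + 1) l α)
  | spider_bend_out (x : Colour) (n : ℕ+) (k l : ℕ) (α : Fin n → ℝ) :
      Derives
        ((wires (copies k n) ⊠ cup n).comp (spider x n (k + 1) l α ⊠ wires [n])
          (by simp [copies, List.replicate_add]))
        (spider x n k (l + 1) α)
  -- elimination and expansion
  | elim (n : ℕ+) : Derives (gatherer n ⨟ divider n) (wires [1, n])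
  | expand (n : ℕ+) : Derives (divider n ⨟ gatherer n) (wires [n + 1])
  -- distribution of dividers and gatherers
  | cup_dist (n : ℕ+) :
      Derives (cup (n + 1) ⨟ (divider n ⊠ divider n))
        ((cup 1 ⊠ cup n) ⨟ (wires [1] ⊠ swap [1] [n] ⊠ wires [n]))
  | cap_dist (n : ℕ+) :
      Derives ((gatherer n ⊠ gatherer n) ⨟ cap (n + 1))
        ((wires [1] ⊠ swap [n] [1] ⊠ wires [n]) ⨟ (cap 1 ⊠ cap n))
  | spider_dist (x : Colour) (n : ℕ+) (k l : ℕ) (α : ℝ) (β : Fin n → ℝ) :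
      Derives
        (spider x (n + 1) k l (Fin.cons (α := fun _ => ℝ) α β : Fin (n + 1) → ℝ) ⨟ dividers n l)
        (dividers n k ⨟ (spider₁ x k l α ⊠ spider x n k l β))
  | had_dist (n : ℕ+) :
      Derives (had (n + 1) ⨟ divider n) (divider n ⨟ (had 1 ⊠ had n))
  -- fusion of two spiders connected by `j + 1` wires
  | spider_fusion (x : Colour) (n : ℕ+) (k l j m p : ℕ) (α β : Fin n → ℝ) :
      Derives
        ((spider x n k (l + (j + 1)) α ⊠ wires (copies m n)).comp
          (wires (copies l n) ⊠ spider x n ((j + 1) + m) p β)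
          (by simp only [copies, List.replicate_add, List.append_assoc]))
        (spider x n (k + m) (l + p) (α + β))
  | spider_id (x : Colour) (n : ℕ+) : Derives (spider₀ x n 1 1) (wires [n])
  | colour_change (x : Colour) (n : ℕ+) (k l : ℕ) (α : Fin n → ℝ) :
      Derives (hads n k ⨟ spider x n k l α ⨟ hads n l) (spider x.other n k l α)
  | copy (x : Colour) :
      Derives (dumbbell x 1 0 0 ⊠ (spider₀ x.other 1 0 1 ⨟ spider₀ x 1 1 2))
        (spider₀ x.other 1 0 1 ⊠ spider₀ x.other 1 0 1)
  | bialgebra (x : Colour) :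
      Derives
        (dumbbell x 1 0 0 ⊠
          ((spider₀ x 1 1 2 ⊠ spider₀ x 1 1 2) ⨟ (wires [1] ⊠ swap [1] [1] ⊠ wires [1])
            ⨟ (spider₀ x.other 1 2 1 ⊠ spider₀ x.other 1 2 1)))
        (spider₀ x.other 1 2 1 ⨟ spider₀ x 1 1 2)
  | scalar (x : Colour) :
      Derives (dumbbell x 1 (fun _ => π / 4) (fun _ => -(π / 4))) (wires [])
  | euler (x : Colour) (α₁ α₂ : ℝ) :
      Derives
        (dumbbell x 1 0 0 ⊠ (spider₁ x 1 1 α₁ ⨟ had 1 ⨟ spider₁ x 1 1 α₂))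
        (dumbbell x 1 (fun _ => eulerγ α₁ α₂) (fun _ => π) ⊠
          (spider₁ x.other 1 1 (eulerβ₁ α₁ α₂) ⨟ spider₁ x 1 1 (eulerβ₂ α₁ α₂)
            ⨟ spider₁ x.other 1 1 (eulerβ₃ α₁ α₂)))
  -- matrices
  | matrix_zero :
      Derives (matrix (0 : Matrix (Fin (1 : ℕ+)) (Fin (1 : ℕ+)) (ZMod 2)))
        (tripleEdge 1 ⊠ (spider₀ .green 1 1 0 ⨟ spider₀ .red 1 0 1))
  | matrix_one :
      Derives (matrix (1 : Matrix (Fin (1 : ℕ+)) (Fin (1 : ℕ+)) (ZMod 2))) (wires [1])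
  | matrix_rows {a b n : ℕ+} (A : Matrix (Fin a) (Fin n) (ZMod 2))
      (B : Matrix (Fin b) (Fin n) (ZMod 2)) :
      Derives ((matrix (rowBlock A B)).comp (divide a b) (reg_coe (a + b)).symm)
        (spider₀ .green n 1 2 ⨟ (matrix A ⊠ matrix B))
  | matrix_cols {m c d : ℕ+} (C : Matrix (Fin m) (Fin c) (ZMod 2))
      (D : Matrix (Fin m) (Fin d) (ZMod 2)) :
      Derives ((gather c d).comp (matrix (colBlock C D)) (reg_coe (c + d)))
        (dumbbell .green m 0 0 ⊠ ((matrix C ⊠ matrix D) ⨟ spider₀ .red m 2 1))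

theorem Derives.types_eq {a b a' b' : Ty} {f : Diag a b} {f' : Diag a' b'} (h : Derives f f') :
    a = a' ∧ b = b' := by
  induction h with
  | spider_swap_out | spider_swap_in =>
    constructor <;> simp [copies, List.eq_replicate_iff] <;> grind
  | spider_bend_in | spider_bend_out =>
    constructor <;> simp [copies, List.eq_replicate_iff] <;> grind
  | _ => simp_all [copies, reg_coe, List.replicate_succ, List.replicate_append_replicate]

/-! ### Graph state boxes -/

/-- Hadamard box on `1_n`, empty for `n = 0`. -/
def hadReg : (n : ℕ) → Diag (reg n) (reg n)
  | 0 => wires []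
  | n + 1 => had n.succPNat

/-- Green spider `1_n + 1_n ⟶ 1_n`, empty for `n = 0`. -/
def mergeReg : (n : ℕ) → Diag (reg n ++ reg n) (reg n)
  | 0 => wires []
  | n + 1 => spider₀ .green n.succPNat 2 1

/-- The scalar `√2 ^ n`, empty for `n = 0`. -/
def sqrtTwoPow : ℕ → Diag [] []
  | 0 => wires []
  | n + 1 => dumbbell .green n.succPNat 0 0

/-- The matrix box `1_n ⟶ 1_m`, denoting `|x⟩ ↦ |A x⟩`, including the matrices with no row or no
column. -/
def matrixReg : {m n : ℕ} → Matrix (Fin m) (Fin n) (ZMod 2) → Diag (reg n) (reg m)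
  | 0, 0, _ => wires []
  | 0, n + 1, _ => spider₀ .green n.succPNat 1 0
  | m + 1, 0, _ => tripleEdge m.succPNat ⊠ spider₀ .red m.succPNat 0 1
  | _ + 1, n + 1, A => matrix (n := n.succPNat) (m := Nat.succPNat _) A

/-- The box of a permutation: qubit number `v` becomes qubit number `τ v`. -/
def permReg {m n : ℕ} (τ : Fin n ≃ Fin m) : Diag (reg n) (reg m) :=
  matrixReg (Matrix.of fun i j => if τ j = i then 1 else 0)

/-- The box of the one-vertex graph: a green dot, normalised by `1/√2`. -/
def boxK₁ : Diag [] (reg 1) :=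
  tripleEdge 1 ⊠ spider₀ .green 1 0 1

/-- The all-ones matrix. -/
def allOnes (m n : ℕ) : Matrix (Fin m) (Fin n) (ZMod 2) := Matrix.of fun _ _ => 1

/-- One step of the construction of graph state boxes.  A new first vertex `u`, with `k` neighbours
and `s` non-neighbours, is added to a box `D` on `n` qubits; `τ` puts the neighbours of `u` first.
The green dot of `u` is connected to the register of its neighbours through the all-ones matrix
and a Hadamard box; then the original order of the vertices is restored. -/
def boxStep {n k s : ℕ} (τ : Fin n ≃ Fin (k + s)) (D : Diag [] (reg n)) : Diag [] (reg (n + 1)) :=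
  tripleEdge 1 ⊠ sqrtTwoPow k ⊠
    (((spider₀ .green 1 0 2 ⨟ (wires [1] ⊠ (matrixReg (allOnes k 1) ⨟ hadReg k))) ⊠
        (D ⨟ permReg τ ⨟ divide k s)).comp
      (wires [1] ⊠ (mergeReg k ⊠ wires (reg s))) (by simp)
    ⨟ (wires [1] ⊠ (gather k s ⨟ permReg τ.symm))
    ⨟ gathererReg n)

/-- `IsGraphStateBox G D`: the diagram `D` is a graph state box of the graph `G`, whose vertices are
`0 < 1 < ⋯`.  The permutations `τ` may be chosen freely among those that put the neighbourhood of the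
first vertex first. -/
inductive IsGraphStateBox : {n : ℕ} → SimpleGraph (Fin n) → Diag [] (reg n) → Prop
  | single (G : SimpleGraph (Fin 1)) : IsGraphStateBox G boxK₁
  | step {n k s : ℕ} (G : SimpleGraph (Fin (n + 1))) (τ : Fin n ≃ Fin (k + s))
      (hτ : ∀ v : Fin n, G.Adj 0 v.succ ↔ (τ v : ℕ) < k) (D : Diag [] (reg n))
      (hD : IsGraphStateBox (G.comap Fin.succ) D) : IsGraphStateBox G (boxStep τ D)

theorem exists_order {n : ℕ} (p : Fin n → Prop) :
    ∃ (k s : ℕ) (τ : Fin n ≃ Fin (k + s)), ∀ v, p v ↔ (τ v : ℕ) < k := by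
  classical
  refine ⟨Fintype.card {v // p v}, Fintype.card {v // ¬ p v},
    (Equiv.sumCompl p).symm.trans
      ((Equiv.sumCongr (Fintype.equivFin _) (Fintype.equivFin _)).trans finSumFinEquiv), ?_⟩
  intro v
  by_cases h : p v
  · simp [h, Equiv.sumCompl_symm_apply_of_pos]
  · simp [h, Equiv.sumCompl_symm_apply_of_neg]

/-- Every non-empty graph has a graph state box. -/
theorem exists_isGraphStateBox {n : ℕ} (G : SimpleGraph (Fin (n + 1))) :
    ∃ D, IsGraphStateBox G D := by
  induction n with
  | zero => exact ⟨_, .single G⟩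
  | succ n ih =>
    obtain ⟨D, hD⟩ := ih (G.comap Fin.succ)
    obtain ⟨k, s, τ, hτ⟩ := exists_order fun v => G.Adj 0 v.succ
    exact ⟨_, .step G τ hτ D hD⟩

/-- The local complement `G ⋆ u`: the edges between neighbours of `u` are complemented. -/
def localComplement {V : Type*} (G : SimpleGraph V) (u : V) : SimpleGraph V where
  Adj v w := v ≠ w ∧ Xor (G.Adj v w) (G.Adj u v ∧ G.Adj u w)
  symm := ⟨fun v w ⟨h, h'⟩ => ⟨h.symm, by
    rwa [G.adj_comm w v, and_comm (a := G.Adj u w)]⟩⟩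
  loopless := ⟨fun _ h => h.1 rfl⟩

/-- The phase vector with `θ` on the vertices of `S` and `0` elsewhere. -/
noncomputable def phaseOn {V : Type*} (S : Set V) (θ : ℝ) : V → ℝ :=
  S.indicator fun _ => θ

end SZX

/-!
# Local complementation of graph state boxes

Diagrams modulo derivable equality form a symmetric monoidal category, in which derivations become
computations with morphisms.  The green spiders make every register a commutative comonoid, so that
maps that commute with copying behave as functions between sets of bit strings: such a map into a
tensor product, or into a register, is determined by its components (`hom_ext`, `hom_ext_coord`),
and effects on a register are multiplied pointwise, as functions on bit strings.

The copyable maps from an object to one qubit (`Form`) play the part of functions with values in the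
field with two elements.  They are added by the red spider, which is a comonoid homomorphism up to
the invertible scalar `√2` (`exists_root_mul_eq_one`); the bialgebra law gives the Hopf law
`addF_self`, that is, `x + x = 0`.  Matrix boxes act on coordinates as matrices
(`isMatrix_matrixReg`).  A wire with a Hadamard box between two bits is, up to `√2`, a controlled `Z`
gate `cz`, and it is bilinear as the Hadamard box exchanges the two colours (`cz_addF`).

Bending the output wire of a state turns it into an effect without loss of information
(`eq_of_toEffect_eq`).  The effect of a graph state box of `G` with `n` vertices is `(1/√2) ^ n`
times the product `graphEff G` of the controlled `Z` gates on the edges of `G` (`toEffect_box`), each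
step of the construction adding the edges at the new vertex (`toEffect_boxStep`).  The rotations of
the theorem now act on this effect.

* A red rotation of the vertex `u` adds an auxiliary bit `y`, in a red state of phase `θ`, to the bit
  of `u` (`xR_single`).  By bilinearity this multiplies the controlled `Z` gates by one between `y`
  and the sum of the neighbours of `u` (`shift_comp_graphEff`), and plugging in the red state leaves
  the phase `θ` on this sum (`redState_cz`, `xR_phaseOn_comp`).
* For quarter turns, the phase of a sum and the opposite phases of its terms combine to the
  controlled `Z` gates between all pairs of terms (`Form.phase_sum`).  For two bits this is
  `phase_addF`, which is the Euler rule for the angles `(-π/2, -π/2)` in another shape.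
* Since controlled `Z` gates are involutions, multiplying by those between neighbours of `u`
  complements the edges between them (`graphEff_localComplement`).

No scalar is left over: the green effects of quarter turns give no phase to a zero bit
(`zeroPhase_pi_div_two`), and the scalar `eulerScalar` of the Euler rule cancels.  The former comes
from the Euler rules for the angles `(π, π/4)` and `(π, 0)`, whose right-hand sides differ by a red
rotation and a scalar, and which are compared after plugging in red and green dots
(`eulerScalar_scale`, `zeroPhase_pi_div_four`).
-/

namespace SZX

set_option linter.unusedSectionVars false

open Diag CategoryTheory MonoidalCategory

/-! ### The symmetric monoidal category of diagrams modulo derivability -/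

/-- Types of the calculus, as objects of the category of diagrams modulo derivable equality. -/
structure Obj : Type where
  ty : Ty

/-- Derivable equality of parallel diagrams. -/
def derivSetoid (a b : Ty) : Setoid (Diag a b) where
  r f g := Derives f g
  iseqv := ⟨fun f => .refl f, fun h => h.symm, fun h h' => h.trans h'⟩

instance : CategoryStruct Obj where
  Hom X Y := Quotient (derivSetoid X.ty Y.ty)
  id X := Quotient.mk _ (wires X.ty)
  comp := Quotient.map₂ (fun f g => f.comp g rfl) fun _ _ h _ _ h' => .comp_congr rfl rfl h h'

/-- The class of a diagram. -/
def mk {a b : Ty} (f : Diag a b) : Obj.mk a ⟶ Obj.mk b := Quotient.mk (derivSetoid a b) f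

theorem mk_eq_iff {a b : Ty} {f g : Diag a b} : mk f = mk g ↔ Derives f g :=
  ⟨fun h => Quotient.exact (s := derivSetoid a b) h,
    fun h => Quotient.sound (s := derivSetoid a b) h⟩

theorem mk_surj {X Y : Obj} (f : X ⟶ Y) : ∃ d : Diag X.ty Y.ty, mk d = f :=
  Quotient.exists_rep (s := derivSetoid X.ty Y.ty) f

instance : Category Obj where
  id_comp f := by
    obtain ⟨d, rfl⟩ := mk_surj f
    exact mk_eq_iff.2 (.id_comp d rfl)
  comp_id f := by
    obtain ⟨d, rfl⟩ := mk_surj f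
    exact mk_eq_iff.2 (.comp_id d rfl)
  assoc f g h := by
    obtain ⟨f, rfl⟩ := mk_surj f
    obtain ⟨g, rfl⟩ := mk_surj g
    obtain ⟨h, rfl⟩ := mk_surj h
    exact mk_eq_iff.2 (.comp_assoc f g h rfl rfl)

theorem mk_comp {a b c : Ty} (f : Diag a b) (g : Diag b c) (h : b = b) :
    mk (f.comp g h) = mk f ≫ mk g := rfl

theorem mk_wires (a : Ty) : mk (wires a) = 𝟙 (Obj.mk a) := rfl

/-- The identity diagram between two presentations of the same type. -/
def eqHom {a b : Ty} (h : a = b) : Obj.mk a ⟶ Obj.mk b := mk ((wires a).comp (wires b) h)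

@[simp] theorem eqHom_rfl {a : Ty} (h : a = a) : eqHom h = 𝟙 (Obj.mk a) := by
  exact mk_eq_iff.2 (.id_comp _ rfl)

@[simp]
theorem eqHom_trans {a b c : Ty} (h : a = b) (h' : b = c) :
    eqHom h ≫ eqHom h' = eqHom (h.trans h') := by
  subst h h'; simp

theorem mk_comp_eqHom {a b b' c : Ty} (f : Diag a b) (g : Diag b' c) (h : b = b') :
    mk (f.comp g h) = mk f ≫ eqHom h ≫ mk g := by
  subst h; simp [mk_comp]

/-- A derivation between diagrams whose types are presented differently. -/
theorem Derives.mk_eq {a b a' b' : Ty} {f : Diag a b} {f' : Diag a' b'} (h : Derives f f')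
    (ha : a = a') (hb : b' = b) : mk f = eqHom ha ≫ mk f' ≫ eqHom hb := by
  subst ha hb; simpa using mk_eq_iff.2 h

/-- A diagram that is derivably an identity. -/
def IsWires {a b : Ty} (f : Diag a b) : Prop := Derives f (wires a)

theorem IsWires.wires (a : Ty) : IsWires (Diag.wires a) := .refl _

theorem IsWires.comp {a b b' c : Ty} {f : Diag a b} {g : Diag b' c} (hf : IsWires f)
    (hg : IsWires g) (h : b = b') : IsWires (f.comp g h) := by
  have e := hf.types_eq.2
  subst h e
  exact (Derives.comp_congr rfl rfl hf hg).trans (.id_comp _ rfl)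

theorem IsWires.tensor {a b c d : Ty} {f : Diag a b} {g : Diag c d} (hf : IsWires f)
    (hg : IsWires g) : IsWires (f ⊠ g) :=
  (Derives.tensor_congr hf hg).trans (.id_tensor_id _ _)

theorem IsWires.eqWires {a b : Ty} (h : a = b) :
    IsWires ((Diag.wires a).comp (Diag.wires b) h) :=
  (IsWires.wires a).comp (.wires b) h

theorem IsWires.mk_eq {a b : Ty} {f g : Diag a b} (hf : IsWires f) (hg : IsWires g) :
    mk f = mk g := mk_eq_iff.2 (hf.trans hg.symm)

/-- The isomorphism between two presentations of the same type. -/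
def eqIso {a b : Ty} (h : a = b) : Obj.mk a ≅ Obj.mk b where
  hom := eqHom h
  inv := eqHom h.symm

theorem tensor_wd {a b c d : Ty} {f f' : Diag a b} {g g' : Diag c d}
    (h : Derives f f') (h' : Derives g g') : Derives (f ⊠ g) (f' ⊠ g') :=
  .tensor_congr h h'

instance : MonoidalCategoryStruct Obj where
  tensorObj X Y := ⟨X.ty ++ Y.ty⟩
  tensorUnit := ⟨[]⟩
  tensorHom := Quotient.map₂ (fun f g => f ⊠ g) fun _ _ h _ _ h' => tensor_wd h h'
  whiskerLeft X _ _ := Quotient.map (fun f => wires X.ty ⊠ f) fun _ _ h => tensor_wd (.refl _) h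
  whiskerRight f Y := Quotient.map (fun f => f ⊠ wires Y.ty) (fun _ _ h => tensor_wd h (.refl _)) f
  associator X Y Z := eqIso (List.append_assoc X.ty Y.ty Z.ty)
  leftUnitor X := eqIso (List.nil_append X.ty)
  rightUnitor X := eqIso (List.append_nil X.ty)

/-- Derivable equality up to identities before and after. -/
theorem mk_comp_wires_eq {a b b' c p q q' r : Ty} {f : Diag a b} {w : Diag b' c} {w' : Diag p q}
    {g : Diag q' r} (hw : IsWires w) (hw' : IsWires w') (h : b = b') (h' : q = q')
    (hfg : Derives f g) : Derives (f.comp w h) (w'.comp g h') := by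
  have e := hw'.types_eq.2
  subst h h' e
  exact (((Derives.comp_congr rfl rfl (.refl f) hw).trans (.comp_id _ rfl)).trans hfg).trans
    ((Derives.comp_congr rfl rfl hw' (.refl g)).trans (.id_comp _ rfl)).symm

instance : MonoidalCategory Obj :=
  MonoidalCategory.ofTensorHom
    (id_tensorHom_id := fun X Y => mk_eq_iff.2 (.id_tensor_id _ _))
    (id_tensorHom := fun X _ _ f => by
      obtain ⟨f, rfl⟩ := mk_surj f
      rfl)
    (tensorHom_id := fun f Y => by
      obtain ⟨f, rfl⟩ := mk_surj f
      rfl)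
    (tensorHom_comp_tensorHom := fun f f' g g' => by
      obtain ⟨f, rfl⟩ := mk_surj f
      obtain ⟨g, rfl⟩ := mk_surj g
      obtain ⟨f', rfl⟩ := mk_surj f'
      obtain ⟨g', rfl⟩ := mk_surj g'
      exact mk_eq_iff.2 (.interchange _ _ _ _ rfl rfl))
    (associator_naturality := fun f g h => by
      obtain ⟨f, rfl⟩ := mk_surj f
      obtain ⟨g, rfl⟩ := mk_surj g
      obtain ⟨h, rfl⟩ := mk_surj h
      exact mk_eq_iff.2 (mk_comp_wires_eq (.eqWires _) (.eqWires _) rfl rfl (.tensor_assoc _ _ _)))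
    (leftUnitor_naturality := fun f => by
      obtain ⟨f, rfl⟩ := mk_surj f
      exact mk_eq_iff.2 (mk_comp_wires_eq (.eqWires _) (.eqWires _) rfl rfl (.nil_tensor _)))
    (rightUnitor_naturality := fun f => by
      obtain ⟨f, rfl⟩ := mk_surj f
      exact mk_eq_iff.2 (mk_comp_wires_eq (.eqWires _) (.eqWires _) rfl rfl (.tensor_nil _)))
    (pentagon := fun W X Y Z => by
      refine IsWires.mk_eq (f := Diag.comp (_ ⊠ _) (Diag.comp _ (_ ⊠ _) rfl) rfl)
        (g := Diag.comp _ _ rfl) ?_ ?_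
      · exact ((IsWires.eqWires _).tensor (.wires _)).comp
          ((IsWires.eqWires _).comp ((IsWires.wires _).tensor (.eqWires _)) rfl) rfl
      · exact (IsWires.eqWires _).comp (.eqWires _) rfl)
    (triangle := fun X Y => by
      refine IsWires.mk_eq (f := Diag.comp _ (_ ⊠ _) rfl) (g := _ ⊠ _) ?_ ?_
      · exact (IsWires.eqWires _).comp ((IsWires.wires _).tensor (.eqWires _)) rfl
      · exact (IsWires.eqWires _).tensor (.wires _))

theorem whiskerLeft_eqHom {a b : Ty} (h : a = b) (c : Ty) :
    (Obj.mk c ◁ eqHom h : Obj.mk c ⊗ Obj.mk a ⟶ Obj.mk c ⊗ Obj.mk b) = eqHom (by rw [h]) := by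
  subst h
  rw [eqHom_rfl, MonoidalCategory.whiskerLeft_id]
  exact (eqHom_rfl _).symm

theorem leftUnitor_hom_eq (a : Ty) : (λ_ (Obj.mk a)).hom = eqHom (List.nil_append a) := rfl

theorem leftUnitor_inv_eq (a : Ty) : (λ_ (Obj.mk a)).inv = eqHom (List.nil_append a).symm := rfl

/-- The symmetry isomorphism. -/
def swapIso (X Y : Obj) : X ⊗ Y ≅ Y ⊗ X where
  hom := mk (swap X.ty Y.ty)
  inv := mk (swap Y.ty X.ty)
  hom_inv_id := mk_eq_iff.2 (.swap_swap _ _)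
  inv_hom_id := mk_eq_iff.2 (.swap_swap _ _)

theorem swapIso_hom_natural {X X' Y Y' : Obj} (f : X ⟶ X') (g : Y ⟶ Y') :
    (f ⊗ₘ g) ≫ (swapIso X' Y').hom = (swapIso X Y).hom ≫ (g ⊗ₘ f) := by
  obtain ⟨f, rfl⟩ := mk_surj f
  obtain ⟨g, rfl⟩ := mk_surj g
  exact mk_eq_iff.2 (.swap_natural f g)

theorem swapIso_hexagon (X Y Z : Obj) :
    (α_ X Y Z).hom ≫ (swapIso X (Y ⊗ Z)).hom ≫ (α_ Y Z X).hom =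
      ((swapIso X Y).hom ▷ Z) ≫ (α_ Y X Z).hom ≫ (Y ◁ (swapIso X Z).hom) := by
  have h := (Derives.swap_append X.ty Y.ty Z.ty).mk_eq (List.append_assoc _ _ _).symm
    (List.append_assoc _ _ _).symm
  rw [mk_comp_eqHom] at h
  change (swapIso X (Y ⊗ Z)).hom = (α_ X Y Z).inv ≫ (((swapIso X Y).hom ▷ Z) ≫
    (α_ Y X Z).hom ≫ (Y ◁ (swapIso X Z).hom)) ≫ (α_ Y Z X).inv at h
  rw [h]
  simp

instance : SymmetricCategory Obj where
  braiding := swapIso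
  braiding_naturality_right X _ _ f := by
    have := swapIso_hom_natural (𝟙 X) f
    simpa using this
  braiding_naturality_left f Z := by
    have := swapIso_hom_natural f (𝟙 Z)
    simpa using this
  hexagon_forward := swapIso_hexagon
  hexagon_reverse X Y Z := by
    have h := congrArg Iso.inv (Iso.ext (swapIso_hexagon Z X Y) :
      (α_ Z X Y) ≪≫ (swapIso Z (X ⊗ Y)) ≪≫ (α_ X Y Z) =
        whiskerRightIso (swapIso Z X) Y ≪≫ (α_ X Z Y) ≪≫ whiskerLeftIso X (swapIso Z Y))
    simp only [Iso.trans_inv, whiskerRightIso_inv, whiskerLeftIso_inv, Category.assoc] at h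
    exact h
  symmetry X Y := (swapIso X Y).hom_inv_id

/-! ### Copying and discarding -/

section Comonoid

open scoped ComonObj

attribute [local instance] ComonObj.instTensorUnit

variable {C : Type*} [Category C] [MonoidalCategory C] [SymmetricCategory C]

/-- Copy the input and feed the two copies to `f` and `g`. -/
def pair {X Y Z : C} [ComonObj X] (f : X ⟶ Y) (g : X ⟶ Z) : X ⟶ Y ⊗ Z := Δ[X] ≫ (f ⊗ₘ g)

/-- Discard the second component. -/
def fst (X Y : C) [ComonObj Y] : X ⊗ Y ⟶ X := X ◁ ε[Y] ≫ (ρ_ X).hom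

/-- Discard the first component. -/
def snd (X Y : C) [ComonObj X] : X ⊗ Y ⟶ Y := ε[X] ▷ Y ≫ (λ_ Y).hom

section

variable {X Y Z W V : C} [ComonObj X]

@[simp]
theorem pair_tensorHom (f : X ⟶ Y) (g : X ⟶ Z) (h : Y ⟶ W) (k : Z ⟶ V) :
    pair f g ≫ (h ⊗ₘ k) = pair (f ≫ h) (g ≫ k) := by
  simp [pair]

@[simp]
theorem pair_whiskerLeft (f : X ⟶ Y) (g : X ⟶ Z) (k : Z ⟶ V) :
    pair f g ≫ Y ◁ k = pair f (g ≫ k) := by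
  rw [← id_tensorHom, pair_tensorHom, Category.comp_id]

@[simp]
theorem pair_whiskerRight (f : X ⟶ Y) (g : X ⟶ Z) (h : Y ⟶ W) :
    pair f g ≫ h ▷ Z = pair (f ≫ h) g := by
  rw [← tensorHom_id, pair_tensorHom, Category.comp_id]

theorem pair_id_id : pair (𝟙 X) (𝟙 X) = Δ[X] := by simp [pair]

@[simp]
theorem comp_pair [ComonObj W] (h : W ⟶ X) [IsComonHom h] (f : X ⟶ Y) (g : X ⟶ Z) :
    h ≫ pair f g = pair (h ≫ f) (h ≫ g) := by
  simp [pair]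

theorem comp_comul [ComonObj W] (h : W ⟶ X) [IsComonHom h] : h ≫ Δ[X] = pair h h := by
  rw [← pair_id_id, comp_pair, Category.comp_id]

@[simp]
theorem pair_fst [ComonObj Z] (f : X ⟶ Y) (g : X ⟶ Z) [IsComonHom g] :
    pair f g ≫ fst Y Z = f := by
  rw [fst, reassoc_of% pair_whiskerLeft, IsComonHom.hom_counit, pair, Category.assoc,
    ComonObj.comul_counit_hom_assoc]
  simp

@[simp]
theorem pair_snd [ComonObj Y] (f : X ⟶ Y) (g : X ⟶ Z) [IsComonHom f] :
    pair f g ≫ snd Y Z = g := by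
  rw [snd, reassoc_of% pair_whiskerRight, IsComonHom.hom_counit, pair, Category.assoc,
    ComonObj.counit_comul_hom_assoc]
  simp

@[simp]
theorem pair_associator_hom (f : X ⟶ Y) (g : X ⟶ Z) (h : X ⟶ W) :
    pair (pair f g) h ≫ (α_ Y Z W).hom = pair f (pair g h) := by
  have h1 : pair (pair f g) h = Δ[X] ≫ Δ[X] ▷ X ≫ ((f ⊗ₘ g) ⊗ₘ h) := by
    simp only [pair, MonoidalCategory.tensorHom_def, comp_whiskerRight, Category.assoc]
  have h2 : pair f (pair g h) = Δ[X] ≫ X ◁ Δ[X] ≫ (f ⊗ₘ (g ⊗ₘ h)) := by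
    rw [pair, pair, ← id_tensorHom, tensorHom_comp_tensorHom, Category.id_comp]
  rw [h1, h2, Category.assoc, Category.assoc, associator_naturality, ComonObj.comul_assoc_assoc]

@[simp]
theorem pair_associator_inv (f : X ⟶ Y) (g : X ⟶ Z) (h : X ⟶ W) :
    pair f (pair g h) ≫ (α_ Y Z W).inv = pair (pair f g) h := by
  rw [← pair_associator_hom, Category.assoc, Iso.hom_inv_id, Category.comp_id]

variable [IsCommComonObj X]

@[simp]
theorem pair_braiding (f : X ⟶ Y) (g : X ⟶ Z) : pair f g ≫ (β_ Y Z).hom = pair g f := by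
  rw [pair, Category.assoc, BraidedCategory.braiding_naturality, IsCommComonObj.comul_comm_assoc,
    pair]

@[simp]
theorem pair_tensorμ (f : X ⟶ Y) (g : X ⟶ Z) (h : X ⟶ W) (k : X ⟶ V) :
    pair (pair f g) (pair h k) ≫ tensorμ Y Z W V = pair (pair f h) (pair g k) := by
  rw [tensorμ, reassoc_of% pair_associator_hom, reassoc_of% pair_whiskerLeft, pair_associator_inv,
    reassoc_of% pair_whiskerLeft, pair_whiskerRight, pair_braiding, reassoc_of% pair_whiskerLeft,
    pair_associator_hom, pair_associator_inv]

instance [ComonObj Y] [ComonObj Z] (f : X ⟶ Y) (g : X ⟶ Z) [IsComonHom f] [IsComonHom g] :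
    IsComonHom (pair f g) where
  hom_counit := by
    have : pair f g ≫ (ε[Y] ⊗ₘ ε[Z]) = ε[X] ≫ (λ_ (𝟙_ C)).inv := by
      rw [pair_tensorHom, IsComonHom.hom_counit, IsComonHom.hom_counit, pair,
        ComonObj.counit_comul_hom]
    rw [Comon.tensorObj_counit, reassoc_of% this]
    simp
  hom_comul := by
    rw [Comon.tensorObj_comul, reassoc_of% pair_tensorHom, comp_comul, comp_comul, pair_tensorμ]
    rfl

end

section

variable {X Y Z W : C} [ComonObj X] [ComonObj Y] [ComonObj Z] [ComonObj W]

instance : IsComonHom ε[X] where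
  hom_counit := by simp
  hom_comul := by simp [unitors_inv_equal]

instance (f : X ⟶ Y) (g : Z ⟶ W) [IsComonHom f] [IsComonHom g] : IsComonHom (f ⊗ₘ g) where
  hom_counit := by simp
  hom_comul := by
    rw [Comon.tensorObj_comul, Comon.tensorObj_comul, tensorHom_comp_tensorHom_assoc,
      IsComonHom.hom_comul, IsComonHom.hom_comul, Category.assoc, ← tensorμ_natural,
      tensorHom_comp_tensorHom_assoc]

instance (f : X ⟶ Y) [IsComonHom f] : IsComonHom (f ▷ Z) := by
  rw [← tensorHom_id]
  infer_instance

instance (f : X ⟶ Y) [IsComonHom f] : IsComonHom (Z ◁ f) := by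
  rw [← id_tensorHom]
  infer_instance

instance : IsComonHom (ρ_ X).hom where
  hom_counit := by simp [unitors_equal]
  hom_comul := by
    rw [Comon.tensorObj_comul, MonoidalCategory.tensorHom_def, Category.assoc, Category.assoc,
      ComonObj.instTensorUnit_comul, ← tensor_right_unitality, rightUnitor_naturality]

instance : IsComonHom (λ_ X).hom where
  hom_counit := by simp
  hom_comul := by
    rw [Comon.tensorObj_comul, MonoidalCategory.tensorHom_def', Category.assoc, Category.assoc,
      ComonObj.instTensorUnit_comul, ← tensor_left_unitality, leftUnitor_naturality]

instance : IsComonHom (fst X Y) := by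
  unfold fst
  infer_instance

instance : IsComonHom (snd X Y) := by
  unfold snd
  infer_instance

theorem pair_fst_snd : pair (fst X Y) (snd X Y) = 𝟙 (X ⊗ Y) := by
  have h : (Δ[X] ⊗ₘ Δ[Y]) ≫ ((𝟙 X ⊗ₘ ε[X]) ⊗ₘ (ε[Y] ⊗ₘ 𝟙 Y)) =
      ((ρ_ X).inv ⊗ₘ (λ_ Y).inv) := by
    simp [tensorHom_comp_tensorHom]
  have h' : tensorμ X X Y Y ≫ ((𝟙 X ⊗ₘ ε[Y]) ⊗ₘ (ε[X] ⊗ₘ 𝟙 Y)) =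
      ((𝟙 X ⊗ₘ ε[X]) ⊗ₘ (ε[Y] ⊗ₘ 𝟙 Y)) ≫ tensorμ _ _ _ _ := (tensorμ_natural _ _ _ _).symm
  calc pair (fst X Y) (snd X Y)
      = (Δ[X] ⊗ₘ Δ[Y]) ≫ tensorμ X X Y Y ≫ ((𝟙 X ⊗ₘ ε[Y]) ⊗ₘ (ε[X] ⊗ₘ 𝟙 Y)) ≫
          ((ρ_ X).hom ⊗ₘ (λ_ Y).hom) := by
        simp [pair, fst, snd]
    _ = ((ρ_ X).inv ⊗ₘ (λ_ Y).inv) ≫ tensorμ _ _ _ _ ≫ ((ρ_ X).hom ⊗ₘ (λ_ Y).hom) := by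
        rw [reassoc_of% h', reassoc_of% h]
    _ = 𝟙 _ := by
        simp only [tensorμ, braiding_tensorUnit_right]
        monoidal

/-- Copyable maps into a tensor product are determined by their components. -/
theorem hom_ext {f g : X ⟶ Y ⊗ Z} [IsComonHom f] [IsComonHom g]
    (h₁ : f ≫ fst Y Z = g ≫ fst Y Z) (h₂ : f ≫ snd Y Z = g ≫ snd Y Z) : f = g := by
  rw [← Category.comp_id f, ← Category.comp_id g, ← pair_fst_snd, comp_pair, comp_pair, h₁, h₂]

@[simp]
theorem tensorHom_fst {V : C} (f : X ⟶ V) (g : Z ⟶ W) [IsComonHom g] :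
    (f ⊗ₘ g) ≫ fst V W = fst X Z ≫ f := by
  simp [fst, MonoidalCategory.tensorHom_def, ← whisker_exchange_assoc, ← MonoidalCategory.whiskerLeft_comp_assoc]

@[simp]
theorem tensorHom_snd {V : C} (f : X ⟶ Y) (g : Z ⟶ V) [IsComonHom f] :
    (f ⊗ₘ g) ≫ snd Y V = snd X Z ≫ g := by
  simp [snd, MonoidalCategory.tensorHom_def', whisker_exchange_assoc, ← comp_whiskerRight_assoc]

@[simp]
theorem whiskerRight_fst {V : C} (f : X ⟶ V) : f ▷ Z ≫ fst V Z = fst X Z ≫ f := by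
  rw [← tensorHom_id, tensorHom_fst]

@[simp]
theorem whiskerRight_snd {V : C} (f : X ⟶ Y) [IsComonHom f] : f ▷ V ≫ snd Y V = snd X V := by
  simp [snd, ← comp_whiskerRight_assoc]

@[simp]
theorem whiskerLeft_fst {V : C} (g : Z ⟶ W) [IsComonHom g] : V ◁ g ≫ fst V W = fst V Z := by
  simp [fst, ← MonoidalCategory.whiskerLeft_comp_assoc]

@[simp]
theorem whiskerLeft_snd {V : C} (g : Z ⟶ V) : X ◁ g ≫ snd X V = snd X Z ≫ g := by
  rw [← id_tensorHom, tensorHom_snd]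

end

section

variable {X Y Z W : C} [ComonObj X] [ComonObj Y] [ComonObj Z] [ComonObj W]
  [IsCommComonObj X] [IsCommComonObj Y] [IsCommComonObj Z] [IsCommComonObj W]

theorem associator_hom_eq_pair : (α_ X Y Z).hom =
    pair (fst _ _ ≫ fst _ _) (pair (fst _ _ ≫ snd _ _) (snd _ _)) := by
  rw [← pair_associator_hom, ← comp_pair, pair_fst_snd, Category.comp_id, pair_fst_snd,
    Category.id_comp]

instance : IsComonHom (α_ X Y Z).hom := by
  rw [associator_hom_eq_pair]
  infer_instance

instance : IsComonHom (α_ X Y Z).inv := inferInstance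

theorem braiding_hom_eq_pair : (β_ X Y).hom = pair (snd _ _) (fst _ _) := by
  rw [← pair_braiding, pair_fst_snd, Category.id_comp]

instance : IsComonHom (β_ X Y).hom := by
  rw [braiding_hom_eq_pair]
  infer_instance

end

end Comonoid

/-! ### Effects, weights and scalars -/

section Effects

open scoped ComonObj

attribute [local instance] ComonObj.instTensorUnit

variable {C : Type*} [Category C] [MonoidalCategory C] [SymmetricCategory C]
variable {X Y Z W V : C} [ComonObj X] [IsCommComonObj X]

/-- The map `f`, weighted by the effect `w` on a copy of the input. -/
def weight (w : X ⟶ 𝟙_ C) (f : X ⟶ Y) : X ⟶ Y := pair w f ≫ (λ_ Y).hom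

/-- Effects on a commutative comonoid are multiplied pointwise. -/
instance : CommMonoid (X ⟶ 𝟙_ C) where
  mul a b := weight a b
  one := ε[X]
  mul_assoc a b c := by
    change weight (weight a b) c = weight a (weight b c)
    simp only [weight]
    rw [← pair_whiskerRight, ← pair_whiskerLeft, ← pair_associator_hom]
    simp only [Category.assoc]
    congr 1
    monoidal
  one_mul a := by
    change weight ε[X] a = a
    simp [weight, pair]
  mul_one a := by
    change weight a ε[X] = a
    simp [weight, pair, unitors_equal]
  mul_comm a b := by
    change weight a b = weight b a
    rw [weight, weight, ← pair_braiding, Category.assoc]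
    simp [← unitors_equal]

theorem mul_eq_pair (a b : X ⟶ 𝟙_ C) : a * b = pair a b ≫ (λ_ (𝟙_ C)).hom := rfl

theorem one_eq_counit : (1 : X ⟶ 𝟙_ C) = ε[X] := rfl

theorem weight_comp (w : X ⟶ 𝟙_ C) (f : X ⟶ Y) (g : Y ⟶ Z) :
    weight w f ≫ g = weight w (f ≫ g) := by
  rw [weight, weight, Category.assoc, ← leftUnitor_naturality, reassoc_of% pair_whiskerLeft]

theorem weight_comp_effect (w : X ⟶ 𝟙_ C) (f : X ⟶ Y) (g : Y ⟶ 𝟙_ C) :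
    weight w f ≫ g = w * (f ≫ g) := weight_comp w f g

theorem one_weight (f : X ⟶ Y) : weight 1 f = f := by
  simp [weight, pair, one_eq_counit]

section

variable [ComonObj W] [IsCommComonObj W] (h : W ⟶ X) [IsComonHom h]

theorem comp_weight (w : X ⟶ 𝟙_ C) (f : X ⟶ Y) :
    h ≫ weight w f = weight (h ≫ w) (h ≫ f) := by
  rw [weight, reassoc_of% comp_pair, weight]

theorem comp_mul (a b : X ⟶ 𝟙_ C) : h ≫ (a * b) = (h ≫ a) * (h ≫ b) := comp_weight h a b

theorem comp_one : h ≫ (1 : X ⟶ 𝟙_ C) = 1 := IsComonHom.hom_counit h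

/-- Precomposition with a copyable map, on effects. -/
def pullHom : (X ⟶ 𝟙_ C) →* (W ⟶ 𝟙_ C) where
  toFun a := h ≫ a
  map_one' := comp_one h
  map_mul' := comp_mul h

theorem comp_prod {ι : Type*} (s : Finset ι) (a : ι → (X ⟶ 𝟙_ C)) :
    h ≫ ∏ i ∈ s, a i = ∏ i ∈ s, h ≫ a i := map_prod (pullHom h) a s

end

theorem pair_leftUnitor {f : X ⟶ 𝟙_ C} {g : X ⟶ Y} : pair f g ≫ (λ_ Y).hom = weight f g := rfl

theorem pair_rightUnitor {f : X ⟶ 𝟙_ C} {g : X ⟶ Y} : pair g f ≫ (ρ_ Y).hom = weight f g := by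
  rw [weight, ← pair_braiding, Category.assoc]
  simp

end Effects

section Scalars

open scoped ComonObj

attribute [local instance] ComonObj.instTensorUnit

variable {C : Type*} [Category C] [MonoidalCategory C] [SymmetricCategory C]
variable {X Y Z W V : C}

theorem scalar_mul_eq_comp (s t : 𝟙_ C ⟶ 𝟙_ C) : s * t = s ≫ t := by
  simp [mul_eq_pair, pair, MonoidalCategory.tensorHom_def, unitors_equal]
  simp [← unitors_equal]

theorem scalar_one : (1 : 𝟙_ C ⟶ 𝟙_ C) = 𝟙 _ := rfl

theorem scalar_tensor (s t : 𝟙_ C ⟶ 𝟙_ C) :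
    (λ_ (𝟙_ C)).inv ≫ (s ⊗ₘ t) ≫ (λ_ (𝟙_ C)).hom = s * t := by
  simp [mul_eq_pair, pair]

/-- The action of scalars on all maps. -/
def scale (s : 𝟙_ C ⟶ 𝟙_ C) (f : X ⟶ Y) : X ⟶ Y := (λ_ X).inv ≫ (s ⊗ₘ f) ≫ (λ_ Y).hom

infixr:73 " ⊙ " => scale

theorem one_scale (f : X ⟶ Y) : (1 : 𝟙_ C ⟶ 𝟙_ C) ⊙ f = f := by
  simp [scale, scalar_one]

theorem mul_scale (s t : 𝟙_ C ⟶ 𝟙_ C) (f : X ⟶ Y) : (s * t) ⊙ f = s ⊙ t ⊙ f := by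
  rw [scalar_mul_eq_comp]
  simp [scale, MonoidalCategory.tensorHom_def]

theorem scale_def (s : 𝟙_ C ⟶ 𝟙_ C) (f : X ⟶ Y) :
    s ⊙ f = (λ_ X).inv ≫ (s ⊗ₘ f) ≫ (λ_ Y).hom := rfl

theorem scale_eq_whisker (s : 𝟙_ C ⟶ 𝟙_ C) (f : X ⟶ Y) :
    s ⊙ f = (λ_ X).inv ≫ s ▷ X ≫ (λ_ X).hom ≫ f := by
  simp [scale_def, MonoidalCategory.tensorHom_def]

theorem scale_comp (s : 𝟙_ C ⟶ 𝟙_ C) (f : X ⟶ Y) (g : Y ⟶ Z) : (s ⊙ f) ≫ g = s ⊙ (f ≫ g) := by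
  simp [scale_eq_whisker]

theorem comp_scale (s : 𝟙_ C ⟶ 𝟙_ C) (f : X ⟶ Y) (g : Y ⟶ Z) : f ≫ (s ⊙ g) = s ⊙ (f ≫ g) := by
  simp [scale_def, MonoidalCategory.tensorHom_def']

theorem scale_whiskerRight (s : 𝟙_ C ⟶ 𝟙_ C) (f : X ⟶ Y) (Z : C) : (s ⊙ f) ▷ Z = s ⊙ (f ▷ Z) := by
  simp [scale_eq_whisker]

theorem whiskerLeft_scale (s : 𝟙_ C ⟶ 𝟙_ C) (f : X ⟶ Y) (Z : C) : Z ◁ (s ⊙ f) = s ⊙ (Z ◁ f) := by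
  have h : Z ◁ s ≫ (ρ_ Z).hom = (ρ_ Z).hom ≫ (λ_ Z).inv ≫ s ▷ Z ≫ (λ_ Z).hom := by
    have := BraidedCategory.braiding_naturality_right Z s
    rw [braiding_tensorUnit_right] at this
    have h2 := congrArg (· ≫ (λ_ Z).hom) this
    simpa using h2
  rw [scale_eq_whisker, scale_eq_whisker]
  have h3 : Z ◁ ((λ_ X).inv ≫ s ▷ X ≫ (λ_ X).hom ≫ f) =
      ((ρ_ Z).inv ≫ (Z ◁ s ≫ (ρ_ Z).hom)) ▷ X ≫ Z ◁ f := by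
    monoidal
  rw [h3, h]
  monoidal

theorem scale_tensorHom (s : 𝟙_ C ⟶ 𝟙_ C) (f : X ⟶ Y) (g : Z ⟶ W) :
    (s ⊙ f) ⊗ₘ g = s ⊙ (f ⊗ₘ g) := by
  rw [MonoidalCategory.tensorHom_def, MonoidalCategory.tensorHom_def, scale_whiskerRight, scale_comp]

theorem tensorHom_scale (s : 𝟙_ C ⟶ 𝟙_ C) (f : X ⟶ Y) (g : Z ⟶ W) :
    f ⊗ₘ (s ⊙ g) = s ⊙ (f ⊗ₘ g) := by
  rw [MonoidalCategory.tensorHom_def, MonoidalCategory.tensorHom_def, whiskerLeft_scale, comp_scale]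

theorem scale_scalar (s t : 𝟙_ C ⟶ 𝟙_ C) : s ⊙ t = s * t := scalar_tensor s t

theorem scale_eq_weight [ComonObj X] [IsCommComonObj X] (s : 𝟙_ C ⟶ 𝟙_ C) (f : X ⟶ Y) :
    s ⊙ f = weight (ε[X] ≫ s) f := by
  rw [scale_def, weight, ← Category.id_comp f, ← pair_tensorHom, pair, ComonObj.counit_comul_hom]
  simp

theorem scale_effect [ComonObj X] [IsCommComonObj X] (s : 𝟙_ C ⟶ 𝟙_ C) (a : X ⟶ 𝟙_ C) :
    s ⊙ a = (ε[X] ≫ s) * a := scale_eq_weight s a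

theorem scale_mul_effect [ComonObj X] [IsCommComonObj X] (s : 𝟙_ C ⟶ 𝟙_ C) (a b : X ⟶ 𝟙_ C) :
    (s ⊙ a) * b = s ⊙ (a * b) := by
  rw [scale_effect, scale_effect, mul_assoc]

theorem mul_scale_effect [ComonObj X] [IsCommComonObj X] (s : 𝟙_ C ⟶ 𝟙_ C) (a b : X ⟶ 𝟙_ C) :
    a * (s ⊙ b) = s ⊙ (a * b) := by
  rw [mul_comm, scale_mul_effect, mul_comm]

theorem scale_pair [ComonObj X] (s : 𝟙_ C ⟶ 𝟙_ C) (f : X ⟶ Y) (g : X ⟶ Z) :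
    pair (s ⊙ f) g = s ⊙ pair f g := by
  rw [pair, scale_tensorHom, comp_scale, pair]

/-- A scalar with an inverse can be cancelled. -/
theorem scale_cancel {s t : 𝟙_ C ⟶ 𝟙_ C} (h : t * s = 1) {f g : X ⟶ Y} (e : s ⊙ f = s ⊙ g) :
    f = g := by
  rw [← one_scale f, ← one_scale g, ← h, mul_scale, mul_scale, e]

end Scalars

/-! ### Caps and transposition -/

section SelfDual

attribute [local instance] ComonObj.instTensorUnit

variable {C : Type*} [Category C] [MonoidalCategory C] [SymmetricCategory C]

/-- An object with a chosen symmetric effect `cap` that bends two wires into each other. -/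
class HasCap (X : C) where
  cap : X ⊗ X ⟶ 𝟙_ C
  braiding_cap : (β_ X X).hom ≫ cap = cap

/-- The cap of an object. -/
def capOf (X : C) [HasCap X] : X ⊗ X ⟶ 𝟙_ C := HasCap.cap

/-- An object that is its own dual, through a symmetric cap. -/
class SelfDual (X : C) extends HasCap X where
  cup : 𝟙_ C ⟶ X ⊗ X
  snake : X ◁ cup ≫ (α_ X X X).inv ≫ cap ▷ X = (ρ_ X).hom ≫ (λ_ X).inv

/-- The cup of a self-dual object. -/
def cupOf (X : C) [SelfDual X] : 𝟙_ C ⟶ X ⊗ X := SelfDual.cup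

theorem braiding_capOf (X : C) [HasCap X] : (β_ X X).hom ≫ capOf X = capOf X :=
  HasCap.braiding_cap

theorem snake_capOf (X : C) [SelfDual X] :
    X ◁ cupOf X ≫ (α_ X X X).inv ≫ capOf X ▷ X = (ρ_ X).hom ≫ (λ_ X).inv :=
  SelfDual.snake

instance : SelfDual (𝟙_ C) where
  cap := (λ_ (𝟙_ C)).hom
  cup := (λ_ (𝟙_ C)).inv
  braiding_cap := by simp [unitors_equal, unitors_inv_equal]
  snake := by monoidal

instance (X Y : C) [HasCap X] [HasCap Y] : HasCap (X ⊗ Y) where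
  cap := tensorμ X Y X Y ≫ (capOf X ⊗ₘ capOf Y) ≫ (λ_ (𝟙_ C)).hom
  braiding_cap := by
    have h : tensorδ X X Y Y = tensorμ X Y X Y := by
      simp [tensorδ, tensorμ, SymmetricCategory.braiding_swap_eq_inv_braiding X Y]
    have h' : (β_ (X ⊗ Y) (X ⊗ Y)).hom ≫ tensorμ X Y X Y =
        tensorμ X Y X Y ≫ ((β_ X X).hom ⊗ₘ (β_ Y Y).hom) := by
      have := congrArg (tensorδ X X Y Y ≫ · ≫ tensorδ X X Y Y)
        (SymmetricCategory.tensorμ_braid_swap X Y)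
      simp only [Category.assoc, tensorμ_tensorδ, tensorδ_tensorμ_assoc, Category.comp_id] at this
      rw [h] at this
      exact this
    rw [reassoc_of% h', tensorHom_comp_tensorHom_assoc, braiding_capOf, braiding_capOf]

theorem capOf_tensor (X Y : C) [HasCap X] [HasCap Y] :
    capOf (X ⊗ Y) = tensorμ X Y X Y ≫ (capOf X ⊗ₘ capOf Y) ≫ (λ_ (𝟙_ C)).hom := rfl

section

variable {X Y Z W : C} [HasCap X] [HasCap Y] [HasCap Z] [HasCap W]

/-- `IsTranspose A B`: bending the wires of `A` around gives `B`. -/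
def IsTranspose (A : X ⟶ Y) (B : Y ⟶ X) : Prop := A ▷ Y ≫ capOf Y = X ◁ B ≫ capOf X

theorem IsTranspose.id (X : C) [HasCap X] : IsTranspose (𝟙 X) (𝟙 X) := by simp [IsTranspose]

theorem IsTranspose.symm {A : X ⟶ Y} {B : Y ⟶ X} (h : IsTranspose A B) : IsTranspose B A := by
  unfold IsTranspose at *
  rw [← braiding_capOf, BraidedCategory.braiding_naturality_left_assoc, ← h,
    ← BraidedCategory.braiding_naturality_right_assoc, braiding_capOf]

theorem IsTranspose.comp {A : X ⟶ Y} {A' : Y ⟶ X} {B : Y ⟶ Z} {B' : Z ⟶ Y}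
    (hA : IsTranspose A A') (hB : IsTranspose B B') : IsTranspose (A ≫ B) (B' ≫ A') := by
  unfold IsTranspose at *
  rw [comp_whiskerRight, Category.assoc, hB, ← whisker_exchange_assoc, hA]
  simp

theorem IsTranspose.tensor {A : X ⟶ Y} {A' : Y ⟶ X} {B : Z ⟶ W} {B' : W ⟶ Z}
    (hA : IsTranspose A A') (hB : IsTranspose B B') : IsTranspose (A ⊗ₘ B) (A' ⊗ₘ B') := by
  unfold IsTranspose at *
  rw [capOf_tensor, capOf_tensor, reassoc_of% (tensorμ_natural_left A B Y W),
    reassoc_of% (tensorμ_natural_right X Z A' B'), tensorHom_comp_tensorHom_assoc, hA, hB,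
    tensorHom_comp_tensorHom_assoc]

/-- The effect obtained by bending the output of a state. -/
def toEffect (D : 𝟙_ C ⟶ X) : X ⟶ 𝟙_ C := (λ_ X).inv ≫ D ▷ X ≫ capOf X

theorem toEffect_comp {A : X ⟶ Y} {B : Y ⟶ X} (h : IsTranspose A B) (D : 𝟙_ C ⟶ X) :
    toEffect (D ≫ A) = B ≫ toEffect D := by
  unfold IsTranspose at h
  rw [toEffect, toEffect, comp_whiskerRight, Category.assoc, h, ← whisker_exchange_assoc]
  simp

theorem toEffect_scale (s : 𝟙_ C ⟶ 𝟙_ C) (D : 𝟙_ C ⟶ X) : toEffect (s ⊙ D) = s ⊙ toEffect D := by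
  rw [toEffect, scale_whiskerRight, scale_comp, comp_scale, toEffect]

theorem comp_toEffect_comm (D E : 𝟙_ C ⟶ X) : D ≫ toEffect E = E ≫ toEffect D := by
  have h : ∀ D E : 𝟙_ C ⟶ X, D ≫ toEffect E = (λ_ (𝟙_ C)).inv ≫ (E ⊗ₘ D) ≫ capOf X := by
    intro D E
    simp [toEffect, MonoidalCategory.tensorHom_def']
  rw [h D E, h E D]
  nth_rw 1 [← braiding_capOf]
  rw [BraidedCategory.braiding_naturality_assoc, braiding_tensorUnit_left, ← unitors_inv_equal,
    Iso.hom_inv_id, Category.id_comp]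

theorem toEffect_tensor (D : 𝟙_ C ⟶ X) (E : 𝟙_ C ⟶ Y) :
    toEffect ((λ_ (𝟙_ C)).inv ≫ (D ⊗ₘ E)) = (toEffect D ⊗ₘ toEffect E) ≫ (λ_ (𝟙_ C)).hom := by
  rw [toEffect, capOf_tensor, comp_whiskerRight, Category.assoc,
    reassoc_of% (tensorμ_natural_left D E X Y)]
  have h := tensor_left_unitality X Y
  have h' : (λ_ (𝟙_ C)).inv ▷ (X ⊗ Y) ≫ tensorμ (𝟙_ C) (𝟙_ C) X Y =
      (λ_ (X ⊗ Y)).hom ≫ ((λ_ X).inv ⊗ₘ (λ_ Y).inv) := by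
    rw [h]
    simp
  rw [reassoc_of% h']
  simp [toEffect]

end

section

variable {X Y Z W : C} [SelfDual X] [SelfDual Y] [SelfDual Z] [SelfDual W]

/-- Bending the output of a state loses no information. -/
theorem eq_of_toEffect_eq {D E : 𝟙_ C ⟶ X} (h : toEffect D = toEffect E) : D = E := by
  have key : ∀ D : 𝟙_ C ⟶ X, D = cupOf X ≫ toEffect D ▷ X ≫ (λ_ X).hom := by
    intro D
    have h1 : cupOf X ≫ toEffect D ▷ X ≫ (λ_ X).hom =
        (λ_ (𝟙_ C)).inv ≫ (𝟙_ C ◁ cupOf X ≫ D ▷ (X ⊗ X)) ≫ (α_ X X X).inv ≫ capOf X ▷ X ≫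
          (λ_ X).hom := by
      simp only [toEffect]
      monoidal
    rw [h1, whisker_exchange, Category.assoc, reassoc_of% snake_capOf]
    simp [unitors_inv_equal]
  rw [key D, key E, h]

/-- The transpose of a map between self-dual objects. -/
def transpose (A : X ⟶ Y) : Y ⟶ X :=
  (λ_ Y).inv ≫ cupOf X ▷ Y ≫ (α_ X X Y).hom ≫ X ◁ (A ▷ Y ≫ capOf Y) ≫ (ρ_ X).hom

theorem isTranspose_transpose (A : X ⟶ Y) : IsTranspose A (transpose A) := by
  unfold IsTranspose
  have h1 : X ◁ transpose A ≫ capOf X =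
      (ρ_ X).inv ▷ Y ≫ (X ◁ cupOf X ≫ (α_ X X X).inv) ▷ Y ≫ (α_ (X ⊗ X) X Y).hom ≫
        ((X ⊗ X) ◁ (A ▷ Y ≫ capOf Y) ≫ capOf X ▷ 𝟙_ C) ≫ (ρ_ _).hom := by
    simp only [transpose]
    monoidal
  rw [h1, whisker_exchange]
  have h2 : (ρ_ X).inv ▷ Y ≫ (X ◁ cupOf X ≫ (α_ X X X).inv) ▷ Y ≫ (α_ (X ⊗ X) X Y).hom ≫
        (capOf X ▷ (X ⊗ Y) ≫ 𝟙_ C ◁ (A ▷ Y ≫ capOf Y)) ≫ (ρ_ _).hom =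
      (ρ_ X).inv ▷ Y ≫ (X ◁ cupOf X ≫ (α_ X X X).inv ≫ capOf X ▷ X) ▷ Y ≫
        (α_ (𝟙_ C) X Y).hom ≫ (λ_ (X ⊗ Y)).hom ≫ A ▷ Y ≫ capOf Y := by
    monoidal
  rw [h2, snake_capOf]
  monoidal

end

end SelfDual

/-! ### Equality of wires as an effect -/

section Delta

open scoped ComonObj

attribute [local instance] ComonObj.instTensorUnit

variable {C : Type*} [Category C] [MonoidalCategory C] [SymmetricCategory C]
variable {X Y Z W V : C} [ComonObj X] [IsCommComonObj X] [ComonObj Y] [IsCommComonObj Y]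
  [ComonObj Z] [IsCommComonObj Z] [ComonObj W] [IsCommComonObj W] [ComonObj V] [IsCommComonObj V]

theorem tensor_effect (a : X ⟶ 𝟙_ C) (b : Y ⟶ 𝟙_ C) :
    (a ⊗ₘ b) ≫ (λ_ (𝟙_ C)).hom = (fst X Y ≫ a) * (snd X Y ≫ b) := by
  rw [mul_eq_pair, ← pair_tensorHom, pair_fst_snd, Category.id_comp]

theorem pair_weight (w : W ⟶ 𝟙_ C) (f : W ⟶ X) (g : W ⟶ Y) :
    pair (weight w f) g = weight w (pair f g) := by
  have : pair (weight w f) g = pair (pair w f) g ≫ (λ_ X).hom ▷ Y := by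
    rw [pair_whiskerRight, weight]
  rw [this, weight, ← pair_associator_hom, Category.assoc]
  congr 1
  monoidal

theorem pair_weight_right (w : W ⟶ 𝟙_ C) (f : W ⟶ X) (g : W ⟶ Y) :
    pair f (weight w g) = weight w (pair f g) := by
  rw [← pair_braiding, pair_weight, weight_comp, pair_braiding]

theorem weight_whiskerRight (w : X ⟶ 𝟙_ C) (f : X ⟶ Y) :
    weight w f ▷ Z = weight (fst X Z ≫ w) (f ▷ Z) := by
  have h : ∀ g : X ⟶ Y, g ▷ Z = pair (fst X Z ≫ g) (snd X Z) := fun g => by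
    rw [← pair_whiskerRight, pair_fst_snd, Category.id_comp]
  rw [h, h, comp_weight, pair_weight]

theorem whiskerLeft_weight (w : X ⟶ 𝟙_ C) (f : X ⟶ Y) :
    Z ◁ weight w f = weight (snd Z X ≫ w) (Z ◁ f) := by
  have h : ∀ g : X ⟶ Y, Z ◁ g = pair (fst Z X) (snd Z X ≫ g) := fun g => by
    rw [← pair_whiskerLeft, pair_fst_snd, Category.id_comp]
  rw [h, h, comp_weight, pair_weight_right]

variable [HasCap X]

/-- The effect that compares the two outputs of `f` and `g`. -/
def delta (f g : W ⟶ X) : W ⟶ 𝟙_ C := pair f g ≫ capOf X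

theorem delta_comm (f g : W ⟶ X) : delta f g = delta g f := by
  rw [delta, ← braiding_capOf, reassoc_of% pair_braiding, delta]

theorem comp_delta (h : V ⟶ W) [IsComonHom h] (f g : W ⟶ X) :
    h ≫ delta f g = delta (h ≫ f) (h ≫ g) := by
  rw [delta, reassoc_of% comp_pair, delta]

theorem capOf_eq_delta : capOf X = delta (fst X X) (snd X X) := by
  rw [delta, pair_fst_snd, Category.id_comp]

theorem pair_pair_tensorμ_cap (f g : W ⟶ X) (h k : W ⟶ Y) [HasCap Y] :
    pair (pair f h) (pair g k) ≫ capOf (X ⊗ Y) = delta f g * (pair h k ≫ capOf Y) := by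
  rw [capOf_tensor, reassoc_of% pair_tensorμ, reassoc_of% pair_tensorHom]
  rfl

/-- A commutative comonoid with a cap in which compared wires may be substituted for each other. -/
class IsFrobenius (X : C) [ComonObj X] [IsCommComonObj X] [HasCap X] : Prop where
  subst : weight (capOf X) (fst X X) = weight (capOf X) (snd X X)

variable [IsFrobenius X]

theorem delta_subst (f g : W ⟶ X) [IsComonHom f] [IsComonHom g] :
    weight (delta f g) f = weight (delta f g) g := by
  have h := congrArg (pair f g ≫ ·) (IsFrobenius.subst (X := X))
  simp only [comp_weight, pair_fst, pair_snd] at h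
  exact h

theorem delta_subst_pair (f g : W ⟶ X) [IsComonHom f] [IsComonHom g] (k : W ⟶ Y)
    (e : X ⊗ Y ⟶ Z) :
    weight (delta f g) (pair f k ≫ e) = weight (delta f g) (pair g k ≫ e) := by
  rw [← weight_comp, ← weight_comp, ← pair_weight, ← pair_weight, delta_subst]

theorem delta_mul_delta (f g k : W ⟶ X) [IsComonHom f] [IsComonHom g] :
    delta f g * delta f k = delta f g * delta g k := delta_subst_pair f g k (capOf X)

theorem delta_mul_delta_right (f g k : W ⟶ X) [IsComonHom f] [IsComonHom k] :
    delta f g * delta f k = delta f k * delta g k := by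
  rw [mul_comm, delta_mul_delta, delta_comm k g]

/-- Merging by comparison is the transpose of copying. -/
theorem isTranspose_merge : IsTranspose (weight (capOf X) (fst X X)) Δ[X] := by
  have h1 : (X ⊗ X) ◁ Δ[X] = pair (pair (fst _ _ ≫ fst _ _) (fst _ _ ≫ snd _ _))
      (pair (snd (X ⊗ X) X) (snd (X ⊗ X) X)) := by
    rw [← comp_pair, pair_fst_snd, Category.comp_id, ← comp_comul, ← pair_whiskerLeft, pair_fst_snd,
      Category.id_comp]
  rw [IsTranspose, h1, pair_pair_tensorμ_cap, weight_whiskerRight, weight_comp_effect,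
    capOf_eq_delta, comp_delta, comp_delta, whiskerRight_fst, whiskerRight_snd]
  rw [← capOf_eq_delta, delta_mul_delta_right]
  rfl

end Delta

/-! ### Spiders with few legs -/

section Spiders

open scoped ComonObj

attribute [local instance] ComonObj.instTensorUnit

/-- The object of a single wire carrying `n` qubits. -/
def Q (n : ℕ+) : Obj := ⟨[n]⟩

variable (x : Colour) (n : ℕ+) (α β : Fin n → ℝ)

/-- The spider with one input and no output. -/
def eff : Q n ⟶ 𝟙_ Obj := mk (spider x n 1 0 α)

/-- The spider with one output and no input. -/
def sta : 𝟙_ Obj ⟶ Q n := mk (spider x n 0 1 α)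

/-- The spider with one input and one output. -/
def rot : Q n ⟶ Q n := mk (spider x n 1 1 α)

/-- The spider with one input and two outputs. -/
def copy : Q n ⟶ Q n ⊗ Q n := mk (spider₀ x n 1 2)

/-- The spider with two inputs and one output. -/
def merge : Q n ⊗ Q n ⟶ Q n := mk (spider₀ x n 2 1)

/-- The spider with three outputs. -/
def copy₃ : Q n ⟶ Q n ⊗ Q n ⊗ Q n := mk (spider x n 1 3 0)

/-- The spider with three inputs and one output. -/
def merge₃ : (Q n ⊗ Q n) ⊗ Q n ⟶ Q n := mk (spider x n 3 1 0)

/-- The Hadamard box. -/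
def hadQ : Q n ⟶ Q n := mk (had n)

/-- The cap of a wire. -/
def capQ : Q n ⊗ Q n ⟶ 𝟙_ Obj := mk (Diag.cap n)

/-- The cup of a wire. -/
def cupQ : 𝟙_ Obj ⟶ Q n ⊗ Q n := mk (Diag.cup n)

theorem Q_associator_hom (n m p : ℕ+) : (α_ (Q n) (Q m) (Q p)).hom = 𝟙 (Obj.mk [n, m, p]) :=
  eqHom_rfl (a := [n, m, p]) _

theorem Q_associator_inv (n m p : ℕ+) : (α_ (Q n) (Q m) (Q p)).inv = 𝟙 (Obj.mk [n, m, p]) :=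
  eqHom_rfl (a := [n, m, p]) _

theorem Q_leftUnitor_hom : (λ_ (Q n)).hom = 𝟙 (Obj.mk [n]) := eqHom_rfl (a := [n]) _

theorem Q_leftUnitor_inv : (λ_ (Q n)).inv = 𝟙 (Obj.mk [n]) := eqHom_rfl (a := [n]) _

theorem Q_rightUnitor_hom : (ρ_ (Q n)).hom = 𝟙 (Obj.mk [n]) := eqHom_rfl (a := [n]) _

theorem Q_rightUnitor_inv : (ρ_ (Q n)).inv = 𝟙 (Obj.mk [n]) := eqHom_rfl (a := [n]) _

theorem fuse {x : Colour} {n : ℕ+} {k l j m p : ℕ} {α β γ : Fin n → ℝ} (h : α + β = γ) :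
    Derives
        ((spider x n k (l + (j + 1)) α ⊠ wires (copies m n)).comp
          (wires (copies l n) ⊠ spider x n ((j + 1) + m) p β)
          (by simp only [copies, List.replicate_add, List.append_assoc]))
        (spider x n (k + m) (l + p) γ) := h ▸ .spider_fusion x n k l j m p α β

theorem comp_wd {a b c : Ty} {f f' : Diag a b} {g g' : Diag b c}
    (h : Derives f f') (h' : Derives g g') : Derives (f.comp g rfl) (f'.comp g' rfl) :=
  .comp_congr rfl rfl h h'

theorem rot_zero : rot x n 0 = 𝟙 _ := mk_eq_iff.2 (.spider_id x n)

theorem rot_comp_rot : rot x n α ≫ rot x n β = rot x n (α + β) :=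
  mk_eq_iff.2 ((comp_wd (Derives.tensor_nil _).symm (Derives.nil_tensor _).symm).trans
    (Derives.spider_fusion x n 1 0 0 0 1 α β))

theorem rot_comp_eff : rot x n α ≫ eff x n β = eff x n (α + β) :=
  mk_eq_iff.2 ((comp_wd (Derives.tensor_nil _).symm (Derives.nil_tensor _).symm).trans
    (Derives.spider_fusion x n 1 0 0 0 0 α β))

theorem sta_comp_rot : sta x n α ≫ rot x n β = sta x n (α + β) :=
  mk_eq_iff.2 ((comp_wd (Derives.tensor_nil _).symm (Derives.nil_tensor _).symm).trans
    (Derives.spider_fusion x n 0 0 0 0 1 α β))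

theorem copy_braiding : copy x n ≫ (β_ (Q n) (Q n)).hom = copy x n :=
  mk_eq_iff.2 ((comp_wd (.refl _) ((Derives.nil_tensor _).trans
    (Derives.tensor_nil _)).symm).trans (Derives.spider_swap_out x n 1 0 0 0))

theorem braiding_merge : (β_ (Q n) (Q n)).hom ≫ merge x n = merge x n :=
  mk_eq_iff.2 ((comp_wd ((Derives.nil_tensor _).trans
    (Derives.tensor_nil _)).symm (.refl _)).trans (Derives.spider_swap_in x n 0 0 1 0))

theorem copy_comp_whisker_eff : copy x n ≫ Q n ◁ eff x n α = rot x n α ≫ (ρ_ (Q n)).inv := by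
  rw [Q_rightUnitor_inv]
  refine Eq.trans ?_ (Category.comp_id (rot x n α)).symm
  exact mk_eq_iff.2 ((comp_wd (Derives.tensor_nil _).symm (.refl _)).trans
    (fuse (k := 1) (l := 1) (j := 0) (m := 0) (p := 0) (zero_add α)))

theorem copy_comp_whisker_copy : copy x n ≫ Q n ◁ copy x n = copy₃ x n :=
  mk_eq_iff.2 ((comp_wd (Derives.tensor_nil _).symm (.refl _)).trans
    (fuse (k := 1) (l := 1) (j := 0) (m := 0) (p := 2) (zero_add 0)))

theorem whisker_merge_comp_merge : merge x n ▷ Q n ≫ merge x n = merge₃ x n :=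
  mk_eq_iff.2 ((comp_wd (.refl _) (Derives.nil_tensor _).symm).trans
    (fuse (k := 2) (l := 0) (j := 0) (m := 1) (p := 1) (zero_add 0)))

theorem sta_whisker_merge : sta x n α ▷ Q n ≫ merge x n = (λ_ (Q n)).hom ≫ rot x n α := by
  rw [Q_leftUnitor_hom]
  refine Eq.trans ?_ (Category.id_comp (rot x n α)).symm
  exact mk_eq_iff.2 ((comp_wd (.refl _) (Derives.nil_tensor _).symm).trans
    (fuse (k := 0) (l := 0) (j := 0) (m := 1) (p := 1) (add_zero α)))

theorem merge_comp_eff : merge x n ≫ eff x n α = mk (spider x n 2 0 α) :=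
  mk_eq_iff.2 ((comp_wd (Derives.tensor_nil _).symm (Derives.nil_tensor _).symm).trans
    (fuse (k := 2) (l := 0) (j := 0) (m := 0) (p := 0) (zero_add α)))

theorem rot_whisker_cap :
    rot x n α ▷ Q n ≫ capQ n = merge x n ≫ eff x n α := by
  rw [merge_comp_eff]
  exact mk_eq_iff.2 ((comp_wd (.refl _) (Derives.nil_tensor _).symm).trans
    (Derives.spider_bend_in x n 1 0 α))

theorem cap_eq_merge : capQ n = merge x n ≫ eff x n 0 := by
  rw [← rot_whisker_cap, rot_zero, id_whiskerRight, Category.id_comp]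

theorem sta_whisker_cap :
    sta x n α ▷ Q n ≫ capQ n = (λ_ (Q n)).hom ≫ eff x n α := by
  rw [Q_leftUnitor_hom]
  refine Eq.trans ?_ (Category.id_comp (eff x n α)).symm
  exact mk_eq_iff.2 ((comp_wd (.refl _) (Derives.nil_tensor _).symm).trans
    (Derives.spider_bend_in x n 0 0 α))

theorem copy_whisker_cap :
    copy x n ▷ Q n ≫ (α_ (Q n) (Q n) (Q n)).hom ≫ Q n ◁ capQ n =
      merge x n ≫ (ρ_ (Q n)).inv := by
  rw [Q_rightUnitor_inv, Q_associator_hom]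
  refine Eq.trans ?_ (Category.comp_id (merge x n)).symm
  have h : 𝟙 (Obj.mk [n, n, n]) ≫ Q n ◁ capQ n =
      (mk (Diag.tensor (a := [n]) (b := [n]) (wires [n]) (Diag.cap n)) :
        (Q n ⊗ Q n) ⊗ Q n ⟶ Q n ⊗ 𝟙_ Obj) := Category.id_comp _
  refine Eq.trans (congrArg (copy x n ▷ Q n ≫ ·) h) ?_
  exact mk_eq_iff.2 (Derives.spider_bend_in x n 1 1 0)

/-- Swap of the first two of three wires. -/
def swap₁₂ : Q n ⊗ Q n ⊗ Q n ⟶ Q n ⊗ Q n ⊗ Q n :=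
  mk (Diag.tensor (a := [n, n]) (b := [n, n]) (c := [n]) (d := [n]) (swap [n] [n]) (wires [n]))

theorem swap₁₂_eq : swap₁₂ n = (α_ (Q n) (Q n) (Q n)).inv ≫ (β_ (Q n) (Q n)).hom ▷ Q n ≫
    (α_ (Q n) (Q n) (Q n)).hom := by
  rw [Q_associator_hom, Q_associator_inv]
  exact ((Category.id_comp _).trans (Category.comp_id _)).symm

theorem whiskerLeft_braiding_eq : (α_ (Q n) (Q n) (Q n)).hom ≫ Q n ◁ (β_ (Q n) (Q n)).hom ≫
    (α_ (Q n) (Q n) (Q n)).inv =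
      (mk (Diag.tensor (a := [n]) (b := [n]) (wires [n]) (swap [n] [n])) :
        (Q n ⊗ Q n) ⊗ Q n ⟶ (Q n ⊗ Q n) ⊗ Q n) := by
  rw [Q_associator_hom, Q_associator_inv]
  exact (Category.id_comp _).trans (Category.comp_id _)

theorem copy₃_braiding : copy₃ x n ≫ (β_ (Q n) (Q n ⊗ Q n)).hom ≫ (α_ (Q n) (Q n) (Q n)).hom =
    copy₃ x n := by
  have h1 : copy₃ x n ≫ (α_ (Q n) (Q n) (Q n)).inv ≫ (β_ (Q n) (Q n)).hom ▷ Q n ≫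
      (α_ (Q n) (Q n) (Q n)).hom = copy₃ x n := by
    rw [← swap₁₂_eq]
    exact mk_eq_iff.2 ((comp_wd (.refl _) (Derives.nil_tensor _).symm).trans
      (Derives.spider_swap_out x n 1 0 1 0))
  have h2 : copy₃ x n ≫ Q n ◁ (β_ (Q n) (Q n)).hom = copy₃ x n :=
    mk_eq_iff.2 (show Derives ((spider x n 1 3 0).comp (wires [n] ⊠ swap [n] [n]) rfl)
      (spider x n 1 3 0) by
        refine Derives.trans ?_ (Derives.spider_swap_out x n 1 1 0 0)
        exact comp_wd (.refl _) (tensor_wd (.refl _) (Derives.tensor_nil _).symm))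
  rw [BraidedCategory.braiding_tensor_right_hom]
  simp only [Category.assoc, Iso.inv_hom_id, Category.comp_id]
  have h1' := congrArg (· ≫ Q n ◁ (β_ (Q n) (Q n)).hom) h1
  simp only [Category.assoc] at h1'
  rw [h1', h2]

theorem merge₃_braiding : (β_ (Q n) (Q n ⊗ Q n)).hom ≫ merge₃ x n =
    (α_ (Q n) (Q n) (Q n)).inv ≫ merge₃ x n := by
  have h1 : (β_ (Q n) (Q n)).hom ▷ Q n ≫ merge₃ x n = merge₃ x n :=
    mk_eq_iff.2 ((comp_wd (Derives.nil_tensor _).symm (.refl _)).trans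
      (Derives.spider_swap_in x n 0 1 1 0))
  have h2 : ((α_ (Q n) (Q n) (Q n)).hom ≫ Q n ◁ (β_ (Q n) (Q n)).hom ≫
      (α_ (Q n) (Q n) (Q n)).inv) ≫ merge₃ x n = merge₃ x n := by
    rw [whiskerLeft_braiding_eq]
    exact mk_eq_iff.2 ((comp_wd (tensor_wd (.refl _) (Derives.tensor_nil _).symm) (.refl _)).trans
      (Derives.spider_swap_in x n 1 0 1 0))
  simp only [Category.assoc] at h2
  rw [BraidedCategory.braiding_tensor_right_hom]
  simp only [Category.assoc]
  rw [h2, h1]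

/-- The spiders of either colour form a commutative comonoid. -/
@[reducible]
def spiderComon : ComonObj (Q n) where
  counit := eff x n 0
  comul := copy x n
  comul_counit := by
    rw [copy_comp_whisker_eff, rot_zero, Category.id_comp]
  counit_comul := by
    rw [← copy_braiding, Category.assoc, ← BraidedCategory.braiding_naturality_right,
      reassoc_of% (copy_comp_whisker_eff x n 0), rot_zero, Category.id_comp]
    simp
  comul_assoc := by
    rw [copy_comp_whisker_copy]
    have h : copy x n ≫ copy x n ▷ Q n = copy₃ x n ≫ (β_ (Q n) (Q n ⊗ Q n)).hom := by
      nth_rw 1 [← copy_braiding]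
      rw [Category.assoc, ← BraidedCategory.braiding_naturality_right, ← Category.assoc,
        copy_comp_whisker_copy]
    rw [reassoc_of% h, copy₃_braiding]

theorem spiderComon_comm : @IsCommComonObj _ _ _ _ (Q n) (spiderComon x n) :=
  letI := spiderComon x n
  ⟨copy_braiding x n⟩

instance : SelfDual (Q n) where
  cap := capQ n
  braiding_cap := mk_eq_iff.2 (.swap_cap n)
  cup := cupQ n
  snake := by
    have h : (α_ (Q n) (Q n) (Q n)).inv ≫ capQ n ▷ Q n =
        (mk (Diag.tensor (a := [n, n]) (b := []) (Diag.cap n) (wires [n])) :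
          Q n ⊗ Q n ⊗ Q n ⟶ 𝟙_ Obj ⊗ Q n) := by
      rw [Q_associator_inv]
      exact Category.id_comp _
    rw [h, Q_leftUnitor_inv, Q_rightUnitor_hom]
    exact (mk_eq_iff.2 (.snake_left n)).trans (Category.comp_id (𝟙 (Q n))).symm

theorem capOf_Q : capOf (Q n) = capQ n := rfl

theorem spider_isFrobenius :
    letI := spiderComon x n
    letI := spiderComon_comm x n
    merge x n = weight (capOf (Q n)) (fst (Q n) (Q n)) ∧ IsFrobenius (Q n) := by
  let := spiderComon x n
  have := spiderComon_comm x n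
  have h : merge x n = weight (capOf (Q n)) (fst (Q n) (Q n)) := by
    have h1 : (copy x n) ▷ Q n ≫ (α_ (Q n) (Q n) (Q n)).hom = pair (fst _ _) (𝟙 _) := by
      change Δ[Q n] ▷ Q n ≫ _ = _
      rw [← pair_id_id, ← Category.id_comp (pair _ _ ▷ Q n), ← pair_fst_snd, Category.assoc,
        reassoc_of% pair_whiskerRight, comp_pair, Category.comp_id, pair_associator_hom, pair_fst_snd]
    rw [← pair_rightUnitor, ← Category.id_comp (capOf _), ← pair_whiskerLeft, ← h1,
      Category.assoc, Category.assoc, capOf_Q, reassoc_of% (copy_whisker_cap x n)]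
    simp
  refine ⟨h, ⟨?_⟩⟩
  rw [← h, ← braiding_merge, h, comp_weight, braiding_capOf, braiding_hom_eq_pair, pair_fst]

end Spiders

/-! ### Rules in categorical form -/

section Rules

open scoped ComonObj

attribute [local instance] ComonObj.instTensorUnit

instance (n : ℕ+) : ComonObj (Q n) := spiderComon .green n

instance (n : ℕ+) : IsCommComonObj (Q n) := spiderComon_comm .green n

instance (n : ℕ+) : IsFrobenius (Q n) := (spider_isFrobenius .green n).2

theorem merge_green (n : ℕ+) : merge .green n = weight (capOf (Q n)) (fst (Q n) (Q n)) :=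
  (spider_isFrobenius .green n).1

theorem counit_Q (n : ℕ+) : ε[Q n] = eff .green n 0 := rfl

theorem comul_Q (n : ℕ+) : Δ[Q n] = copy .green n := rfl

theorem isTranspose_merge_copy (x : Colour) (n : ℕ+) : IsTranspose (merge x n) (copy x n) := by
  let := spiderComon x n
  have := spiderComon_comm x n
  have h := spider_isFrobenius x n
  have := h.2
  rw [h.1]
  exact isTranspose_merge

variable (x : Colour) (n : ℕ+) (α β : Fin n → ℝ)

theorem toEffect_sta : toEffect (sta x n α) = eff x n α := by
  rw [toEffect, capOf_Q, sta_whisker_cap]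
  simp

theorem isTranspose_rot : IsTranspose (rot x n α) (rot x n α) := by
  have h := rot_whisker_cap x n α
  rw [IsTranspose]
  have h2 : Q n ◁ rot x n α ≫ capQ n = merge x n ≫ eff x n α := by
    rw [← capOf_Q, ← braiding_capOf, BraidedCategory.braiding_naturality_right_assoc, capOf_Q, h,
      ← Category.assoc, braiding_merge]
  rw [capOf_Q, h, h2]

/-- The scalar of a state plugged into an effect of the other colour. -/
def dum : 𝟙_ Obj ⟶ 𝟙_ Obj := sta x n α ≫ eff x.other n β

theorem sta_comp_eff_comm (y : Colour) : sta x n α ≫ eff y n β = sta y n β ≫ eff x n α := by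
  rw [← toEffect_sta, comp_toEffect_comm, toEffect_sta]

theorem dum_comm : dum x n α β = dum x.other n β α := by
  rw [dum, sta_comp_eff_comm, dum]
  cases x <;> rfl

theorem mk_scale (s : Diag [] []) {a b : Ty} (f : Diag a b) :
    (mk (s ⊠ f) : Obj.mk a ⟶ Obj.mk b) = mk s ⊙ mk f := by
  rw [scale, leftUnitor_inv_eq, leftUnitor_hom_eq]
  refine Eq.trans ?_ (congrArg₂ (fun u v => u ≫ (mk s ⊗ₘ mk f) ≫ v)
    (eqHom_rfl (a := a) rfl).symm (eqHom_rfl (a := b) rfl).symm)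
  exact ((Category.id_comp _).trans (Category.comp_id _)).symm

/-- Swap of the middle two of four wires. -/
def midSwap (n m p r : ℕ+) : (Q n ⊗ Q m) ⊗ (Q p ⊗ Q r) ⟶ (Q n ⊗ Q p) ⊗ (Q m ⊗ Q r) :=
  mk (Diag.tensor (a := [n]) (b := [n]) (wires [n])
    (Diag.tensor (a := [m, p]) (b := [p, m]) (c := [r]) (d := [r]) (swap [m] [p]) (wires [r])))

theorem tensorμ_Q (n m p r : ℕ+) : tensorμ (Q n) (Q m) (Q p) (Q r) = midSwap n m p r := by
  have h1 : (α_ (Q n) (Q m) (Q p ⊗ Q r)).hom = 𝟙 (Obj.mk [n, m, p, r]) :=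
    eqHom_rfl (a := [n, m, p, r]) _
  have h2 : (α_ (Q n) (Q p) (Q m ⊗ Q r)).inv = 𝟙 (Obj.mk [n, p, m, r]) :=
    eqHom_rfl (a := [n, p, m, r]) _
  have h3 : Q n ◁ (α_ (Q m) (Q p) (Q r)).inv = 𝟙 (Obj.mk [n, m, p, r]) := by
    rw [Q_associator_inv]
    exact MonoidalCategory.whiskerLeft_id (Q n) (Obj.mk [m, p, r])
  have h4 : Q n ◁ (α_ (Q p) (Q m) (Q r)).hom = 𝟙 (Obj.mk [n, p, m, r]) := by
    rw [Q_associator_hom]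
    exact MonoidalCategory.whiskerLeft_id (Q n) (Obj.mk [p, m, r])
  rw [tensorμ, h1, h2, h3, h4]
  refine (Category.id_comp _).trans ((Category.id_comp _).trans ?_)
  refine Eq.trans (congrArg (Q n ◁ (β_ (Q m) (Q p)).hom ▷ Q r ≫ ·) (Category.id_comp _)) ?_
  exact Category.comp_id _

theorem sta_tensor_sta_copy :
    dum x 1 0 0 ⊙ (sta x.other 1 0 ≫ copy x 1) =
      (λ_ (𝟙_ Obj)).inv ≫ (sta x.other 1 0 ⊗ₘ sta x.other 1 0) := by
  have h := mk_eq_iff.2 (Derives.copy x)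
  have h1 := mk_scale (dumbbell x 1 0 0) (spider₀ x.other 1 0 1 ⨟ spider₀ x 1 1 2)
  refine Eq.trans h1.symm (h.trans ?_)
  refine (Category.id_comp _).symm.trans ?_
  exact congrArg (· ≫ (sta x.other 1 0 ⊗ₘ sta x.other 1 0)) (eqHom_rfl (a := []) rfl).symm

theorem bialg :
    dum x 1 0 0 ⊙ ((copy x 1 ⊗ₘ copy x 1) ≫ tensorμ (Q 1) (Q 1) (Q 1) (Q 1) ≫
      (merge x.other 1 ⊗ₘ merge x.other 1)) = merge x.other 1 ≫ copy x 1 := by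
  refine Eq.trans ?_ (mk_eq_iff.2 (Derives.bialgebra x))
  rw [tensorμ_Q, ← Category.assoc]
  exact (mk_scale _ _).symm

theorem dum_pi_div_four : dum x 1 (fun _ => π / 4) (fun _ => -(π / 4)) = 1 :=
  mk_eq_iff.2 (Derives.scalar x)

theorem hadQ_comp_rot : hadQ n ≫ rot x n α ≫ hadQ n = rot x.other n α := by
  refine Eq.trans ?_ (mk_eq_iff.2 (Derives.colour_change x n 1 1 α))
  rw [← Category.assoc]
  exact (mk_eq_iff.2 (comp_wd (comp_wd (Derives.tensor_nil _) (.refl _))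
    (Derives.tensor_nil _))).symm

theorem hadQ_comp_hadQ : hadQ n ≫ hadQ n = 𝟙 _ := by
  have h := hadQ_comp_rot .green n 0
  rwa [rot_zero, rot_zero, Category.id_comp] at h

theorem sta_comp_hadQ : sta x n α ≫ hadQ n = sta x.other n α := by
  refine Eq.trans ?_ (mk_eq_iff.2 (Derives.colour_change x n 0 1 α))
  exact (mk_eq_iff.2 (comp_wd (Derives.id_comp _ rfl) (Derives.tensor_nil _))).symm

theorem hadQ_comp_eff : hadQ n ≫ eff x n α = eff x.other n α := by
  refine Eq.trans ?_ (mk_eq_iff.2 (Derives.colour_change x n 1 0 α))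
  exact (mk_eq_iff.2 ((Derives.comp_id _ rfl).trans
    (comp_wd (Derives.tensor_nil _) (.refl _)))).symm

theorem hads_two : (mk (hads n 2) : Q n ⊗ Q n ⟶ Q n ⊗ Q n) = (hadQ n ⊗ₘ hadQ n) :=
  mk_eq_iff.2 (tensor_wd (.refl _) (Derives.tensor_nil _))

theorem merge_comp_hadQ : merge x n ≫ hadQ n = (hadQ n ⊗ₘ hadQ n) ≫ merge x.other n := by
  have h : (hadQ n ⊗ₘ hadQ n) ≫ merge x n ≫ hadQ n = merge x.other n := by
    rw [← hads_two]
    refine Eq.trans ?_ (mk_eq_iff.2 (Derives.colour_change x n 2 1 0))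
    rw [← Category.assoc]
    exact (mk_eq_iff.2 (comp_wd (.refl _) (Derives.tensor_nil _))).symm
  rw [← h, tensorHom_comp_tensorHom_assoc, hadQ_comp_hadQ, id_tensorHom_id, Category.id_comp]

theorem hadQ_cap : (hadQ n ⊗ₘ hadQ n) ≫ capQ n = capQ n := by
  nth_rw 1 [cap_eq_merge .green]
  rw [merge_comp_eff, ← hads_two, cap_eq_merge .red, merge_comp_eff]
  refine Eq.trans ?_ (mk_eq_iff.2 (Derives.colour_change .green n 2 0 0))
  exact (mk_eq_iff.2 (Derives.comp_id _ rfl)).symm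

theorem isTranspose_hadQ : IsTranspose (hadQ n) (hadQ n) := by
  rw [IsTranspose, capOf_Q]
  nth_rw 1 [← hadQ_cap]
  rw [← tensorHom_id, tensorHom_comp_tensorHom_assoc, hadQ_comp_hadQ, Category.id_comp, id_tensorHom]

theorem whisker_merge_assoc : Q n ◁ merge x n ≫ merge x n =
    (α_ (Q n) (Q n) (Q n)).inv ≫ merge x n ▷ Q n ≫ merge x n := by
  rw [whisker_merge_comp_merge, ← merge₃_braiding, ← whisker_merge_comp_merge,
    ← BraidedCategory.braiding_naturality_right_assoc, braiding_merge]

theorem euler_eq (α₁ α₂ : ℝ) :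
    dum x 1 0 0 ⊙ (rot x 1 (fun _ => α₁) ≫ hadQ 1 ≫ rot x 1 (fun _ => α₂)) =
      dum x 1 (fun _ => eulerγ α₁ α₂) (fun _ => π) ⊙
        (rot x.other 1 (fun _ => eulerβ₁ α₁ α₂) ≫ rot x 1 (fun _ => eulerβ₂ α₁ α₂) ≫
          rot x.other 1 (fun _ => eulerβ₃ α₁ α₂)) := by
  rw [← Category.assoc, ← Category.assoc]
  exact ((mk_scale _ _).symm.trans (mk_eq_iff.2 (Derives.euler x α₁ α₂))).trans (mk_scale _ _)

end Rules

/-! ### The qubit as a bialgebra -/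

section Qubit

open scoped ComonObj

attribute [local instance] ComonObj.instTensorUnit

/-- The scalar `√2`. -/
def root : 𝟙_ Obj ⟶ 𝟙_ Obj := dum .green 1 0 0

theorem dum_red : dum .red 1 0 0 = root := dum_comm .red 1 0 0

theorem scalar_comp_tensor {X Y : Obj} (f : 𝟙_ Obj ⟶ X) (g : 𝟙_ Obj ⟶ Y) (a : X ⟶ 𝟙_ Obj)
    (b : Y ⟶ 𝟙_ Obj) :
    (λ_ (𝟙_ Obj)).inv ≫ (f ⊗ₘ g) ≫ (a ⊗ₘ b) ≫ (λ_ (𝟙_ Obj)).hom = (f ≫ a) * (g ≫ b) := by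
  rw [tensorHom_comp_tensorHom_assoc, scalar_tensor]

/-- `√2` is invertible: `1 = ⟨π/4|-π/4⟩²`, and the two red dots in the two copies of this scalar
are, up to `√2`, copies of one red dot. -/
theorem exists_root_mul_eq_one : ∃ r : 𝟙_ Obj ⟶ 𝟙_ Obj, root * r = 1 := by
  set D := sta .green 1 (fun _ => π / 4) ≫ rot .red 1 (fun _ => -(π / 4)) with hD
  have h1 : sta .red 1 0 ≫ toEffect D = 1 := by
    rw [comp_toEffect_comm, toEffect_sta, hD, Category.assoc, rot_comp_eff, add_zero,
      ← dum_pi_div_four .green]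
    rfl
  refine ⟨sta .red 1 0 ≫ copy .green 1 ≫ (toEffect D ⊗ₘ toEffect D) ≫ (λ_ (𝟙_ Obj)).hom, ?_⟩
  have h2 := congrArg (· ≫ (toEffect D ⊗ₘ toEffect D) ≫ (λ_ (𝟙_ Obj)).hom)
    (sta_tensor_sta_copy .green)
  simp only [scale_comp, Category.assoc] at h2
  change root ⊙ (sta .red 1 0 ≫ _) = (λ_ (𝟙_ Obj)).inv ≫ (sta .red 1 0 ⊗ₘ sta .red 1 0) ≫ _ at h2
  rw [scalar_comp_tensor, h1, mul_one, scale_scalar] at h2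
  exact h2

/-- The scalar `1/√2`. -/
noncomputable def rootInv : 𝟙_ Obj ⟶ 𝟙_ Obj := exists_root_mul_eq_one.choose

theorem root_mul_rootInv : root * rootInv = 1 := exists_root_mul_eq_one.choose_spec

theorem rootInv_mul_root : rootInv * root = 1 := by rw [mul_comm, root_mul_rootInv]

theorem root_scale_rootInv_scale {X Y : Obj} (f : X ⟶ Y) : root ⊙ rootInv ⊙ f = f := by
  rw [← mul_scale, root_mul_rootInv, one_scale]

theorem rootInv_scale_root_scale {X Y : Obj} (f : X ⟶ Y) : rootInv ⊙ root ⊙ f = f := by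
  rw [← mul_scale, rootInv_mul_root, one_scale]

/-- Addition modulo 2. -/
def addQ : Q 1 ⊗ Q 1 ⟶ Q 1 := root ⊙ merge .red 1

/-- The basis state of a zero bit. -/
noncomputable def zeroQ : 𝟙_ Obj ⟶ Q 1 := rootInv ⊙ sta .red 1 0

theorem root_scale_zeroQ : root ⊙ zeroQ = sta .red 1 0 := root_scale_rootInv_scale _

/-- The red merging is compatible with discarding: this is the transpose of the copy rule for the
green state. -/
theorem merge_red_counit :
    root ⊙ (merge .red 1 ≫ eff .green 1 0) =
      (eff .green 1 0 ⊗ₘ eff .green 1 0) ≫ (λ_ (𝟙_ Obj)).hom := by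
  have h := congrArg toEffect (sta_tensor_sta_copy .red)
  rw [dum_red, toEffect_scale, toEffect_tensor] at h
  change root ⊙ toEffect (sta .green 1 0 ≫ _) = (toEffect (sta .green 1 0) ⊗ₘ
    toEffect (sta .green 1 0)) ≫ _ at h
  rwa [toEffect_comp (isTranspose_merge_copy .red 1).symm, toEffect_sta] at h

instance : IsComonHom addQ where
  hom_counit := by
    rw [addQ, scale_comp, counit_Q, merge_red_counit]
    rfl
  hom_comul := by
    have h := bialg .green
    rw [Comon.tensorObj_comul, comul_Q, addQ, scale_comp, scale_tensorHom, tensorHom_scale,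
      comp_scale, comp_scale]
    congr 1
    rw [Category.assoc]
    exact h.symm

instance : IsComonHom zeroQ where
  hom_counit := by
    rw [zeroQ, scale_comp, counit_Q, sta_comp_eff_comm, scale_scalar]
    exact rootInv_mul_root
  hom_comul := by
    have h := sta_tensor_sta_copy .green
    rw [zeroQ, scale_comp, scale_tensorHom, tensorHom_scale, comp_scale, comp_scale,
      ComonObj.instTensorUnit_comul, comul_Q]
    congr 1
    refine Eq.trans ?_ (congrArg (rootInv ⊙ ·) h)
    exact (rootInv_scale_root_scale _).symm

section

variable {W V : Obj} [ComonObj W] [IsCommComonObj W] [ComonObj V] [IsCommComonObj V]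

/-- The pointwise sum of two maps to the qubit. -/
def addF (f g : W ⟶ Q 1) : W ⟶ Q 1 := pair f g ≫ addQ

variable (W) in
/-- The constant zero map to the qubit. -/
noncomputable def zeroF : W ⟶ Q 1 := ε[W] ≫ zeroQ

instance (f g : W ⟶ Q 1) [IsComonHom f] [IsComonHom g] : IsComonHom (addF f g) := by
  unfold addF
  infer_instance

instance : IsComonHom (zeroF W) := by
  unfold zeroF
  infer_instance

theorem comp_addF (h : V ⟶ W) [IsComonHom h] (f g : W ⟶ Q 1) :
    h ≫ addF f g = addF (h ≫ f) (h ≫ g) := by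
  rw [addF, reassoc_of% comp_pair, addF]

theorem comp_zeroF (h : V ⟶ W) [IsComonHom h] : h ≫ zeroF W = zeroF V := by
  rw [zeroF, IsComonHom.hom_counit_assoc, zeroF]

theorem addF_comm (f g : W ⟶ Q 1) : addF f g = addF g f := by
  rw [addF, addF, addQ, comp_scale, comp_scale, ← pair_braiding, Category.assoc, braiding_merge]

theorem addF_assoc (f g h : W ⟶ Q 1) : addF (addF f g) h = addF f (addF g h) := by
  rw [addF, addF, addF, addF, ← pair_whiskerRight, ← pair_whiskerLeft]
  simp only [addQ, scale_whiskerRight, whiskerLeft_scale, scale_comp, comp_scale, Category.assoc]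
  rw [whisker_merge_assoc, reassoc_of% pair_associator_inv]

theorem zeroF_addF (f : W ⟶ Q 1) : addF (zeroF W) f = f := by
  have h : zeroQ ▷ Q 1 ≫ addQ = (λ_ (Q 1)).hom := by
    rw [zeroQ, addQ, scale_whiskerRight, scale_comp, comp_scale, rootInv_scale_root_scale,
      sta_whisker_merge, rot_zero, Category.comp_id]
  rw [addF, zeroF, ← pair_whiskerRight, Category.assoc, h, pair_leftUnitor]
  exact one_weight f

theorem delta_zeroF (f : W ⟶ Q 1) : delta (zeroF W) f = rootInv ⊙ (f ≫ eff .red 1 0) := by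
  rw [delta, zeroF, ← pair_whiskerRight, Category.assoc, capOf_Q, zeroQ, scale_whiskerRight,
    scale_comp, sta_whisker_cap, comp_scale]
  congr 1
  rw [← Category.assoc, pair_leftUnitor]
  congr 1
  exact one_weight f

/-- Two bits agree when their sum vanishes. -/
theorem delta_eq_delta_addF (f g : W ⟶ Q 1) : delta f g = delta (zeroF W) (addF f g) := by
  rw [delta_zeroF, addF, addQ, comp_scale, scale_comp, rootInv_scale_root_scale, delta, capOf_Q,
    cap_eq_merge .red, Category.assoc]

/-- The Hopf law.  On pairs `(x, y)` with `x = y`, equivalently `x + y = 0`, one may replace `y`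
by `x` in `x + y = 0`; then `y` is discarded. -/
theorem addF_self (f : W ⟶ Q 1) [IsComonHom f] : addF f f = zeroF W := by
  set x := fst (Q 1) (Q 1) with hx
  set y := snd (Q 1) (Q 1) with hy
  have h1 : weight (delta x y) (addF x x) = weight (delta x y) (zeroF _) := by
    have h2 : weight (delta x y) (addF x x) = weight (delta x y) (addF y x) :=
      delta_subst_pair x y x addQ
    rw [h2, addF_comm, delta_eq_delta_addF, ← delta_subst]
  have h3 : addF x x = x ≫ addF (𝟙 _) (𝟙 _) := by rw [comp_addF, Category.comp_id]
  have h4 : zeroF (Q 1 ⊗ Q 1) = x ≫ zeroF (Q 1) := by rw [comp_zeroF]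
  have h5 : weight (delta x y) x = merge .green 1 := by
    rw [merge_green, ← capOf_eq_delta]
  rw [h3, h4, ← weight_comp, ← weight_comp, h5] at h1
  have h6 := congrArg (sta .green 1 0 ▷ Q 1 ≫ ·) h1
  simp only [reassoc_of% (sta_whisker_merge .green 1 0)] at h6
  rw [rot_zero, Category.id_comp, Category.id_comp, Iso.cancel_iso_hom_left] at h6
  rw [← Category.comp_id f, ← comp_addF, h6, comp_zeroF]

end

/-- Three wires between dots of different colours amount to `1/√2`. -/
theorem mk_tripleEdge_one : mk (tripleEdge 1) = rootInv := by
  have h1 : mk (tripleEdge 1) = mk (spider₀ .green 1 0 3) ≫ mk (spider₀ .red 1 3 0) := rfl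
  have h2 : (mk (spider₀ .green 1 0 3) : 𝟙_ Obj ⟶ Q 1 ⊗ Q 1 ⊗ Q 1) =
      sta .green 1 0 ≫ copy .green 1 ≫ Q 1 ◁ copy .green 1 := by
    rw [copy_comp_whisker_copy]
    exact (mk_eq_iff.2 ((comp_wd (Derives.tensor_nil _).symm (Derives.nil_tensor _).symm).trans
      (fuse (k := 0) (l := 0) (j := 0) (m := 0) (p := 3) (zero_add 0)))).symm
  have h3 : (mk (spider₀ .red 1 3 0) : Q 1 ⊗ Q 1 ⊗ Q 1 ⟶ 𝟙_ Obj) =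
      Q 1 ◁ merge .red 1 ≫ merge .red 1 ≫ eff .red 1 0 := by
    rw [← Category.assoc, whisker_merge_assoc, whisker_merge_comp_merge, Category.assoc,
      Q_associator_inv]
    refine Eq.trans ?_ (Category.id_comp (merge₃ .red 1 ≫ eff .red 1 0)).symm
    exact (mk_eq_iff.2 ((comp_wd (Derives.tensor_nil _).symm (Derives.nil_tensor _).symm).trans
      (fuse (k := 3) (l := 0) (j := 0) (m := 0) (p := 0) (zero_add 0)))).symm
  have h4 : copy .green 1 ≫ merge .red 1 = rootInv ⊙ (eff .green 1 0 ≫ zeroQ) := by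
    have := addF_self (𝟙 (Q 1))
    rw [addF, pair_id_id, addQ, comp_scale, comul_Q] at this
    rw [← rootInv_scale_root_scale (copy .green 1 ≫ _), this]
    rfl
  have h5 : Q 1 ◁ zeroQ ≫ merge .red 1 = rootInv ⊙ (ρ_ (Q 1)).hom := by
    rw [← braiding_merge, BraidedCategory.braiding_naturality_right_assoc, zeroQ,
      scale_whiskerRight, scale_comp, comp_scale, sta_whisker_merge, rot_zero]
    simp
  have h6 : mk (tripleEdge 1) = (rootInv * rootInv) * root := by
    rw [h1]
    refine (congrArg₂ (· ≫ ·) h2 h3).trans ?_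
    simp only [Category.assoc]
    rw [← MonoidalCategory.whiskerLeft_comp_assoc, h4, whiskerLeft_scale, scale_comp, comp_scale,
      comp_scale, MonoidalCategory.whiskerLeft_comp, Category.assoc, reassoc_of% h5, scale_comp,
      comp_scale, comp_scale, comp_scale, reassoc_of% (copy_comp_whisker_eff .green 1 0), rot_zero,
      Category.id_comp, Iso.inv_hom_id_assoc, ← mul_scale, scale_scalar]
    rfl
  rw [h6, mul_assoc, rootInv_mul_root, mul_one]

end Qubit

/-! ### Phases and controlled phases -/

section Gates

open scoped ComonObj

attribute [local instance] ComonObj.instTensorUnit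

theorem rot_green (n : ℕ+) (α : Fin n → ℝ) : rot .green n α = weight (eff .green n α) (𝟙 _) := by
  rw [← pair_rightUnitor, pair, id_tensorHom, comul_Q, copy_comp_whisker_eff, Category.assoc,
    Iso.inv_hom_id, Category.comp_id]

theorem eff_green_mul (n : ℕ+) (α β : Fin n → ℝ) :
    eff .green n α * eff .green n β = eff .green n (α + β) := by
  rw [← rot_comp_eff, rot_green, weight_comp_effect, Category.id_comp]

/-- The green effect of phase `θ`, which multiplies the basis state of the bit `b` by `e ^ (iθb)`. -/
def phase (θ : ℝ) : Q 1 ⟶ 𝟙_ Obj := eff .green 1 fun _ => θ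

theorem phase_mul (θ φ : ℝ) : phase θ * phase φ = phase (θ + φ) := eff_green_mul 1 _ _

section

variable {W V : Obj} [ComonObj W] [IsCommComonObj W] [ComonObj V] [IsCommComonObj V]

theorem comp_phase_mul (f : W ⟶ Q 1) [IsComonHom f] (θ φ : ℝ) :
    (f ≫ phase θ) * (f ≫ phase φ) = f ≫ phase (θ + φ) := by
  rw [← comp_mul, phase_mul]

/-- The controlled `Z` gate as an effect: a wire with a Hadamard box between the bits `f` and `g`,
normalised so as to multiply by `(-1) ^ (f g)`. -/
def cz (f g : W ⟶ Q 1) : W ⟶ 𝟙_ Obj := root ⊙ delta (f ≫ hadQ 1) g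

theorem delta_comp_left {X Y : Obj} [HasCap X] [HasCap Y] {A : X ⟶ Y} {B : Y ⟶ X}
    (h : IsTranspose A B) (f : W ⟶ X) (g : W ⟶ Y) : delta (f ≫ A) g = delta f (g ≫ B) := by
  unfold IsTranspose at h
  rw [delta, ← pair_whiskerRight, Category.assoc, h, reassoc_of% pair_whiskerLeft, delta]

theorem cz_comm (f g : W ⟶ Q 1) : cz f g = cz g f := by
  rw [cz, delta_comp_left (isTranspose_hadQ 1), delta_comm, cz]

theorem comp_cz (h : V ⟶ W) [IsComonHom h] (f g : W ⟶ Q 1) :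
    h ≫ cz f g = cz (h ≫ f) (h ≫ g) := by
  rw [cz, comp_scale, comp_delta, cz, Category.assoc]

/-- A controlled `Z` gate on a sum splits: the Hadamard box turns the red merging of the summands
into a green one, which is the transpose of copying the other bit. -/
theorem cz_addF (f g h : W ⟶ Q 1) [IsComonHom h] : cz (addF f g) h = cz f h * cz g h := by
  have h1 : addF f g ≫ hadQ 1 = root ⊙ (pair (f ≫ hadQ 1) (g ≫ hadQ 1) ≫ merge .green 1) := by
    rw [addF, addQ, comp_scale, scale_comp, Category.assoc, merge_comp_hadQ,
      reassoc_of% pair_tensorHom]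
    rfl
  have h2 : delta (pair (f ≫ hadQ 1) (g ≫ hadQ 1) ≫ merge .green 1) h =
      delta (f ≫ hadQ 1) h * delta (g ≫ hadQ 1) h := by
    rw [delta_comp_left (isTranspose_merge_copy .green 1), ← comul_Q, comp_comul]
    exact pair_pair_tensorμ_cap _ _ _ _
  rw [cz, h1, delta, scale_pair, scale_comp, ← delta, h2, cz, cz, scale_mul_effect,
    mul_scale_effect]

theorem zeroF_cz (h : W ⟶ Q 1) [IsComonHom h] : cz (zeroF W) h = 1 := by
  rw [cz, zeroF, Category.assoc, zeroQ, scale_comp, sta_comp_hadQ, comp_scale, delta, scale_pair,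
    scale_comp, root_scale_rootInv_scale, ← pair_whiskerRight, Category.assoc, capOf_Q,
    sta_whisker_cap, ← Category.assoc, pair_leftUnitor]
  change weight 1 h ≫ ε[Q 1] = 1
  rw [one_weight, IsComonHom.hom_counit]
  rfl

theorem cz_mul_self (f g : W ⟶ Q 1) [IsComonHom f] [IsComonHom g] : cz f g * cz f g = 1 := by
  rw [← cz_addF, addF_self, zeroF_cz]

end

/-! ### Consequences of the Euler rule -/

theorem arg_eq_of_cos_sin {z : ℂ} {θ : ℝ} (hθ : θ ∈ Set.Ioc (-π) π) (hr : z.re = Real.cos θ)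
    (hi : z.im = Real.sin θ) : z.arg = θ ∧ ‖z‖ = 1 := by
  have h : z = Complex.cos θ + Complex.sin θ * Complex.I := by
    apply Complex.ext <;> simp [hr, hi, Complex.cos_ofReal_re, Complex.sin_ofReal_re]
  exact ⟨h ▸ Complex.arg_cos_add_sin_mul_I hθ, h ▸ Complex.norm_cos_add_sin_mul_I θ⟩

theorem eulerβ₂_of_norm {a b : ℝ} (h : ‖eulerZ a b‖ = 1) (h' : ‖eulerZ' a b‖ = 1) :
    eulerβ₂ a b = π / 2 := by
  have h1 : (Complex.I + 1).arg = π / 4 := by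
    have := Complex.arg_mul_cos_add_sin_mul_I (r := √2) (θ := π / 4) (by positivity)
      ⟨by linarith [Real.pi_pos], by linarith [Real.pi_pos]⟩
    rw [← this, ← Complex.ofReal_cos, ← Complex.ofReal_sin, Real.cos_pi_div_four,
      Real.sin_pi_div_four]
    congr 1
    apply Complex.ext <;> simp [← mul_div_assoc]
  have h0 : eulerZ' a b ≠ 0 := fun e => by simp [e] at h'
  rw [eulerβ₂, if_neg h0, norm_div, h, h', div_one, Complex.ofReal_one, h1]
  ring

theorem euler_pi_pi_div_four : eulerβ₁ π (π / 4) = π / 4 ∧ eulerβ₂ π (π / 4) = π / 2 ∧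
    eulerβ₃ π (π / 4) = 3 * π / 2 ∧ eulerγ π (π / 4) = 0 := by
  have hp := Real.pi_pos
  obtain ⟨hz, hn⟩ : (eulerZ π (π / 4)).arg = 7 * π / 8 ∧ ‖eulerZ π (π / 4)‖ = 1 := by
    refine arg_eq_of_cos_sin ⟨by linarith, by linarith⟩ ?_ ?_
    · change -Real.sin ((π + π / 4) / 2) = _
      rw [← Real.cos_add_pi_div_two, ← Real.cos_two_pi_sub]
      congr 1
      ring
    · change Real.cos ((π + π / 4) / 2 - π / 4) = _
      rw [← Real.sin_add_pi_div_two]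
      congr 1
      ring
  obtain ⟨hz', hn'⟩ : (eulerZ' π (π / 4)).arg = -(5 * π / 8) ∧ ‖eulerZ' π (π / 4)‖ = 1 := by
    refine arg_eq_of_cos_sin ⟨by linarith, by linarith⟩ ?_ ?_
    · change Real.cos ((π + π / 4) / 2) = _
      rw [Real.cos_neg]
      congr 1
      ring
    · change -Real.sin ((π + π / 4) / 2 - π / 4) = _
      rw [Real.sin_neg, ← Real.sin_pi_sub]
      congr 2
      ring
  have h2 := eulerβ₂_of_norm hn hn'
  refine ⟨?_, h2, ?_, ?_⟩
  · rw [eulerβ₁, hz, hz']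
    ring
  · rw [eulerβ₃, hz, hz']
    ring
  · rw [eulerγ, hz, h2]
    ring

theorem euler_pi_zero : eulerβ₁ π 0 = π / 2 ∧ eulerβ₂ π 0 = π / 2 ∧
    eulerβ₃ π 0 = 3 * π / 2 ∧ eulerγ π 0 = -(π / 4) := by
  have hp := Real.pi_pos
  obtain ⟨hz, hn⟩ : (eulerZ π 0).arg = π ∧ ‖eulerZ π 0‖ = 1 := by
    refine arg_eq_of_cos_sin ⟨by linarith, le_rfl⟩ ?_ ?_ <;> simp [eulerZ]
  obtain ⟨hz', hn'⟩ : (eulerZ' π 0).arg = -(π / 2) ∧ ‖eulerZ' π 0‖ = 1 := by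
    refine arg_eq_of_cos_sin ⟨by linarith, by linarith⟩ ?_ ?_ <;> simp [eulerZ']
  have h2 := eulerβ₂_of_norm hn hn'
  refine ⟨?_, h2, ?_, ?_⟩
  · rw [eulerβ₁, hz, hz']
    ring
  · rw [eulerβ₃, hz, hz']
    ring
  · rw [eulerγ, hz, h2]
    ring

theorem euler_neg_pi_div_two : eulerβ₁ (-(π / 2)) (-(π / 2)) = π / 4 ∧
    eulerβ₂ (-(π / 2)) (-(π / 2)) = 0 ∧
    eulerβ₃ (-(π / 2)) (-(π / 2)) = π / 4 ∧ eulerγ (-(π / 2)) (-(π / 2)) = -(π / 4) := by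
  have hp := Real.pi_pos
  have e : (-(π / 2) + -(π / 2)) / 2 = -(π / 2) := by ring
  have hz : (eulerZ (-(π / 2)) (-(π / 2))).arg = π / 4 := by
    have := Complex.arg_mul_cos_add_sin_mul_I (r := √2) (θ := π / 4) (by positivity)
      ⟨by linarith [Real.pi_pos], by linarith [Real.pi_pos]⟩
    rw [← this, ← Complex.ofReal_cos, ← Complex.ofReal_sin, Real.cos_pi_div_four,
      Real.sin_pi_div_four]
    congr 1
    apply Complex.ext <;> simp [← mul_div_assoc, eulerZ, e]
  have hz' : eulerZ' (-(π / 2)) (-(π / 2)) = 0 := by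
    apply Complex.ext <;> simp [eulerZ', e]
  have h2 : eulerβ₂ (-(π / 2)) (-(π / 2)) = 0 := by rw [eulerβ₂, if_pos hz']
  refine ⟨?_, h2, ?_, ?_⟩
  · rw [eulerβ₁, hz, hz', Complex.arg_zero, add_zero]
  · rw [eulerβ₃, hz, hz', Complex.arg_zero, sub_zero]
  · rw [eulerγ, hz, h2]
    ring

theorem dum_other (x : Colour) (n : ℕ+) (α β : Fin n → ℝ) :
    dum x.other n α β = dum x n α β := by
  rw [dum, ← sta_comp_hadQ, Category.assoc, hadQ_comp_eff, dum]
  cases x <;> rfl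

/-- The phase that the green effect of phase `θ` gives to a zero bit. -/
noncomputable def zeroPhase (θ : ℝ) : 𝟙_ Obj ⟶ 𝟙_ Obj := zeroQ ≫ phase θ

theorem zeroPhase_mul (θ φ : ℝ) : zeroPhase θ * zeroPhase φ = zeroPhase (θ + φ) :=
  comp_phase_mul zeroQ θ φ

theorem zeroPhase_zero : zeroPhase 0 = 1 := comp_one zeroQ

theorem zeroQ_comp_rot (θ : ℝ) : zeroQ ≫ rot .green 1 (fun _ => θ) = zeroPhase θ ⊙ zeroQ := by
  rw [rot_green, comp_weight, Category.comp_id, scale_eq_weight, ComonObj.instTensorUnit_counit,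
    Category.id_comp]
  rfl

theorem sta_comp_rot_green (θ : ℝ) :
    sta .red 1 0 ≫ rot .green 1 (fun _ => θ) = zeroPhase θ ⊙ sta .red 1 0 := by
  rw [← root_scale_zeroQ, scale_comp, zeroQ_comp_rot, ← mul_scale, ← mul_scale, mul_comm]

theorem dum_zero (θ : ℝ) : dum .red 1 0 (fun _ => θ) = root * zeroPhase θ := by
  rw [← scale_scalar, zeroPhase, ← scale_comp, root_scale_zeroQ]
  rfl

theorem dum_zero_right (θ : ℝ) : dum .red 1 (fun _ => θ) 0 = root * zeroPhase θ := by
  rw [dum_comm, dum_other, dum_zero]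

/-- The scalar of the Euler rule for the angles `(π, 0)`. -/
noncomputable def eulerScalar : 𝟙_ Obj ⟶ 𝟙_ Obj := dum .red 1 (fun _ => -(π / 4)) (fun _ => π)

theorem euler_zero : root ⊙ (rot .green 1 (fun _ => π) ≫ hadQ 1) =
    eulerScalar ⊙ (rot .red 1 (fun _ => π / 2) ≫ rot .green 1 (fun _ => π / 2) ≫
      rot .red 1 (fun _ => 3 * π / 2)) := by
  have h := euler_eq .green π 0
  obtain ⟨h1, h2, h3, h4⟩ := euler_pi_zero
  rw [h1, h2, h3, h4, ← dum_other .green 1 (fun _ => -(π / 4))] at h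
  have h5 : rot .green 1 (fun _ => (0 : ℝ)) = 𝟙 _ := rot_zero .green 1
  rw [h5, Category.comp_id] at h
  exact h

/-- The scalar of the Euler rule is invertible, as the left-hand side of the rule, between a red
state and a red effect, is a product of invertible scalars. -/
theorem exists_mul_eulerScalar : ∃ t : 𝟙_ Obj ⟶ 𝟙_ Obj, t * eulerScalar = 1 := by
  have h := congrArg (fun f => sta .red 1 0 ≫ f ≫ eff .red 1 0) euler_zero
  simp only [scale_comp, comp_scale, Category.assoc, hadQ_comp_eff] at h
  rw [reassoc_of% sta_comp_rot_green] at h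
  change root ⊙ (zeroPhase π ⊙ sta .red 1 0) ≫ eff .green 1 0 = _ at h
  have h1 : sta .red 1 0 ≫ eff .green 1 0 = root := dum_red
  rw [scale_comp, h1, scale_scalar, scale_scalar, scale_scalar] at h
  have h2 : (rootInv * zeroPhase (-π) * rootInv) * (root * (zeroPhase π * root)) = 1 := by
    calc _ = (root * rootInv) * (root * rootInv) * (zeroPhase π * zeroPhase (-π)) := by
          simp only [mul_comm, mul_left_comm]
      _ = 1 := by
          rw [root_mul_rootInv, zeroPhase_mul, add_neg_cancel, zeroPhase_zero, mul_one, mul_one]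
  rw [h, mul_left_comm, mul_comm] at h2
  exact ⟨_, h2⟩

/-- The Euler rules for `(π, π/4)` and `(π, 0)` differ by a red phase. -/
theorem eulerScalar_scale : eulerScalar ⊙ (rot .green 1 (fun _ => π) ≫ rot .red 1 (fun _ => π / 4)) =
    (root * zeroPhase π) ⊙ (rot .red 1 (fun _ => -(π / 4)) ≫ rot .green 1 (fun _ => π)) := by
  have h := euler_eq .green π (π / 4)
  obtain ⟨h1, h2, h3, h4⟩ := euler_pi_pi_div_four
  rw [h1, h2, h3, h4, ← dum_other .green 1 (fun _ => 0)] at h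
  have h5 := dum_zero π
  have h6 : rot .red 1 (fun _ => π / 4) = rot .red 1 (fun _ => -(π / 4)) ≫
      rot .red 1 (fun _ => π / 2) := by
    rw [rot_comp_rot]
    congr 1
    funext i
    simp only [Pi.add_apply]
    ring
  change root ⊙ _ = dum .red 1 0 _ ⊙ (rot .red 1 _ ≫ _ ≫ rot .red 1 _) at h
  rw [h5, h6, Category.assoc] at h
  have h7 := congrArg (eulerScalar ⊙ ·) h
  simp only [] at h7
  rw [← mul_scale eulerScalar (root * _), mul_comm eulerScalar, mul_scale, ← comp_scale eulerScalar,
    ← euler_zero, ← mul_scale, mul_comm, mul_scale, comp_scale, ← mul_scale (root * _),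
    mul_comm (root * _), mul_scale root] at h7
  have h8 := congrArg (· ≫ hadQ 1) (scale_cancel rootInv_mul_root h7)
  simp only [scale_comp, Category.assoc, hadQ_comp_hadQ, hadQ_comp_rot, Category.comp_id] at h8
  exact h8

/-- The two sides of `eulerScalar_scale`, between a red state and a green effect, are invertible
scalars that differ by the factor `zeroPhase (π / 4)`. -/
theorem zeroPhase_pi_div_four : zeroPhase (π / 4) = 1 := by
  obtain ⟨t, ht⟩ := exists_mul_eulerScalar
  have h := congrArg (fun f => sta .red 1 0 ≫ f ≫ eff .green 1 0) eulerScalar_scale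
  simp only [scale_comp, comp_scale, Category.assoc] at h
  rw [reassoc_of% sta_comp_rot_green, rot_comp_eff, ← Category.assoc (sta .red 1 0) (rot .red 1 _),
    sta_comp_rot, zero_add, add_zero, scale_comp] at h
  have h1 : sta .red 1 0 ≫ rot .red 1 (fun _ => π / 4) ≫ eff .green 1 0 =
      root * zeroPhase (π / 4) := by
    rw [← Category.assoc, sta_comp_rot, zero_add]
    exact dum_zero_right _
  rw [h1] at h
  change eulerScalar ⊙ zeroPhase π ⊙ (root * zeroPhase (π / 4)) = (root * zeroPhase π) ⊙ eulerScalar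
    at h
  simp only [scale_scalar] at h
  have h2 := congrArg (fun s => t * rootInv * zeroPhase (-π) * s) h
  have h3 : zeroPhase (-π) * zeroPhase π = 1 := by
    rw [zeroPhase_mul, neg_add_cancel, zeroPhase_zero]
  have h4 : ∀ q, t * rootInv * zeroPhase (-π) * (eulerScalar * (zeroPhase π * (root * q))) =
      (t * eulerScalar) * (rootInv * root) * (zeroPhase (-π) * zeroPhase π) * q := fun q => by
    simp only [mul_comm, mul_left_comm]
  have h5 : t * rootInv * zeroPhase (-π) * (root * zeroPhase π * eulerScalar) =
      (t * eulerScalar) * (rootInv * root) * (zeroPhase (-π) * zeroPhase π) := by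
    simp only [mul_comm, mul_left_comm]
  simp only [h4, h5] at h2
  rwa [ht, h3, rootInv_mul_root, one_mul, one_mul, one_mul] at h2

theorem zeroPhase_pi_div_two : zeroPhase (π / 2) = 1 := by
  have h := zeroPhase_mul (π / 4) (π / 4)
  rw [zeroPhase_pi_div_four, one_mul] at h
  rw [h]
  congr 1
  ring

theorem zeroPhase_neg_pi_div_two : zeroPhase (-(π / 2)) = 1 := by
  have h := zeroPhase_mul (-(π / 2)) (π / 2)
  rwa [zeroPhase_pi_div_two, mul_one, neg_add_cancel, zeroPhase_zero] at h

/-- The Euler rule for `(-π/2, -π/2)`.  Here `eulerZ'` vanishes, so that the green rotation in the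
middle of the right-hand side is trivial and the two red rotations fuse. -/
theorem euler_clifford : root ⊙ (rot .green 1 (fun _ => -(π / 2)) ≫ hadQ 1 ≫
      rot .green 1 (fun _ => -(π / 2))) =
    eulerScalar ⊙ rot .red 1 (fun _ => π / 2) := by
  have h := euler_eq .green (-(π / 2)) (-(π / 2))
  obtain ⟨h1, h2, h3, h4⟩ := euler_neg_pi_div_two
  rw [h1, h2, h3, h4, ← dum_other .green 1 (fun _ => -(π / 4))] at h
  have h5 : rot .green 1 (fun _ => (0 : ℝ)) = 𝟙 _ := rot_zero .green 1
  rw [h5, Category.id_comp] at h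
  have h6 : rot .red 1 (fun _ => π / 4) ≫ rot .red 1 (fun _ => π / 4) =
      rot .red 1 (fun _ => π / 2) := by
    rw [rot_comp_rot]
    congr 1
    funext i
    simp only [Pi.add_apply]
    ring
  refine h.trans ?_
  change _ ⊙ (rot .red _ _ ≫ rot .red _ _) = _
  rw [h6]
  rfl

/-- The scalar of the Euler rule relates the red and the green effect of a quarter turn. -/
theorem eulerScalar_scale_eff :
    eulerScalar ⊙ eff .red 1 (fun _ => π / 2) = root ⊙ phase (-(π / 2)) := by
  have h := congrArg (sta .red 1 0 ≫ ·) euler_clifford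
  simp only [comp_scale] at h
  rw [reassoc_of% sta_comp_rot_green, zeroPhase_neg_pi_div_two, one_scale,
    ← Category.assoc (sta .red 1 0), sta_comp_hadQ, sta_comp_rot, zero_add] at h
  have h2 := congrArg toEffect h
  rw [toEffect_scale, toEffect_scale] at h2
  erw [sta_comp_rot] at h2
  rw [zero_add] at h2
  erw [toEffect_sta, toEffect_sta] at h2
  exact h2.symm

section

variable {W V : Obj} [ComonObj W] [IsCommComonObj W] [ComonObj V] [IsCommComonObj V]

theorem rot_phase_eq (θ : ℝ) : rot .green 1 (fun _ => θ) = weight (phase θ) (𝟙 _) := rot_green 1 _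

theorem comp_rot_green (f : W ⟶ Q 1) [IsComonHom f] (θ : ℝ) :
    f ≫ rot .green 1 (fun _ => θ) = weight (f ≫ phase θ) f := by
  rw [rot_phase_eq, comp_weight, Category.comp_id]

theorem delta_weight {X : Obj} [ComonObj X] [IsCommComonObj X] [HasCap X] (w : W ⟶ 𝟙_ Obj) (f g : W ⟶ X) :
    delta (weight w f) g = w * delta f g := by
  rw [delta, pair_weight, weight_comp_effect, delta]

/-- A quarter turn on a sum of bits: `(-i) ^ (f ⊕ g) · i ^ f · i ^ g = (-1) ^ (f g)`. -/
theorem phase_addF (f g : W ⟶ Q 1) [IsComonHom f] [IsComonHom g] :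
    (addF f g ≫ phase (-(π / 2))) * ((f ≫ phase (π / 2)) * (g ≫ phase (π / 2))) = cz f g := by
  have hH : root ⊙ hadQ 1 = eulerScalar ⊙ (rot .green 1 (fun _ => π / 2) ≫
      rot .red 1 (fun _ => π / 2) ≫ rot .green 1 (fun _ => π / 2)) := by
    have h := congrArg (fun f => rot .green 1 (fun _ => π / 2) ≫ f ≫ rot .green 1 (fun _ => π / 2))
      euler_clifford
    have e1 : rot .green 1 (fun _ => π / 2) ≫ rot .green 1 (fun _ => -(π / 2)) = 𝟙 _ := by
      rw [rot_comp_rot, ← rot_zero .green]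
      congr 1
      exact funext fun _ => add_neg_cancel (π / 2)
    have e2 : rot .green 1 (fun _ => -(π / 2)) ≫ rot .green 1 (fun _ => π / 2) = 𝟙 _ := by
      rw [rot_comp_rot, ← rot_zero .green]
      congr 1
      exact funext fun _ => neg_add_cancel (π / 2)
    simp only [scale_comp, comp_scale, Category.assoc] at h
    rw [reassoc_of% e1, e2, Category.comp_id] at h
    exact h
  have h1 : delta (f ≫ rot .red 1 (fun _ => π / 2)) g =
      rootInv ⊙ (addF f g ≫ eff .red 1 (fun _ => π / 2)) := by
    rw [delta, ← pair_whiskerRight, Category.assoc, capOf_Q, rot_whisker_cap, addF, addQ,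
      comp_scale, scale_comp, rootInv_scale_root_scale, Category.assoc]
  have h2 : cz f g = delta (f ≫ (root ⊙ hadQ 1)) g := by
    rw [cz, comp_scale, delta, delta, scale_pair, scale_comp]
  rw [h2, hH, comp_scale, delta, scale_pair, scale_comp, ← delta, ← Category.assoc f,
    comp_rot_green, weight_comp, delta_weight, ← Category.assoc f,
    delta_comp_left (isTranspose_rot .green 1 _), comp_rot_green, delta_comm, delta_weight,
    delta_comm, h1, mul_scale_effect, mul_scale_effect, ← mul_scale, mul_comm eulerScalar,
    mul_scale, ← mul_scale_effect eulerScalar (f ≫ _),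
    ← mul_scale_effect eulerScalar (g ≫ _), ← comp_scale, eulerScalar_scale_eff,
    comp_scale, mul_scale_effect, mul_scale_effect, rootInv_scale_root_scale]
  rw [mul_comm, mul_assoc]

/-- The normalised red state of phase `θ`. -/
noncomputable def redState (θ : ℝ) : 𝟙_ Obj ⟶ Q 1 := rootInv ⊙ sta .red 1 fun _ => θ

theorem rot_red_eq (θ : ℝ) : rot .red 1 (fun _ => θ) =
    (λ_ (Q 1)).inv ≫ redState θ ▷ Q 1 ≫ addQ := by
  rw [redState, addQ, scale_whiskerRight, scale_comp, comp_scale, comp_scale, comp_scale,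
    rootInv_scale_root_scale, sta_whisker_merge, Iso.inv_hom_id_assoc]

/-- A controlled `Z` gate turns the red state of phase `θ` into the green effect of phase `θ`. -/
theorem redState_cz (θ : ℝ) (f : W ⟶ Q 1) [IsComonHom f] :
    (λ_ W).inv ≫ redState θ ▷ W ≫ cz (fst (Q 1) W) (snd (Q 1) W ≫ f) = f ≫ phase θ := by
  have h : cz (fst (Q 1) W) (snd (Q 1) W ≫ f) = root ⊙ (Q 1 ◁ f ≫ hadQ 1 ▷ Q 1 ≫ capQ 1) := by
    rw [cz, delta, ← pair_whiskerLeft, ← pair_whiskerRight, pair_fst_snd, capOf_Q,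
      Category.id_comp, Category.assoc, whisker_exchange_assoc]
  have h1 : redState θ ≫ hadQ 1 = rootInv ⊙ sta .green 1 fun _ => θ := by
    rw [redState, scale_comp, sta_comp_hadQ]
    rfl
  rw [h, comp_scale, comp_scale, ← whisker_exchange_assoc, ← comp_whiskerRight_assoc, h1,
    scale_whiskerRight, scale_comp, sta_whisker_cap, comp_scale, comp_scale,
    root_scale_rootInv_scale, ← leftUnitor_inv_naturality_assoc, Iso.inv_hom_id_assoc]
  rfl

end

end Gates

/-! ### Dividing a register -/

section Divide

open scoped ComonObj

attribute [local instance] ComonObj.instTensorUnit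

theorem dividers_one (n : ℕ+) : Derives (dividers n 1) (divider n) := by
  refine (Derives.comp_id _ _).trans ?_
  refine Derives.trans (Derives.comp_congr _ rfl (Derives.tensor_nil _) ?_)
    (Derives.comp_id (divider n) rfl)
  exact (tensor_wd (.refl _) ((Derives.tensor_nil _).trans (Derives.swap_nil _))).trans
    (.id_tensor_id _ _)

theorem dividers_two (n : ℕ+) : Derives (dividers n 2)
    ((divider n ⊠ divider n) ⨟ (wires [1] ⊠ swap [n] [1] ⊠ wires [n])) :=
  (Derives.comp_id _ _).trans
    (Derives.comp_congr _ rfl (.tensor_congr (.refl _) (dividers_one n)) (.refl _))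

variable (x : Colour) (n : ℕ+) (α : ℝ) (β : Fin n → ℝ)

/-- The divider. -/
def splitQ : Q (n + 1) ⟶ Q 1 ⊗ Q n := mk (divider n)

/-- The gatherer. -/
def joinQ : Q 1 ⊗ Q n ⟶ Q (n + 1) := mk (gatherer n)

theorem splitQ_joinQ : splitQ n ≫ joinQ n = 𝟙 _ := mk_eq_iff.2 (.expand n)

theorem joinQ_splitQ : joinQ n ≫ splitQ n = 𝟙 _ := mk_eq_iff.2 (.elim n)

/-- The phase vector `α :: β`. -/
def consPhase : Fin (n + 1 : ℕ+) → ℝ := (Fin.cons (α := fun _ => ℝ) α β : Fin (n + 1) → ℝ)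

theorem consPhase_zero : consPhase n 0 0 = 0 := by
  funext i
  exact Fin.cases (motive := fun i => consPhase n 0 0 i = 0) rfl (fun _ => rfl) i

theorem eff_splitQ : eff x (n + 1) (consPhase n α β) =
    splitQ n ≫ (eff x 1 (fun _ => α) ⊗ₘ eff x n β) ≫ (λ_ (𝟙_ Obj)).hom := by
  have h := Derives.spider_dist x n 1 0 α β
  have h1 : (λ_ (𝟙_ Obj)).hom = 𝟙 (Obj.mk []) := eqHom_rfl (a := []) rfl
  rw [h1]
  refine Eq.trans ?_ (congrArg (splitQ n ≫ ·) (Category.comp_id _).symm)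
  exact mk_eq_iff.2 ((Derives.comp_id _ rfl).symm.trans (h.trans
    (comp_wd (dividers_one n) (.refl _))))

theorem sta_splitQ : sta x (n + 1) (consPhase n α β) ≫ splitQ n =
    (λ_ (𝟙_ Obj)).inv ≫ (sta x 1 (fun _ => α) ⊗ₘ sta x n β) := by
  have h := Derives.spider_dist x n 0 1 α β
  have h1 : (λ_ (𝟙_ Obj)).inv = 𝟙 (Obj.mk []) := eqHom_rfl (a := []) rfl
  rw [h1]
  refine Eq.trans ?_ (Category.id_comp (sta x 1 (fun _ => α) ⊗ₘ sta x n β)).symm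
  exact mk_eq_iff.2 ((comp_wd (.refl _) (dividers_one n).symm).trans (h.trans
    (Derives.id_comp _ _)))

theorem rot_splitQ : rot x (n + 1) (consPhase n α β) ≫ splitQ n =
    splitQ n ≫ (rot x 1 (fun _ => α) ⊗ₘ rot x n β) :=
  mk_eq_iff.2 ((comp_wd (.refl _) (dividers_one n).symm).trans
    ((Derives.spider_dist x n 1 1 α β).trans (comp_wd (dividers_one n) (.refl _))))

theorem copy_splitQ : copy x (n + 1) ≫ (splitQ n ⊗ₘ splitQ n) ≫ tensorμ (Q 1) (Q n) (Q 1) (Q n) =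
    splitQ n ≫ (copy x 1 ⊗ₘ copy x n) := by
  have h := Derives.spider_dist x n 1 2 0 0
  have h0 : (Fin.cons (α := fun _ => ℝ) 0 0 : Fin (n + 1) → ℝ) = 0 := consPhase_zero n
  rw [h0] at h
  rw [tensorμ_Q]
  exact mk_eq_iff.2 ((comp_wd (.refl _) (dividers_two n).symm).trans
    (h.trans (comp_wd (dividers_one n) (.refl _))))

theorem hadQ_splitQ : hadQ (n + 1) ≫ splitQ n = splitQ n ≫ (hadQ 1 ⊗ₘ hadQ n) :=
  mk_eq_iff.2 (.had_dist n)

theorem joinQ_cap : (joinQ n ⊗ₘ joinQ n) ≫ capQ (n + 1) = capOf (Q 1 ⊗ Q n) := by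
  have h1 : (λ_ (𝟙_ Obj)).hom = 𝟙 (Obj.mk []) := eqHom_rfl (a := []) rfl
  rw [capOf_tensor, tensorμ_Q, h1]
  refine Eq.trans ?_ (congrArg (midSwap 1 n 1 n ≫ ·) (Category.comp_id _).symm)
  exact mk_eq_iff.2 (.cap_dist n)

theorem dum_splitQ : dum .green (n + 1) 0 0 = root * dum .green n 0 0 := by
  have h1 := sta_splitQ .green n 0 0
  have h2 := eff_splitQ .red n 0 0
  rw [consPhase_zero] at h1 h2
  rw [dum]
  change _ ≫ eff .red _ _ = _
  rw [h2, ← Category.assoc, h1, Category.assoc]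
  exact scalar_comp_tensor _ _ _ _

instance : IsComonHom (splitQ n) where
  hom_counit := by
    have h := eff_splitQ .green n 0 0
    rw [consPhase_zero] at h
    exact h.symm
  hom_comul := by
    have h := tensorμ_tensorδ (Q 1) (Q n) (Q 1) (Q n)
    rw [show tensorδ (Q 1) (Q n) (Q 1) (Q n) = tensorμ (Q 1) (Q 1) (Q n) (Q n) by
      simp [tensorδ, tensorμ, SymmetricCategory.braiding_swap_eq_inv_braiding (Q n) (Q 1)]] at h
    rw [Comon.tensorObj_comul, comul_Q, comul_Q, comul_Q, ← reassoc_of% copy_splitQ, h,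
      Category.comp_id]

end Divide

/-! ### Registers -/

section Registers

open scoped ComonObj

attribute [local instance] ComonObj.instTensorUnit

section Transpose

variable {X Y Z W : Obj} [ComonObj X] [IsCommComonObj X] [ComonObj Y] [IsCommComonObj Y]
  [ComonObj Z] [IsCommComonObj Z] [ComonObj W] [IsCommComonObj W] [HasCap X] [HasCap Y] [HasCap Z]

theorem isTranspose_iff {A : X ⟶ Y} {B : Y ⟶ X} :
    IsTranspose A B ↔ delta (fst X Y ≫ A) (snd X Y) = delta (fst X Y) (snd X Y ≫ B) := by
  rw [IsTranspose, delta, delta, ← pair_whiskerRight, ← pair_whiskerLeft, pair_fst_snd,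
    Category.id_comp, Category.id_comp]

theorem delta_tensor (f g : W ⟶ X ⊗ Y) [IsComonHom f] [IsComonHom g] :
    delta f g = delta (f ≫ fst X Y) (g ≫ fst X Y) * delta (f ≫ snd X Y) (g ≫ snd X Y) := by
  have h : ∀ f : W ⟶ X ⊗ Y, IsComonHom f → pair (f ≫ fst X Y) (f ≫ snd X Y) = f := fun f _ => by
    rw [← comp_pair, pair_fst_snd, Category.comp_id]
  rw [delta]
  nth_rw 1 [← h f inferInstance, ← h g inferInstance]
  exact pair_pair_tensorμ_cap _ _ _ _

theorem isTranspose_associator : IsTranspose (α_ X Y Z).hom (α_ X Y Z).inv := by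
  rw [isTranspose_iff]
  rw [delta_tensor, delta_tensor, delta_tensor, delta_tensor (fst _ _ ≫ fst _ _)]
  have e1 : (α_ X Y Z).hom ≫ fst _ _ = fst _ _ ≫ fst _ _ := by
    rw [associator_hom_eq_pair, pair_fst]
  have e2 : (α_ X Y Z).hom ≫ snd _ _ ≫ fst _ _ = fst _ _ ≫ snd _ _ := by
    rw [associator_hom_eq_pair, reassoc_of% pair_snd, pair_fst]
  have e3 : (α_ X Y Z).hom ≫ snd _ _ ≫ snd _ _ = snd _ _ := by
    rw [associator_hom_eq_pair, reassoc_of% pair_snd, pair_snd]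
  have e4 : (α_ X Y Z).inv ≫ fst _ _ ≫ fst _ _ = fst _ _ := by
    rw [Iso.inv_comp_eq, e1]
  have e5 : (α_ X Y Z).inv ≫ fst _ _ ≫ snd _ _ = snd _ _ ≫ fst _ _ := by
    rw [Iso.inv_comp_eq, e2]
  have e6 : (α_ X Y Z).inv ≫ snd _ _ = snd _ _ ≫ snd _ _ := by
    rw [Iso.inv_comp_eq, e3]
  simp only [Category.assoc, e1, e2, e3, e4, e5, e6, mul_assoc]

theorem eq_one_of_isComonHom (f : W ⟶ 𝟙_ Obj) [IsComonHom f] : f = 1 := by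
  have h := IsComonHom.hom_counit f
  rwa [ComonObj.instTensorUnit_counit, Category.comp_id] at h

theorem delta_unit (f g : W ⟶ 𝟙_ Obj) [IsComonHom f] [IsComonHom g] : delta f g = 1 := by
  rw [eq_one_of_isComonHom f, eq_one_of_isComonHom g]
  exact one_mul (1 : W ⟶ 𝟙_ Obj)

theorem isTranspose_rightUnitor : IsTranspose (ρ_ X).inv (ρ_ X).hom := by
  have e1 : (ρ_ X).inv ≫ fst X (𝟙_ Obj) = 𝟙 X := by
    rw [fst, ComonObj.instTensorUnit_counit]
    simp
  have e2 : fst X (𝟙_ Obj) = (ρ_ X).hom := by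
    rw [fst, ComonObj.instTensorUnit_counit]
    simp
  rw [isTranspose_iff, delta_tensor, Category.assoc, e1, Category.comp_id, e2, delta_unit, mul_one]

end Transpose

/-- The object of a register of `n` qubits; there is no wire when `n = 0`. -/
def R (n : ℕ) : Obj := ⟨reg n⟩

instance : (n : ℕ) → ComonObj (R n)
  | 0 => inferInstanceAs (ComonObj (𝟙_ Obj))
  | n + 1 => inferInstanceAs (ComonObj (Q n.succPNat))

instance : (n : ℕ) → IsCommComonObj (R n)
  | 0 => inferInstanceAs (IsCommComonObj (𝟙_ Obj))
  | n + 1 => inferInstanceAs (IsCommComonObj (Q n.succPNat))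

instance : (n : ℕ) → SelfDual (R n)
  | 0 => inferInstanceAs (SelfDual (𝟙_ Obj))
  | n + 1 => inferInstanceAs (SelfDual (Q n.succPNat))

/-- The first qubit and the other qubits of a register. -/
def split (n : ℕ) : R (n + 1) ⟶ Q 1 ⊗ R n := mk (dividerReg n)

/-- A register from its first qubit and its other qubits. -/
def join (n : ℕ) : Q 1 ⊗ R n ⟶ R (n + 1) := mk (gathererReg n)

theorem split_zero : split 0 = (ρ_ (Q 1)).inv := (Q_rightUnitor_inv 1).symm

theorem join_zero : join 0 = (ρ_ (Q 1)).hom := (Q_rightUnitor_hom 1).symm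

theorem split_join : (n : ℕ) → split n ≫ join n = 𝟙 _
  | 0 => mk_eq_iff.2 (.id_comp _ rfl)
  | n + 1 => splitQ_joinQ n.succPNat

theorem join_split : (n : ℕ) → join n ≫ split n = 𝟙 _
  | 0 => mk_eq_iff.2 (.id_comp _ rfl)
  | n + 1 => joinQ_splitQ n.succPNat

/-- The gatherer as an isomorphism. -/
def joinIso (n : ℕ) : Q 1 ⊗ R n ≅ R (n + 1) where
  hom := join n
  inv := split n
  hom_inv_id := join_split n
  inv_hom_id := split_join n

instance : (n : ℕ) → IsComonHom (split n)
  | 0 => by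
    have h : IsComonHom (ρ_ (Q 1)).inv := inferInstance
    rw [split_zero]
    exact h
  | n + 1 => inferInstanceAs (IsComonHom (splitQ n.succPNat))

instance (n : ℕ) : IsComonHom (join n) := by
  have : IsComonHom (joinIso n).symm.hom := inferInstanceAs (IsComonHom (split n))
  exact inferInstanceAs (IsComonHom (joinIso n).symm.inv)

theorem isTranspose_join : (n : ℕ) → IsTranspose (join n) (split n)
  | 0 => by
    have h : IsTranspose (ρ_ (Q 1)).hom (ρ_ (Q 1)).inv := isTranspose_rightUnitor.symm
    rw [split_zero, join_zero]
    exact h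
  | n + 1 => by
    have h : joinQ n.succPNat ▷ _ ≫ capQ _ = _ ◁ splitQ n.succPNat ≫ capOf _ := by
      rw [← joinQ_cap, ← id_tensorHom, tensorHom_comp_tensorHom_assoc, Category.id_comp,
        splitQ_joinQ, tensorHom_id]
    exact h

/-- The value of qubit number `i`. -/
def coord : (n : ℕ) → Fin n → (R n ⟶ Q 1)
  | 0, i => i.elim0
  | n + 1, i => Fin.cases (split n ≫ fst _ _) (fun j => split n ≫ snd _ _ ≫ coord n j) i

theorem coord_zero (n : ℕ) : coord (n + 1) 0 = split n ≫ fst _ _ := rfl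

theorem coord_succ (n : ℕ) (i : Fin n) : coord (n + 1) i.succ = split n ≫ snd _ _ ≫ coord n i := rfl

instance isComonHom_coord : (n : ℕ) → (i : Fin n) → IsComonHom (coord n i)
  | 0, i => i.elim0
  | n + 1, i => by
    induction i using Fin.cases with
    | zero =>
      rw [coord_zero]
      infer_instance
    | succ j =>
      rw [coord_succ]
      have := isComonHom_coord n j
      infer_instance

theorem split_coord (n : ℕ) : split n = pair (coord (n + 1) 0) (split n ≫ snd _ _) := by
  rw [coord_zero, ← comp_pair, pair_fst_snd, Category.comp_id]

theorem join_coord_zero (n : ℕ) : join n ≫ coord (n + 1) 0 = fst _ _ := by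
  rw [coord_zero, reassoc_of% join_split]

theorem join_coord_succ (n : ℕ) (i : Fin n) :
    join n ≫ coord (n + 1) i.succ = snd _ _ ≫ coord n i := by
  rw [coord_succ, reassoc_of% join_split]

theorem coord_one : coord 1 0 = 𝟙 (Q 1) := by
  rw [coord_zero, split_zero]
  change (ρ_ (Q 1)).inv ≫ fst (Q 1) (𝟙_ Obj) = _
  rw [fst, ComonObj.instTensorUnit_counit]
  simp

/-- The isomorphism between two presentations of a register. -/
def castR {n m : ℕ} (h : n = m) : R n ⟶ R m := eqHom (congrArg reg h)

theorem castR_rfl {n : ℕ} (h : n = n) : castR h = 𝟙 (R n) := eqHom_rfl _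

theorem castR_coord {n m : ℕ} (h : n = m) (i : Fin m) :
    castR h ≫ coord m i = coord n (Fin.cast h.symm i) := by
  subst h
  rw [castR_rfl, Category.id_comp]
  rfl

instance {n m : ℕ} (h : n = m) : IsComonHom (castR h) := by
  subst h
  rw [castR_rfl]
  infer_instance

section

variable {W V : Obj} [ComonObj W] [IsCommComonObj W] [ComonObj V] [IsCommComonObj V]

/-- Copyable maps into a register are determined by their coordinates. -/
theorem hom_ext_coord : {n : ℕ} → {f g : W ⟶ R n} → [IsComonHom f] → [IsComonHom g] →
    (∀ i, f ≫ coord n i = g ≫ coord n i) → f = g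
  | 0, f, g, hf, hg, _ =>
    (@eq_one_of_isComonHom W _ _ f hf).trans (@eq_one_of_isComonHom W _ _ g hg).symm
  | n + 1, f, g, _, _, h => by
    have h1 : f ≫ split n = g ≫ split n := by
      refine hom_ext ?_ ?_
      · rw [Category.assoc, Category.assoc]
        exact h 0
      · refine hom_ext_coord fun i => ?_
        simp only [Category.assoc]
        exact h i.succ
    rw [← Category.comp_id f, ← split_join, reassoc_of% h1, split_join, Category.comp_id]

theorem delta_coord : {n : ℕ} → (f g : W ⟶ R n) → [IsComonHom f] → [IsComonHom g] →
    delta f g = ∏ i, delta (f ≫ coord n i) (g ≫ coord n i)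
  | 0, f, g, hf, hg => by
    rw [Fin.prod_univ_zero]
    exact @delta_unit W _ _ f g hf hg
  | n + 1, f, g, _, _ => by
    have h : delta f g = delta (f ≫ split n) (g ≫ split n) := by
      rw [← delta_comp_left (isTranspose_join n), Category.assoc, split_join, Category.comp_id]
    rw [h, delta_tensor, delta_coord (f := (f ≫ split n) ≫ snd _ _), Fin.prod_univ_succ]
    simp only [coord_zero, coord_succ, Category.assoc]

end

end Registers

/-! ### Linear forms -/

section Forms

open scoped ComonObj

attribute [local instance] ComonObj.instTensorUnit

/-- The copyable maps to a qubit.  They behave as functions with values in the field with two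
elements. -/
structure Form (W : Obj) [ComonObj W] [IsCommComonObj W] where
  hom : W ⟶ Q 1
  isComonHom : IsComonHom hom

attribute [instance] Form.isComonHom

namespace Form

variable {W V : Obj} [ComonObj W] [IsCommComonObj W] [ComonObj V] [IsCommComonObj V]

@[ext]
theorem ext {f g : Form W} (h : f.hom = g.hom) : f = g := by
  cases f
  cases g
  congr

instance : Add (Form W) := ⟨fun f g => ⟨addF f.hom g.hom, inferInstance⟩⟩

noncomputable instance : Zero (Form W) := ⟨⟨zeroF W, inferInstance⟩⟩

noncomputable instance : AddCommMonoid (Form W) where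
  add_assoc f g h := ext (addF_assoc _ _ _)
  zero_add f := ext (zeroF_addF _)
  add_zero f := ext ((addF_comm _ _).trans (zeroF_addF _))
  add_comm f g := ext (addF_comm _ _)
  nsmul := nsmulRec

theorem add_hom (f g : Form W) : (f + g).hom = addF f.hom g.hom := rfl

theorem zero_hom : (0 : Form W).hom = zeroF W := rfl

/-- Precomposition with a copyable map. -/
noncomputable def pull (h : V ⟶ W) [IsComonHom h] : Form W →+ Form V where
  toFun f := ⟨h ≫ f.hom, inferInstance⟩
  map_zero' := ext (comp_zeroF h)
  map_add' _ _ := ext (comp_addF h _ _)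

theorem pull_hom (h : V ⟶ W) [IsComonHom h] (f : Form W) : (pull h f).hom = h ≫ f.hom := rfl

/-- The controlled `Z` gate between two forms. -/
def cz (f g : Form W) : W ⟶ 𝟙_ Obj := SZX.cz f.hom g.hom

/-- The green effect of phase `θ` on a form. -/
def phase (θ : ℝ) (f : Form W) : W ⟶ 𝟙_ Obj := f.hom ≫ SZX.phase θ

theorem cz_comm (f g : Form W) : cz f g = cz g f := SZX.cz_comm _ _

theorem add_cz (f g h : Form W) : cz (f + g) h = cz f h * cz g h := cz_addF _ _ _

theorem zero_cz (h : Form W) : cz 0 h = 1 := zeroF_cz _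

theorem cz_add (f g h : Form W) : cz f (g + h) = cz f g * cz f h := by
  rw [cz_comm, add_cz, cz_comm g, cz_comm h]

theorem cz_mul_self (f g : Form W) : cz f g * cz f g = 1 := SZX.cz_mul_self _ _

theorem sum_cz {ι : Type*} (s : Finset ι) (f : ι → Form W) (g : Form W) :
    cz (∑ i ∈ s, f i) g = ∏ i ∈ s, cz (f i) g := by
  classical
  induction s using Finset.induction_on with
  | empty => exact zero_cz g
  | insert a s ha ih => rw [Finset.sum_insert ha, Finset.prod_insert ha, add_cz, ih]

theorem comp_cz (h : V ⟶ W) [IsComonHom h] (f g : Form W) :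
    h ≫ cz f g = cz (pull h f) (pull h g) := SZX.comp_cz h _ _

theorem comp_phase (h : V ⟶ W) [IsComonHom h] (θ : ℝ) (f : Form W) :
    h ≫ phase θ f = phase θ (pull h f) := (Category.assoc _ _ _).symm

theorem phase_mul (θ φ : ℝ) (f : Form W) : phase θ f * phase φ f = phase (θ + φ) f :=
  comp_phase_mul _ _ _

theorem phase_zero (f : Form W) : phase 0 f = 1 := comp_one f.hom

theorem phase_neg_mul (θ : ℝ) (f : Form W) : phase (-θ) f * phase θ f = 1 := by
  rw [phase_mul, neg_add_cancel, phase_zero]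

theorem phase_add (f g : Form W) :
    phase (-(π / 2)) (f + g) * (phase (π / 2) f * phase (π / 2) g) = cz f g := phase_addF _ _

theorem phase_zero_form : phase (-(π / 2)) (0 : Form W) = 1 := by
  rw [phase, zero_hom, zeroF, Category.assoc]
  change ε[W] ≫ zeroPhase _ = 1
  rw [zeroPhase_neg_pi_div_two]
  exact Category.comp_id _

/-- A quarter turn on a sum of bits against quarter turns on its terms. -/
theorem phase_sum {ι : Type*} [LinearOrder ι] (s : Finset ι) (f : ι → Form W) :
    phase (-(π / 2)) (∑ i ∈ s, f i) * ∏ i ∈ s, phase (π / 2) (f i) =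
      ∏ j ∈ s, ∏ i ∈ s with i < j, cz (f i) (f j) := by
  induction s using Finset.induction_on_max with
  | empty =>
    simp only [Finset.sum_empty, Finset.prod_empty, mul_one]
    exact phase_zero_form
  | insert a s ha ih =>
    have ha' : a ∉ s := fun h => lt_irrefl a (ha a h)
    have h1 : ∏ i ∈ insert a s with i < a, cz (f i) (f a) = cz (∑ i ∈ s, f i) (f a) := by
      rw [sum_cz, Finset.filter_insert, if_neg (lt_irrefl a), Finset.filter_true_of_mem ha]
    have h2 : ∏ j ∈ s, ∏ i ∈ insert a s with i < j, cz (f i) (f j) =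
        ∏ j ∈ s, ∏ i ∈ s with i < j, cz (f i) (f j) := by
      refine Finset.prod_congr rfl fun j hj => ?_
      rw [Finset.filter_insert, if_neg (ha j hj).not_gt]
    rw [Finset.prod_insert ha', Finset.prod_insert ha', Finset.sum_insert ha', h1, h2, ← ih,
      ← phase_add, add_comm]
    have h3 := phase_neg_mul (π / 2) (∑ i ∈ s, f i)
    calc _ = phase (-(π / 2)) (∑ i ∈ s, f i + f a) *
          (phase (π / 2) (f a) * ∏ i ∈ s, phase (π / 2) (f i)) *
          (phase (-(π / 2)) (∑ i ∈ s, f i) * phase (π / 2) (∑ i ∈ s, f i)) := by rw [h3, mul_one]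
      _ = _ := by ac_rfl

end Form

end Forms

/-! ### Dividing and gathering parts of a register -/

section Gather

open scoped ComonObj

attribute [local instance] ComonObj.instTensorUnit

/-- The value of qubit number `i`, as a form. -/
def X (n : ℕ) (i : Fin n) : Form (R n) := ⟨coord n i, inferInstance⟩

/-- The generalised divider. -/
def divideR (k s : ℕ) : R (k + s) ⟶ R k ⊗ R s := mk (divide k s)

/-- The generalised gatherer. -/
def gatherR (k s : ℕ) : R k ⊗ R s ⟶ R (k + s) := mk (gather k s)

theorem divideR_zero (s : ℕ) : divideR 0 s = castR (Nat.zero_add s) ≫ (λ_ (R s)).inv := by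
  have h : (λ_ (R s)).inv = 𝟙 (R s) := eqHom_rfl (a := reg s) _
  rw [h]
  exact (Category.comp_id (castR (Nat.zero_add s))).symm

theorem gatherR_zero (s : ℕ) : gatherR 0 s = (λ_ (R s)).hom ≫ castR (Nat.zero_add s).symm := by
  have h : (λ_ (R s)).hom = 𝟙 (R s) := eqHom_rfl (a := reg s) _
  rw [h]
  exact (Category.id_comp (castR (Nat.zero_add s).symm)).symm

theorem divideR_succ (k s : ℕ) : divideR (k + 1) s = castR (Nat.add_right_comm k 1 s) ≫
    split (k + s) ≫ Q 1 ◁ divideR k s ≫ (α_ (Q 1) (R k) (R s)).inv ≫ join k ▷ R s := by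
  have h : (α_ (Q 1) (R k) (R s)).inv ≫ join k ▷ R s =
      (mk (Diag.tensor (a := [1] ++ reg k) (b := reg (k + 1)) (gathererReg k) (wires (reg s))) :
        Q 1 ⊗ R k ⊗ R s ⟶ R (k + 1) ⊗ R s) := by
    have h1 : (α_ (Q 1) (R k) (R s)).inv = 𝟙 (Obj.mk ([1] ++ (reg k ++ reg s))) :=
      eqHom_rfl (a := [1] ++ (reg k ++ reg s)) _
    rw [h1]
    exact Category.id_comp (X := (Obj.mk ([1] ++ (reg k ++ reg s)))) _
  rw [h, ← Category.assoc, ← Category.assoc]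
  have h2 := mk_comp_eqHom (wires (reg (k + 1 + s))) (dividerReg (k + s))
    (by rw [Nat.add_right_comm])
  rw [mk_wires, Category.id_comp] at h2
  exact congrArg (fun f => (f ≫ Q 1 ◁ divideR k s) ≫
    (mk (Diag.tensor (a := [1] ++ reg k) (b := reg (k + 1)) (gathererReg k) (wires (reg s))) :
        Q 1 ⊗ R k ⊗ R s ⟶ R (k + 1) ⊗ R s)) h2

theorem gatherR_succ (k s : ℕ) : gatherR (k + 1) s = (split k ▷ R s ≫ (α_ (Q 1) (R k) (R s)).hom ≫
    Q 1 ◁ gatherR k s ≫ join (k + s)) ≫ castR (Nat.add_right_comm k 1 s).symm := by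
  have h : (α_ (Q 1) (R k) (R s)).hom ≫ Q 1 ◁ gatherR k s =
      (mk (Diag.tensor (a := [1]) (b := [1]) (wires [1]) (gather k s)) :
        (Q 1 ⊗ R k) ⊗ R s ⟶ Q 1 ⊗ R (k + s)) := by
    have h1 : (α_ (Q 1) (R k) (R s)).hom = 𝟙 (Obj.mk (([1] ++ reg k) ++ reg s)) :=
      eqHom_rfl (a := ([1] ++ reg k) ++ reg s) _
    rw [h1]
    exact Category.id_comp (X := (Obj.mk ([1] ++ (reg k ++ reg s)))) _
  rw [reassoc_of% h]
  have h2 := mk_comp_eqHom ((dividerReg k ⊠ wires (reg s)) ⨟ (wires [1] ⊠ gather k s) ⨟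
    gathererReg (k + s)) (wires (reg (k + 1 + s))) (by rw [Nat.add_right_comm])
  rw [mk_wires, Category.comp_id] at h2
  refine Eq.trans h2 ?_
  refine congrArg (· ≫ castR (Nat.add_right_comm k 1 s).symm) ?_
  exact Category.assoc (split k ▷ R s) (mk (Diag.tensor (a := [1]) (b := [1]) (wires [1])
    (gather k s)) : (Q 1 ⊗ R k) ⊗ R s ⟶ Q 1 ⊗ R (k + s)) (join (k + s))

instance isComonHom_divideR : (k s : ℕ) → IsComonHom (divideR k s)
  | 0, s => by
    have : IsComonHom (λ_ (R s)).inv := inferInstance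
    have : IsComonHom (castR (Nat.zero_add s) ≫ (λ_ (R s)).inv) := inferInstance
    rw [divideR_zero]
    exact this
  | k + 1, s => by
    have := isComonHom_divideR k s
    rw [divideR_succ]
    infer_instance

instance isComonHom_gatherR : (k s : ℕ) → IsComonHom (gatherR k s)
  | 0, s => by
    have : IsComonHom ((λ_ (R s)).hom ≫ castR (Nat.zero_add s).symm) := inferInstance
    rw [gatherR_zero]
    exact this
  | k + 1, s => by
    have := isComonHom_gatherR k s
    rw [gatherR_succ]
    infer_instance

theorem gatherR_castAdd : (k s : ℕ) → (i : Fin k) →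
    gatherR k s ≫ coord (k + s) (Fin.castAdd s i) = fst _ _ ≫ coord k i
  | 0, _, i => i.elim0
  | k + 1, s, i => by
    rw [gatherR_succ, Category.assoc, castR_coord]
    induction i using Fin.cases with
    | zero =>
      change _ ≫ coord (k + s + 1) 0 = _
      simp only [Category.assoc]
      rw [join_coord_zero, coord_zero, whiskerLeft_fst, associator_hom_eq_pair, pair_fst,
        reassoc_of% whiskerRight_fst]
    | succ i =>
      change _ ≫ coord (k + s + 1) (Fin.castAdd s i).succ = _
      simp only [Category.assoc]
      rw [join_coord_succ, coord_succ, reassoc_of% whiskerLeft_snd, gatherR_castAdd k s i,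
        associator_hom_eq_pair, reassoc_of% pair_snd, reassoc_of% pair_fst, Category.assoc,
        reassoc_of% whiskerRight_fst]

theorem gatherR_natAdd : (k s : ℕ) → (i : Fin s) →
    gatherR k s ≫ coord (k + s) (Fin.natAdd k i) = snd _ _ ≫ coord s i
  | 0, s, i => by
    have h : snd (𝟙_ Obj) (R s) = (λ_ (R s)).hom := by
      rw [snd, ComonObj.instTensorUnit_counit]
      simp
    have h1 : ((λ_ (R s)).hom ≫ castR (Nat.zero_add s).symm) ≫ coord (0 + s) (Fin.natAdd 0 i) =
        snd (𝟙_ Obj) (R s) ≫ coord s i := by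
      rw [Category.assoc, castR_coord, h]
      congr 2
      ext
      simp
    rw [gatherR_zero]
    exact h1
  | k + 1, s, i => by
    rw [gatherR_succ, Category.assoc, castR_coord]
    have e : Fin.cast (Nat.add_right_comm k 1 s) (Fin.natAdd (k + 1) i) = (Fin.natAdd k i).succ := by
      ext
      simp only [Fin.val_cast, Fin.val_natAdd, Fin.val_succ]
      omega
    rw [e]
    simp only [Category.assoc]
    rw [join_coord_succ, reassoc_of% whiskerLeft_snd, gatherR_natAdd k s i,
      associator_hom_eq_pair, reassoc_of% pair_snd, reassoc_of% pair_snd,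
      reassoc_of% whiskerRight_snd]

theorem divideR_castAdd : (k s : ℕ) → (i : Fin k) →
    divideR k s ≫ fst _ _ ≫ coord k i = coord (k + s) (Fin.castAdd s i)
  | 0, _, i => i.elim0
  | k + 1, s, i => by
    have e1 : (α_ (Q 1) (R k) (R s)).inv ≫ fst _ _ ≫ fst _ _ = fst _ _ := by
      rw [Iso.inv_comp_eq, associator_hom_eq_pair, pair_fst]
    have e2 : (α_ (Q 1) (R k) (R s)).inv ≫ fst _ _ ≫ snd _ _ = snd _ _ ≫ fst _ _ := by
      rw [Iso.inv_comp_eq, associator_hom_eq_pair, reassoc_of% pair_snd, pair_fst]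
    rw [divideR_succ]
    simp only [Category.assoc]
    rw [reassoc_of% whiskerRight_fst]
    induction i using Fin.cases with
    | zero =>
      rw [join_coord_zero, e1, whiskerLeft_fst, ← coord_zero, castR_coord]
      rfl
    | succ i =>
      rw [join_coord_succ, reassoc_of% e2, reassoc_of% whiskerLeft_snd, divideR_castAdd k s i,
        ← coord_succ, castR_coord]
      rfl

theorem divideR_natAdd : (k s : ℕ) → (i : Fin s) →
    divideR k s ≫ snd _ _ ≫ coord s i = coord (k + s) (Fin.natAdd k i)
  | 0, s, i => by
    have h : (λ_ (R s)).inv ≫ snd (𝟙_ Obj) (R s) = 𝟙 (R s) := by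
      rw [snd, ComonObj.instTensorUnit_counit]
      simp
    have h1 : (castR (Nat.zero_add s) ≫ (λ_ (R s)).inv) ≫ snd (𝟙_ Obj) (R s) ≫ coord s i =
        coord (0 + s) (Fin.natAdd 0 i) := by
      rw [Category.assoc, reassoc_of% h, castR_coord]
      congr 1
      ext
      simp
    rw [divideR_zero]
    exact h1
  | k + 1, s, i => by
    have e1 : (α_ (Q 1) (R k) (R s)).inv ≫ snd _ _ = snd _ _ ≫ snd _ _ := by
      rw [Iso.inv_comp_eq, associator_hom_eq_pair, reassoc_of% pair_snd, pair_snd]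
    rw [divideR_succ]
    simp only [Category.assoc]
    rw [reassoc_of% whiskerRight_snd, reassoc_of% e1, reassoc_of% whiskerLeft_snd,
      divideR_natAdd k s i, ← coord_succ, castR_coord]
    congr 1
    ext
    simp only [Fin.val_cast, Fin.val_natAdd, Fin.val_succ]
    omega

theorem divideR_gatherR (k s : ℕ) : divideR k s ≫ gatherR k s = 𝟙 _ := by
  refine hom_ext_coord fun i => ?_
  rw [Category.assoc, Category.id_comp]
  induction i using Fin.addCases with
  | left i => rw [gatherR_castAdd, divideR_castAdd]
  | right i => rw [gatherR_natAdd, divideR_natAdd]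

theorem isTranspose_gatherR (k s : ℕ) : IsTranspose (gatherR k s) (divideR k s) := by
  rw [isTranspose_iff, delta_coord, delta_tensor, delta_coord, delta_coord (f := fst _ _ ≫ snd _ _),
    Fin.prod_univ_add]
  simp only [Category.assoc, gatherR_castAdd, gatherR_natAdd, divideR_castAdd, divideR_natAdd]

end Gather

/-! ### Matrices on registers -/

section Matrices

open scoped ComonObj

attribute [local instance] ComonObj.instTensorUnit

theorem matrix_one_by_one (a : ZMod 2) :
    (mk (matrix (m := 1) (n := 1) (Matrix.of fun _ _ => a)) : Q 1 ⟶ Q 1) =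
      (if a = 0 then (0 : Form (Q 1)) else ⟨𝟙 _, inferInstance⟩).hom := by
  have h : ∀ a : ZMod 2, a = 0 ∨ a = 1 := by decide
  rcases h a with rfl | rfl
  · rw [if_pos rfl, Form.zero_hom, zeroF, zeroQ, comp_scale]
    refine (mk_eq_iff.2 Derives.matrix_zero).trans ((mk_scale _ _).trans ?_)
    rw [mk_tripleEdge_one]
    rfl
  · rw [if_neg one_ne_zero]
    have e : (Matrix.of fun _ _ => (1 : ZMod 2)) = (1 : Matrix (Fin (1 : ℕ+)) (Fin (1 : ℕ+)) _) := by
      ext i j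
      change (1 : ZMod 2) = (1 : Matrix (Fin 1) (Fin 1) (ZMod 2)) i j
      rw [Fin.fin_one_eq_zero i, Fin.fin_one_eq_zero j, Matrix.one_apply_eq]
    rw [e]
    exact mk_eq_iff.2 .matrix_one

/-- The matrix box of a matrix with at least one row and one column. -/
def matR {m n : ℕ} (A : Matrix (Fin (m + 1)) (Fin (n + 1)) (ZMod 2)) : R (n + 1) ⟶ R (m + 1) :=
  mk (matrix (m := m.succPNat) (n := n.succPNat) A)

/-- The matrix box of a matrix with one row. -/
def rowR {n : ℕ} (A : Matrix (Fin 1) (Fin (n + 1)) (ZMod 2)) : R (n + 1) ⟶ Q 1 :=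
  mk (matrix (m := 1) (n := n.succPNat) A)

theorem gatherR_rowR (n : ℕ) (A : Matrix (Fin 1) (Fin (n + 2)) (ZMod 2)) :
    gatherR (n + 1) 1 ≫ rowR A =
      addF (fst (R (n + 1)) (R 1) ≫ rowR (Matrix.of fun i j => A i (Fin.castAdd 1 j)))
        (snd (R (n + 1)) (R 1) ≫ rowR (Matrix.of fun i j => A i (Fin.natAdd (n + 1) j))) := by
  have h := mk_eq_iff.2 (Derives.matrix_cols (m := 1) (c := n.succPNat) (d := 1)
    (fun i j => A i (Fin.castAdd 1 j)) (fun i j => A i (Fin.natAdd (n + 1) j)))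
  have hA : colBlock (m := 1) (c := n.succPNat) (d := 1)
      (fun i j => A i (Fin.castAdd 1 j)) (fun i j => A i (Fin.natAdd (n + 1) j)) = A := by
    ext i j
    exact congrFun (Fin.append_castAdd_natAdd (m := n + 1) (n := 1) (f := A i)) j
  rw [hA] at h
  have h1 : gatherR (n + 1) 1 ≫ rowR A =
      root ⊙ ((rowR (Matrix.of fun i j => A i (Fin.castAdd 1 j)) ⊗ₘ
        rowR (n := 0) (Matrix.of fun i j => A i (Fin.natAdd (n + 1) j))) ≫ merge .red 1) :=
    h.trans (mk_scale _ _)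
  rw [h1, ← comp_scale, addF, ← pair_tensorHom, pair_fst_snd, Category.id_comp]
  rfl

theorem rowR_eq : {n : ℕ} → (A : Matrix (Fin 1) (Fin (n + 1)) (ZMod 2)) →
    rowR A = (∑ j, if A 0 j = 0 then 0 else X (n + 1) j).hom
  | 0, A => by
    have hA : A = Matrix.of fun _ _ => A 0 0 := by
      ext i j
      rw [Fin.fin_one_eq_zero i, Fin.fin_one_eq_zero j]
      rfl
    have h := matrix_one_by_one (A 0 0)
    have h1 : X 1 0 = (⟨𝟙 (Q 1), inferInstance⟩ : Form (Q 1)) := Form.ext coord_one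
    rw [Fin.sum_univ_one, h1]
    exact (congrArg (fun A => mk (matrix (m := 1) (n := 1) A)) hA).trans h
  | n + 1, A => by
    have h := congrArg (divideR (n + 1) 1 ≫ ·) (gatherR_rowR n A)
    simp only [reassoc_of% divideR_gatherR] at h
    rw [h, comp_addF, rowR_eq, rowR_eq]
    have e3 : ∀ {V : Obj} [ComonObj V] [IsCommComonObj V] (φ : Form V →+ Form (R (n + 2)))
        (p : Prop) [Decidable p] (f : Form V), φ (if p then 0 else f) = if p then 0 else φ f := by
      intro V _ _ φ p _ f
      split_ifs <;> simp
    have e1 : ∀ j, Form.pull (divideR (n + 1) 1 ≫ fst _ _) (X (n + 1) j) =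
        X (n + 2) (Fin.castAdd 1 j) := fun j =>
      Form.ext ((Category.assoc _ _ _).trans (divideR_castAdd _ _ _))
    have e2 : ∀ j, Form.pull (divideR (n + 1) 1 ≫ snd _ _) (X 1 j) =
        X (n + 2) (Fin.natAdd (n + 1) j) := fun j =>
      Form.ext ((Category.assoc _ _ _).trans (divideR_natAdd _ _ _))
    rw [← Category.assoc, ← Category.assoc, ← Form.pull_hom, ← Form.pull_hom, ← Form.add_hom,
      map_sum, map_sum]
    refine congrArg Form.hom ((congrArg₂ (· + ·) (Finset.sum_congr rfl fun j _ => ?_)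
      (Finset.sum_congr rfl fun j _ => ?_)).trans (Fin.sum_univ_add (a := n + 1) (b := 1)
        fun j => if A 0 j = 0 then 0 else X (n + 2) j).symm)
    · exact (e3 _ _ _).trans (by rw [e1]; rfl)
    · exact (e3 _ _ _).trans (congrArg (fun f => if A 0 (Fin.natAdd (n + 1) j) = 0 then 0 else f)
        (e2 j))

/-- The copyable map `M` acts on registers as the matrix `A`. -/
def IsMatrix {m n : ℕ} (M : R n ⟶ R m) (A : Matrix (Fin m) (Fin n) (ZMod 2)) : Prop :=
  IsComonHom M ∧ ∀ i, M ≫ coord m i = (∑ j, if A i j = 0 then 0 else X n j).hom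

theorem matR_divideR (m n : ℕ) (A : Matrix (Fin (m + 2)) (Fin (n + 1)) (ZMod 2)) :
    matR A ≫ divideR (m + 1) 1 =
      pair (matR fun i => A (Fin.castAdd 1 i)) (matR fun i => A (Fin.natAdd (m + 1) i)) := by
  have h := mk_eq_iff.2 (Derives.matrix_rows (a := m.succPNat) (b := 1) (n := n.succPNat)
    (fun i => A (Fin.castAdd 1 i)) (fun i => A (Fin.natAdd (m + 1) i)))
  have hA : rowBlock (a := m.succPNat) (b := 1) (n := n.succPNat)
      (fun i => A (Fin.castAdd 1 i)) (fun i => A (Fin.natAdd (m + 1) i)) = A := by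
    ext i j
    exact congrFun (congrFun (Fin.append_castAdd_natAdd (m := m + 1) (n := 1) (f := A)) i) j
  rw [hA] at h
  exact h

theorem isMatrix_matR {n : ℕ} : {m : ℕ} → (A : Matrix (Fin (m + 1)) (Fin (n + 1)) (ZMod 2)) →
    IsMatrix (matR A) A
  | 0, A => by
    have h := rowR_eq A
    refine ⟨?_, fun i => ?_⟩
    · have h2 : IsComonHom (rowR A) := by
        rw [h]
        infer_instance
      exact h2
    · rw [Fin.fin_one_eq_zero i]
      exact (congrArg (rowR A ≫ ·) coord_one).trans ((Category.comp_id _).trans h)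
  | m + 1, A => by
    have h := congrArg (· ≫ gatherR (m + 1) 1) (matR_divideR m n A)
    obtain ⟨hB, hB'⟩ := isMatrix_matR fun i => A (Fin.castAdd 1 i)
    obtain ⟨hC, hC'⟩ := isMatrix_matR (m := 0) fun i => A (Fin.natAdd (m + 1) i)
    simp only [Category.assoc, divideR_gatherR, Category.comp_id] at h
    refine ⟨?_, fun i => ?_⟩
    · rw [h]
      infer_instance
    · rw [h, Category.assoc]
      refine Fin.addCases (fun i => ?_) (fun i => ?_) i
      · rw [gatherR_castAdd, reassoc_of% pair_fst, hB']
      · rw [gatherR_natAdd, reassoc_of% pair_snd, hC']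

/-- A matrix box acts as its matrix.  Matrices with rows but no columns, which do not occur in graph
state boxes, are left out. -/
theorem isMatrix_matrixReg : {m n : ℕ} → (A : Matrix (Fin m) (Fin n) (ZMod 2)) →
    (n = 0 → m = 0) → IsMatrix (mk (matrixReg A)) A
  | 0, 0, _, _ => ⟨inferInstanceAs (IsComonHom (𝟙 (R 0))), fun i => i.elim0⟩
  | 0, n + 1, _, _ => ⟨inferInstanceAs (IsComonHom ε[Q n.succPNat]), fun i => i.elim0⟩
  | _ + 1, 0, _, h => absurd (h rfl) (Nat.succ_ne_zero _)
  | _ + 1, _ + 1, A, _ => isMatrix_matR A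

/-- The box of a permutation. -/
def permR {m n : ℕ} (τ : Fin n ≃ Fin m) : R n ⟶ R m := mk (permReg τ)

theorem isMatrix_permR {m n : ℕ} (τ : Fin n ≃ Fin m) :
    IsMatrix (permR τ) (Matrix.of fun i j => if τ j = i then 1 else 0) := by
  refine isMatrix_matrixReg _ fun h => ?_
  have := Fintype.card_congr τ
  simp only [Fintype.card_fin] at this
  omega

instance {m n : ℕ} (τ : Fin n ≃ Fin m) : IsComonHom (permR τ) := (isMatrix_permR τ).1

theorem permR_coord {m n : ℕ} (τ : Fin n ≃ Fin m) (i : Fin m) :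
    permR τ ≫ coord m i = coord n (τ.symm i) := by
  rw [(isMatrix_permR τ).2, Finset.sum_eq_single (τ.symm i)]
  · simp [X]
  · intro j _ hj
    have : τ j ≠ i := fun h => hj (by rw [← h, Equiv.symm_apply_apply])
    simp [this]
  · simp

theorem isTranspose_permR {m n : ℕ} (τ : Fin n ≃ Fin m) :
    IsTranspose (permR τ) (permR τ.symm) := by
  rw [isTranspose_iff, delta_coord, delta_coord, ← Equiv.prod_comp τ]
  simp only [Category.assoc, permR_coord, Equiv.symm_apply_apply, Equiv.symm_symm]

end Matrices

/-! ### Spiders and Hadamard boxes on registers -/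

section RegisterGates

open scoped ComonObj

attribute [local instance] ComonObj.instTensorUnit

theorem consPhase_tail (n : ℕ) (α : Fin (n + 2) → ℝ) :
    consPhase n.succPNat (α 0) (fun i => α (Fin.succ i)) = α :=
  Fin.cons_self_tail α

/-- The green effect on a register. -/
def effR {n : ℕ} (α : Fin (n + 1) → ℝ) : R (n + 1) ⟶ 𝟙_ Obj := eff .green n.succPNat α

theorem effR_succ (n : ℕ) (α : Fin (n + 2) → ℝ) : effR α =
    (coord (n + 2) 0 ≫ phase (α 0)) * ((split (n + 1) ≫ snd _ _) ≫ effR fun i => α i.succ) := by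
  have h := eff_splitQ .green n.succPNat (α 0) fun i => α (Fin.succ i)
  rw [consPhase_tail, tensor_effect] at h
  have h1 : effR α = split (n + 1) ≫ ((fst (Q 1) (R (n + 1)) ≫ phase (α 0)) *
      (snd (Q 1) (R (n + 1)) ≫ effR fun i => α (Fin.succ i))) := h
  rw [h1, comp_mul, coord_zero, Category.assoc, Category.assoc]

theorem effR_eq : (n : ℕ) → (α : Fin (n + 1) → ℝ) → effR α = ∏ i, Form.phase (α i) (X (n + 1) i)
  | 0, α => by
    have h : α = fun _ => α 0 := funext fun i => by rw [Fin.fin_one_eq_zero i]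
    have h1 : Form.phase (α 0) (X 1 0) = phase (α 0) :=
      (congrArg (· ≫ phase (α 0)) coord_one).trans (Category.id_comp _)
    rw [Fin.prod_univ_one]
    exact (congrArg effR h).trans h1.symm
  | n + 1, α => by
    rw [Fin.prod_univ_succ, effR_succ, effR_eq n, comp_prod]
    congr 1
    refine Finset.prod_congr rfl fun i _ => ?_
    simp only [Form.phase, X, coord_succ, Category.assoc]

theorem mk_sqrtTwoPow : (k : ℕ) → mk (sqrtTwoPow k) = root ^ k
  | 0 => (pow_zero root).symm
  | 1 => (pow_one root).symm
  | k + 2 => by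
    rw [pow_succ', ← mk_sqrtTwoPow (k + 1)]
    exact dum_splitQ k.succPNat

/-- The Hadamard box of a register. -/
def hadR (n : ℕ) : R n ⟶ R n := mk (hadReg n)

theorem hadR_split : (n : ℕ) → hadR (n + 1) ≫ split n = split n ≫ (hadQ 1 ⊗ₘ hadR n)
  | 0 => by
    have h : hadQ 1 ≫ (ρ_ (Q 1)).inv = (ρ_ (Q 1)).inv ≫ (hadQ 1 ⊗ₘ 𝟙 (𝟙_ Obj)) := by simp
    rw [split_zero]
    exact h
  | n + 1 => hadQ_splitQ n.succPNat

section

variable {X Y Z W : Obj} [ComonObj X] [IsCommComonObj X] [ComonObj Y] [IsCommComonObj Y]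
  [ComonObj Z] [IsCommComonObj Z] [ComonObj W] [IsCommComonObj W] [HasCap X] [HasCap Y] [HasCap Z]

theorem scale_mul_scale (s t : 𝟙_ Obj ⟶ 𝟙_ Obj) (a b : W ⟶ 𝟙_ Obj) :
    (s * t) ⊙ (a * b) = (s ⊙ a) * (t ⊙ b) := by
  rw [mul_scale, scale_mul_effect, mul_scale_effect]

theorem pair_comp_fst_snd (f : W ⟶ X ⊗ Y) [IsComonHom f] :
    pair (f ≫ fst X Y) (f ≫ snd X Y) = f := by
  rw [← comp_pair, pair_fst_snd, Category.comp_id]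

/-- Wires with Hadamard boxes between two registers are controlled `Z` gates between their
qubits. -/
theorem delta_hadR : (k : ℕ) → (f g : W ⟶ R k) → [IsComonHom f] → [IsComonHom g] →
    root ^ k ⊙ delta (f ≫ hadR k) g = ∏ i, cz (f ≫ coord k i) (g ≫ coord k i)
  | 0, f, g, hf, hg => by
    rw [Fin.prod_univ_zero, pow_zero, one_scale]
    have h : f ≫ hadR 0 = f := Category.comp_id f
    rw [h]
    exact @delta_unit W _ _ f g hf hg
  | k + 1, f, g, _, _ => by
    have h : delta (f ≫ hadR (k + 1)) g = delta (f ≫ hadR (k + 1) ≫ split k) (g ≫ split k) := by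
      rw [← delta_comp_left (isTranspose_join k), Category.assoc, Category.assoc, split_join,
        Category.comp_id]
    have h1 : f ≫ split k ≫ (hadQ 1 ⊗ₘ hadR k) =
        pair ((f ≫ coord (k + 1) 0) ≫ hadQ 1) ((f ≫ split k ≫ snd _ _) ≫ hadR k) := by
      rw [split_coord, reassoc_of% comp_pair, pair_tensorHom, pair_snd]
    have h2 : g ≫ split k = pair (g ≫ coord (k + 1) 0) (g ≫ split k ≫ snd _ _) := by
      rw [← comp_pair, ← split_coord]
    rw [h, hadR_split, h1, h2, delta, pair_pair_tensorμ_cap, pow_succ', scale_mul_scale, ← cz]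
    have h3 := delta_hadR k (f ≫ split k ≫ snd _ _) (g ≫ split k ≫ snd _ _)
    rw [delta] at h3
    rw [h3, Fin.prod_univ_succ]
    simp only [coord_succ, Category.assoc]

theorem IsTranspose.whiskerLeft {A : X ⟶ Y} {B : Y ⟶ X} (h : IsTranspose A B) (Z : Obj)
    [HasCap Z] : IsTranspose (Z ◁ A) (Z ◁ B) := by
  rw [← id_tensorHom, ← id_tensorHom]
  exact (IsTranspose.id Z).tensor h

theorem IsTranspose.whiskerRight {A : X ⟶ Y} {B : Y ⟶ X} (h : IsTranspose A B) (Z : Obj)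
    [HasCap Z] : IsTranspose (A ▷ Z) (B ▷ Z) := by
  rw [← tensorHom_id, ← tensorHom_id]
  exact h.tensor (IsTranspose.id Z)

end

/-- The green merging of registers. -/
def mergeR (n : ℕ) : R n ⊗ R n ⟶ R n := mk (mergeReg n)

theorem isTranspose_mergeR : (n : ℕ) → IsTranspose (mergeR n) Δ[R n]
  | 0 => by
    have h : IsTranspose (λ_ (𝟙_ Obj)).hom (λ_ (𝟙_ Obj)).inv := by
      rw [isTranspose_iff, delta_unit, delta_tensor, delta_unit, delta_unit, mul_one]
    have h1 : (λ_ (𝟙_ Obj)).hom = mergeR 0 := eqHom_rfl (a := []) rfl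
    rw [h1] at h
    exact h
  | n + 1 => isTranspose_merge_copy .green n.succPNat

/-- The matrix box that copies a bit `k` times. -/
def onesR (k : ℕ) : Q 1 ⟶ R k := mk (matrixReg (allOnes k 1))

theorem isMatrix_onesR (k : ℕ) : IsMatrix (n := 1) (onesR k) (allOnes k 1) :=
  isMatrix_matrixReg _ fun h => absurd h one_ne_zero

instance (k : ℕ) : IsComonHom (onesR k) := (isMatrix_onesR k).1

theorem onesR_coord (k : ℕ) (i : Fin k) : onesR k ≫ coord k i = 𝟙 _ := by
  refine ((isMatrix_onesR k).2 i).trans ?_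
  rw [Fin.sum_univ_one, if_neg (by exact one_ne_zero)]
  exact coord_one

end RegisterGates

/-! ### Graph state boxes as products of controlled `Z` gates -/

section Boxes

open scoped ComonObj

attribute [local instance] ComonObj.instTensorUnit

/-- The green spider without inputs and with two outputs. -/
def bell : 𝟙_ Obj ⟶ Q 1 ⊗ Q 1 := mk (spider₀ .green 1 0 2)

theorem toEffect_bell : toEffect bell = capQ 1 := by
  have h : bell = sta .green 1 0 ≫ copy .green 1 :=
    (mk_eq_iff.2 ((comp_wd (Derives.tensor_nil _).symm (Derives.nil_tensor _).symm).trans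
      (fuse (k := 0) (l := 0) (j := 0) (m := 0) (p := 2) (zero_add 0)))).symm
  rw [h, toEffect_comp (isTranspose_merge_copy .green 1).symm, toEffect_sta, ← cap_eq_merge]

/-- The class of a diagram that prepares a register. -/
def stateOf {n : ℕ} (D : Diag [] (reg n)) : 𝟙_ Obj ⟶ R n := mk D

theorem mk_comp₄_eqHom {a b b' c d e : Ty} (f : Diag a b) (g : Diag b' c) (k : Diag c d)
    (l : Diag d e) (h : b = b') :
    mk (((f.comp g h).comp k rfl).comp l rfl) = mk f ≫ eqHom h ≫ mk g ≫ mk k ≫ mk l := by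
  rw [mk_comp, mk_comp, mk_comp_eqHom, Category.assoc, Category.assoc, Category.assoc]

theorem stateOf_boxStep {n k s : ℕ} (τ : Fin n ≃ Fin (k + s)) (D : Diag [] (reg n)) :
    stateOf (boxStep τ D) =
      rootInv ⊙ root ^ k ⊙ (((λ_ (𝟙_ Obj)).inv ≫ ((bell ≫ Q 1 ◁ (onesR k ≫ hadR k)) ⊗ₘ
        (stateOf D ≫ permR τ ≫ divideR k s))) ≫ (α_ (Q 1) (R k) (R k ⊗ R s)).hom ≫
          Q 1 ◁ (α_ (R k) (R k) (R s)).inv ≫ Q 1 ◁ mergeR k ▷ R s ≫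
            Q 1 ◁ (gatherR k s ≫ permR τ.symm) ≫ join n) := by
  have h0 : (λ_ (𝟙_ Obj)).inv = 𝟙 (𝟙_ Obj ⊗ 𝟙_ Obj) := eqHom_rfl (a := []) rfl
  have h1 : (α_ (Q 1) (R k) (R k ⊗ R s)).hom ≫ Q 1 ◁ (α_ (R k) (R k) (R s)).inv =
      (eqHom (by simp) : Obj.mk (([1] ++ reg k) ++ (reg k ++ reg s)) ⟶
        Obj.mk ([1] ++ ((reg k ++ reg k) ++ reg s))) := by
    have h2 : Q 1 ◁ (α_ (R k) (R k) (R s)).inv = _ :=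
      whiskerLeft_eqHom (List.append_assoc (reg k) (reg k) (reg s)).symm [1]
    rw [h2]
    exact eqHom_trans _ _
  refine (mk_scale _ _).trans ?_
  rw [mk_tripleEdge_one]
  refine congrArg (rootInv ⊙ ·) ((mk_scale _ _).trans ?_)
  rw [mk_sqrtTwoPow]
  refine congrArg (root ^ k ⊙ ·) ?_
  have h3 : (λ_ (𝟙_ Obj)).inv ≫ ((bell ≫ Q 1 ◁ (onesR k ≫ hadR k)) ⊗ₘ
      (stateOf D ≫ permR τ ≫ divideR k s)) =
        ((bell ≫ Q 1 ◁ (onesR k ≫ hadR k)) ⊗ₘ ((stateOf D ≫ permR τ) ≫ divideR k s)) := by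
    rw [h0, Category.assoc]
    exact Category.id_comp _
  rw [h3, reassoc_of% h1]
  exact mk_comp₄_eqHom _ _ _ _ _

/-- The effect of a graph state box is that of the smaller box on the other vertices, times the
controlled `Z` gates between the new vertex and its neighbours.  In the smaller box the permutations
and dividers cancel, and green merging becomes copying. -/
theorem toEffect_boxStep {n k s : ℕ} (τ : Fin n ≃ Fin (k + s)) (D : Diag [] (reg n)) :
    toEffect (stateOf (boxStep τ D)) =
      rootInv ⊙ ((∏ i : Fin k, Form.cz (X (n + 1) 0) (X (n + 1) (τ.symm (Fin.castAdd s i)).succ)) *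
        ((split n ≫ snd _ _) ≫ toEffect (stateOf D))) := by
  set d := (split n ≫ snd _ _) ≫ permR τ ≫ divideR k s with hd
  have h1 : split n ≫ Q 1 ◁ (permR τ ≫ divideR k s) ≫ Q 1 ◁ Δ[R k] ▷ R s ≫
      Q 1 ◁ (α_ (R k) (R k) (R s)).hom ≫ (α_ (Q 1) (R k) (R k ⊗ R s)).inv =
      pair (pair (coord (n + 1) 0) (d ≫ fst _ _)) d := by
    have h2 : d ≫ Δ[R k] ▷ R s ≫ (α_ (R k) (R k) (R s)).hom = pair (d ≫ fst _ _) d := by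
      conv_lhs => rw [← pair_comp_fst_snd d]
      rw [reassoc_of% pair_whiskerRight, comp_comul, pair_associator_hom, pair_comp_fst_snd]
    rw [split_coord, reassoc_of% pair_whiskerLeft, reassoc_of% pair_whiskerLeft,
      reassoc_of% pair_whiskerLeft, ← hd, Category.assoc, h2, pair_associator_inv]
  have hT : IsTranspose ((α_ (Q 1) (R k) (R k ⊗ R s)).hom ≫
      Q 1 ◁ (α_ (R k) (R k) (R s)).inv ≫ Q 1 ◁ mergeR k ▷ R s ≫
        Q 1 ◁ (gatherR k s ≫ permR τ.symm) ≫ join n)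
      (pair (pair (coord (n + 1) 0) (d ≫ fst _ _)) d) := by
    have h2 := isTranspose_associator (X := Q 1) (Y := R k) (Z := R k ⊗ R s)
    have h3 := (isTranspose_associator (X := R k) (Y := R k) (Z := R s)).symm.whiskerLeft (Q 1)
    have h4 := ((isTranspose_mergeR k).whiskerRight (R s)).whiskerLeft (Q 1)
    have h5 := ((isTranspose_gatherR k s).comp (isTranspose_permR τ.symm)).whiskerLeft (Q 1)
    rw [Equiv.symm_symm] at h5
    have h := h2.comp (h3.comp (h4.comp (h5.comp (isTranspose_join n))))
    simp only [Category.assoc] at h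
    rw [h1] at h
    exact h
  have hE : toEffect (bell ≫ Q 1 ◁ (onesR k ≫ hadR k)) =
      delta (fst (Q 1) (R k) ≫ onesR k ≫ hadR k) (snd (Q 1) (R k)) := by
    have h2 := isTranspose_transpose (onesR k ≫ hadR k)
    rw [toEffect_comp (h2.whiskerLeft (Q 1)), toEffect_bell, ← capOf_Q, ← h2, delta,
      ← pair_whiskerRight, pair_fst_snd, Category.id_comp]
  have hE' : toEffect (stateOf D ≫ permR τ ≫ divideR k s) =
      (gatherR k s ≫ permR τ.symm) ≫ toEffect (stateOf D) :=
    toEffect_comp ((isTranspose_permR τ).comp (isTranspose_gatherR k s).symm) _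
  have hp : permR τ ≫ permR τ.symm = 𝟙 _ := hom_ext_coord fun i => by
    rw [Category.assoc, permR_coord, permR_coord, Equiv.symm_symm, Equiv.symm_apply_apply,
      Category.id_comp]
  have hd' : d ≫ gatherR k s ≫ permR τ.symm = split n ≫ snd _ _ := by
    simp only [hd, Category.assoc]
    rw [reassoc_of% divideR_gatherR, hp, Category.comp_id]
  have hd'' : ∀ i, d ≫ fst _ _ ≫ coord k i = coord (n + 1) (τ.symm (Fin.castAdd s i)).succ :=
    fun i => by
      simp only [hd, Category.assoc]
      rw [divideR_castAdd, permR_coord, coord_succ]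
  rw [stateOf_boxStep, toEffect_scale, toEffect_scale, toEffect_comp hT, toEffect_tensor, hE, hE',
    tensor_effect, comp_mul, reassoc_of% pair_fst, reassoc_of% pair_snd, ← Category.assoc d, hd',
    comp_delta, reassoc_of% pair_fst, pair_snd, ← scale_mul_effect]
  congr 2
  rw [← Category.assoc (coord (n + 1) 0), delta_hadR]
  refine Finset.prod_congr rfl fun i _ => ?_
  rw [Form.cz, X, X, Category.assoc, Category.assoc, onesR_coord, Category.comp_id, hd'']

end Boxes

/-! ### Red rotations of a register -/

section RedRotation

open scoped ComonObj

attribute [local instance] ComonObj.instTensorUnit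

/-- The red rotation of a register, trivial when the register is empty. -/
def xR : {n : ℕ} → (Fin n → ℝ) → (R n ⟶ R n)
  | 0, _ => 𝟙 _
  | n + 1, α => rot .red n.succPNat α

theorem xR_split : (n : ℕ) → (α : Fin (n + 1) → ℝ) →
    xR α ≫ split n = split n ≫ (rot .red 1 (fun _ => α 0) ⊗ₘ xR fun i => α i.succ)
  | 0, α => by
    have h : α = fun _ => α 0 := funext fun i => by rw [Fin.fin_one_eq_zero i]
    have h1 : rot .red 1 (fun _ => α 0) ≫ (ρ_ (Q 1)).inv =
        (ρ_ (Q 1)).inv ≫ (rot .red 1 (fun _ => α 0) ⊗ₘ 𝟙 (𝟙_ Obj)) := by simp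
    rw [split_zero]
    exact (congrArg (fun β => rot .red 1 β ≫ (ρ_ (Q 1)).inv) h).trans h1
  | n + 1, α => by
    have h := rot_splitQ .red n.succPNat (α 0) fun i => α (Fin.succ i)
    rw [consPhase_tail] at h
    exact h

theorem xR_zero : (n : ℕ) → xR (fun _ : Fin n => 0) = 𝟙 (R n)
  | 0 => rfl
  | n + 1 => rot_zero .red n.succPNat

/-- Adds the first bit to bit number `u` of the register. -/
def shift : {n : ℕ} → Fin n → (Q 1 ⊗ R n ⟶ R n)
  | 0, u => u.elim0
  | n + 1, u => Fin.cases
      (Q 1 ◁ split n ≫ (α_ (Q 1) (Q 1) (R n)).inv ≫ addQ ▷ R n ≫ join n)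
      (fun v => Q 1 ◁ split n ≫ (α_ (Q 1) (Q 1) (R n)).inv ≫ (β_ (Q 1) (Q 1)).hom ▷ R n ≫
        (α_ (Q 1) (Q 1) (R n)).hom ≫ Q 1 ◁ shift v ≫ join n) u

theorem shift_zero (n : ℕ) : shift (0 : Fin (n + 1)) =
    Q 1 ◁ split n ≫ (α_ (Q 1) (Q 1) (R n)).inv ≫ addQ ▷ R n ≫ join n := rfl

theorem shift_succ {n : ℕ} (v : Fin n) : shift v.succ =
    Q 1 ◁ split n ≫ (α_ (Q 1) (Q 1) (R n)).inv ≫ (β_ (Q 1) (Q 1)).hom ▷ R n ≫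
        (α_ (Q 1) (Q 1) (R n)).hom ≫ Q 1 ◁ shift v ≫ join n := rfl

instance isComonHom_shift : {n : ℕ} → (u : Fin n) → IsComonHom (shift u)
  | 0, u => u.elim0
  | n + 1, u => by
    induction u using Fin.cases with
    | zero =>
      rw [shift_zero]
      infer_instance
    | succ v =>
      have := isComonHom_shift v
      rw [shift_succ]
      infer_instance

theorem shift_eq_pair_zero (n : ℕ) : shift (0 : Fin (n + 1)) =
    pair (addF (fst _ _) (snd _ _ ≫ coord (n + 1) 0)) (snd _ _ ≫ split n ≫ snd _ _) ≫ join n := by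
  have h : Q 1 ◁ split n = pair (fst _ _) (pair (snd _ _ ≫ coord (n + 1) 0)
      (snd _ _ ≫ split n ≫ snd _ _)) := by
    rw [← comp_pair, ← split_coord, ← pair_whiskerLeft, pair_fst_snd, Category.id_comp]
  rw [shift_zero, h, reassoc_of% pair_associator_inv, reassoc_of% pair_whiskerRight, addF]

theorem shift_eq_pair_succ {n : ℕ} (v : Fin n) : shift v.succ =
    pair (snd _ _ ≫ coord (n + 1) 0) (pair (fst _ _) (snd _ _ ≫ split n ≫ snd _ _) ≫ shift v) ≫
      join n := by
  have h : Q 1 ◁ split n = pair (fst _ _) (pair (snd _ _ ≫ coord (n + 1) 0)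
      (snd _ _ ≫ split n ≫ snd _ _)) := by
    rw [← comp_pair, ← split_coord, ← pair_whiskerLeft, pair_fst_snd, Category.id_comp]
  rw [shift_succ, h, reassoc_of% pair_associator_inv, reassoc_of% pair_whiskerRight, pair_braiding,
    reassoc_of% pair_associator_hom, reassoc_of% pair_whiskerLeft]

theorem shift_coord_self : {n : ℕ} → (u : Fin n) →
    shift u ≫ coord n u = addF (fst _ _) (snd _ _ ≫ coord n u)
  | 0, u => u.elim0
  | n + 1, u => by
    induction u using Fin.cases with
    | zero => rw [shift_eq_pair_zero, Category.assoc, join_coord_zero, pair_fst]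
    | succ v =>
      rw [shift_eq_pair_succ, Category.assoc, join_coord_succ, reassoc_of% pair_snd,
        Category.assoc, shift_coord_self v, comp_addF, pair_fst, reassoc_of% pair_snd, coord_succ,
        Category.assoc, Category.assoc]

theorem shift_coord_of_ne : {n : ℕ} → (u i : Fin n) → i ≠ u →
    shift u ≫ coord n i = snd _ _ ≫ coord n i
  | 0, u, _, _ => u.elim0
  | n + 1, u, i, h => by
    induction u using Fin.cases with
    | zero =>
      obtain ⟨j, rfl⟩ := Fin.exists_succ_eq.2 h
      rw [shift_eq_pair_zero, Category.assoc, join_coord_succ, reassoc_of% pair_snd, coord_succ,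
        Category.assoc, Category.assoc]
    | succ v =>
      rw [shift_eq_pair_succ, Category.assoc]
      induction i using Fin.cases with
      | zero => rw [join_coord_zero, pair_fst]
      | succ j =>
        rw [join_coord_succ, reassoc_of% pair_snd, Category.assoc,
          shift_coord_of_ne v j fun e => h (congrArg Fin.succ e), reassoc_of% pair_snd, coord_succ,
          Category.assoc, Category.assoc]

/-- A red rotation of one qubit adds an auxiliary bit, in a red state, to this qubit. -/
theorem xR_single (θ : ℝ) : {n : ℕ} → (u : Fin n) →
    xR (fun i => if i = u then θ else 0) = (λ_ (R n)).inv ≫ redState θ ▷ R n ≫ shift u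
  | 0, u => u.elim0
  | n + 1, u => by
    have h1 : ∀ α : Fin (n + 1) → ℝ, xR α =
        split n ≫ (rot .red 1 (fun _ => α 0) ⊗ₘ xR fun i => α i.succ) ≫ join n := fun α => by
      rw [← reassoc_of% xR_split, split_join, Category.comp_id]
    have h2 : (λ_ (R (n + 1))).inv ≫ redState θ ▷ R (n + 1) ≫ Q 1 ◁ split n ≫
        (α_ (Q 1) (Q 1) (R n)).inv = split n ≫ ((λ_ (Q 1)).inv ≫ redState θ ▷ Q 1) ▷ R n := by
      rw [← whisker_exchange_assoc, ← leftUnitor_inv_naturality_assoc]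
      congr 1
      monoidal
    rw [h1]
    induction u using Fin.cases with
    | zero =>
      have h3 : ∀ i : Fin n, (i.succ = 0) = False := fun i => eq_false (Fin.succ_ne_zero i)
      simp only [if_true, h3, if_false]
      rw [shift_zero, reassoc_of% h2, xR_zero, tensorHom_id, rot_red_eq, ← comp_whiskerRight_assoc,
        Category.assoc]
    | succ v =>
      have h3 : ((0 : Fin (n + 1)) = v.succ) = False := eq_false (Fin.succ_ne_zero v).symm
      have h4 : rot .red 1 (fun _ => (0 : ℝ)) = 𝟙 _ := rot_zero .red 1
      have h5 : ((λ_ (Q 1)).inv ≫ redState θ ▷ Q 1) ▷ R n ≫ (β_ (Q 1) (Q 1)).hom ▷ R n ≫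
          (α_ (Q 1) (Q 1) (R n)).hom = Q 1 ◁ ((λ_ (R n)).inv ≫ redState θ ▷ R n) := by
        rw [← comp_whiskerRight_assoc, Category.assoc, BraidedCategory.braiding_naturality_left,
          braiding_tensorUnit_left, Category.assoc, Iso.inv_hom_id_assoc]
        monoidal
      simp only [h3, if_false, Fin.succ_inj]
      rw [shift_succ, reassoc_of% h2, reassoc_of% h5, h4, xR_single θ v, id_tensorHom,
        ← MonoidalCategory.whiskerLeft_comp_assoc, Category.assoc]

/-- A factor that does not involve the auxiliary bit may be taken out. -/
theorem redState_whisker_mul {W : Obj} [ComonObj W] [IsCommComonObj W] (r : 𝟙_ Obj ⟶ Q 1)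
    (a : W ⟶ 𝟙_ Obj) (b : Q 1 ⊗ W ⟶ 𝟙_ Obj) :
    (λ_ W).inv ≫ r ▷ W ≫ ((snd (Q 1) W ≫ a) * b) = a * ((λ_ W).inv ≫ r ▷ W ≫ b) := by
  have h : (snd (Q 1) W ≫ a) * b = Q 1 ◁ weight a (𝟙 W) ≫ b := by
    rw [whiskerLeft_weight, MonoidalCategory.whiskerLeft_id, weight_comp_effect, Category.id_comp]
  rw [h, ← whisker_exchange_assoc, ← leftUnitor_inv_naturality_assoc, weight_comp_effect,
    Category.id_comp]

end RedRotation

/-! ### The effect of a graph -/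

section Graph

open scoped ComonObj

attribute [local instance] ComonObj.instTensorUnit

open Classical in
/-- The product of the controlled `Z` gates on the edges of a graph, each edge being counted once,
at its larger end. -/
noncomputable def graphEff {n : ℕ} (G : SimpleGraph (Fin n)) : R n ⟶ 𝟙_ Obj :=
  ∏ j, ∏ i, if i < j ∧ G.Adj i j then Form.cz (X n i) (X n j) else 1

/-- The effect of a graph state box depends on the graph only, not on the permutations chosen. -/
theorem toEffect_box {n : ℕ} {G : SimpleGraph (Fin n)} {D : Diag [] (reg n)}
    (h : IsGraphStateBox G D) : toEffect (stateOf D) = rootInv ^ n ⊙ graphEff G := by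
  classical
  induction h with
  | single G =>
    have h1 : stateOf boxK₁ = rootInv ⊙ sta .green 1 0 := by
      rw [← mk_tripleEdge_one]
      exact mk_scale _ _
    have h2 : graphEff G = 1 := by
      refine Finset.prod_eq_one fun j _ => Finset.prod_eq_one fun i _ => if_neg fun h => ?_
      rw [Fin.fin_one_eq_zero i, Fin.fin_one_eq_zero j] at h
      exact lt_irrefl _ h.1
    rw [h1, h2, pow_one]
    refine (toEffect_scale (X := Q 1) _ _).trans ?_
    rw [toEffect_sta]
    rfl
  | @step n k s G τ hτ D hD ih =>
    have h1 : ∏ i : Fin k, Form.cz (X (n + 1) 0) (X (n + 1) (τ.symm (Fin.castAdd s i)).succ) =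
        ∏ j : Fin n, if G.Adj 0 j.succ then Form.cz (X (n + 1) 0) (X (n + 1) j.succ) else 1 := by
      simp only [hτ]
      rw [← Equiv.prod_comp τ.symm, Fin.prod_univ_add]
      simp
    have h2 : (split n ≫ snd _ _) ≫ graphEff (G.comap Fin.succ) =
        ∏ j : Fin n, ∏ i : Fin n, if i.succ < j.succ ∧ G.Adj i.succ j.succ then
          Form.cz (X (n + 1) i.succ) (X (n + 1) j.succ) else 1 := by
      rw [graphEff, comp_prod]
      refine Finset.prod_congr rfl fun j _ => ?_
      rw [comp_prod]
      refine Finset.prod_congr rfl fun i _ => ?_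
      have h3 : ∀ i, Form.pull (split n ≫ snd _ _) (X n i) = X (n + 1) i.succ := fun i =>
        Form.ext (Category.assoc _ _ _)
      simp only [Fin.succ_lt_succ_iff, SimpleGraph.comap_adj]
      split_ifs
      · rw [Form.comp_cz, h3, h3]
      · exact comp_one _
    rw [toEffect_boxStep, ih, h1, comp_scale, h2, mul_scale_effect, ← mul_scale, ← pow_succ']
    congr 1
    rw [graphEff, Fin.prod_univ_succ]
    simp only [Fin.prod_univ_succ, Fin.not_lt_zero, false_and, if_false, Finset.prod_const_one,
      Fin.succ_pos, true_and, Finset.prod_mul_distrib, one_mul]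

variable {n : ℕ} (G : SimpleGraph (Fin n)) (u : Fin n)

open Classical in
/-- The sum of the bits of the neighbours of a vertex. -/
noncomputable def neighborSum : Form (R n) := ∑ j with G.Adj u j, X n j

theorem shift_comp_cz {i j : Fin n} (h : i ≠ j) :
    shift u ≫ Form.cz (X n i) (X n j) = (snd _ _ ≫ Form.cz (X n i) (X n j)) *
      ((if i = u then Form.cz ⟨fst (Q 1) (R n), inferInstance⟩ (Form.pull (snd _ _) (X n j)) else 1) *
        if j = u then Form.cz ⟨fst (Q 1) (R n), inferInstance⟩ (Form.pull (snd _ _) (X n i))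
          else 1) := by
  set y : Form (Q 1 ⊗ R n) := ⟨fst (Q 1) (R n), inferInstance⟩ with hy
  have h1 : Form.pull (shift u) (X n u) = y + Form.pull (snd _ _) (X n u) :=
    Form.ext (shift_coord_self u)
  have h2 : ∀ i, i ≠ u → Form.pull (shift u) (X n i) = Form.pull (snd _ _) (X n i) :=
    fun i hi => Form.ext (shift_coord_of_ne u i hi)
  rw [Form.comp_cz, Form.comp_cz]
  by_cases hi : i = u
  · subst hi
    rw [if_pos rfl, if_neg h.symm, h1, h2 j h.symm, Form.add_cz, mul_one, mul_comm]
  · by_cases hj : j = u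
    · subst hj
      rw [if_neg hi, if_pos rfl, h1, h2 i hi, Form.cz_add, one_mul, mul_comm, Form.cz_comm _ y]
    · rw [if_neg hi, if_neg hj, h2 i hi, h2 j hj, mul_one, mul_one]

/-- Adding an auxiliary bit to the bit of the vertex `u` contributes a controlled `Z` gate between
the auxiliary bit and the sum of the neighbours of `u`. -/
theorem shift_comp_graphEff : shift u ≫ graphEff G = (snd _ _ ≫ graphEff G) *
    Form.cz ⟨fst (Q 1) (R n), inferInstance⟩ (Form.pull (snd _ _) (neighborSum G u)) := by
  classical
  set y : Form (Q 1 ⊗ R n) := ⟨fst (Q 1) (R n), inferInstance⟩ with hy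
  set c : Fin n → (Q 1 ⊗ R n ⟶ 𝟙_ Obj) := fun j => Form.cz y (Form.pull (snd _ _) (X n j)) with hc
  have h1 : shift u ≫ graphEff G = ∏ j, ∏ i,
      ((snd _ _ ≫ if i < j ∧ G.Adj i j then Form.cz (X n i) (X n j) else 1) *
        ((if i = u ∧ i < j ∧ G.Adj i j then c j else 1) *
          if j = u ∧ i < j ∧ G.Adj i j then c i else 1)) := by
    rw [graphEff, comp_prod]
    refine Finset.prod_congr rfl fun j _ => ?_
    rw [comp_prod]
    refine Finset.prod_congr rfl fun i _ => ?_
    by_cases h : i < j ∧ G.Adj i j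
    · simp only [h, and_true, if_true]
      exact shift_comp_cz u h.1.ne
    · simp only [h, and_false, if_false, mul_one]
      rw [comp_one, comp_one]
  have h2 : snd _ _ ≫ graphEff G = ∏ j, ∏ i,
      (snd (Q 1) (R n) ≫ if i < j ∧ G.Adj i j then Form.cz (X n i) (X n j) else 1) := by
    rw [graphEff, comp_prod]
    exact Finset.prod_congr rfl fun j _ => comp_prod _ _ _
  have h3 : (∏ j, ∏ i, if i = u ∧ i < j ∧ G.Adj i j then c j else 1) =
      ∏ j, if u < j ∧ G.Adj u j then c j else 1 := by
    refine Finset.prod_congr rfl fun j _ => ?_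
    rw [Finset.prod_eq_single u]
    · simp
    · intro i _ hi
      rw [if_neg fun h => hi h.1]
    · simp
  have h4 : (∏ j, ∏ i, if j = u ∧ i < j ∧ G.Adj i j then c i else 1) =
      ∏ j, if j < u ∧ G.Adj u j then c j else 1 := by
    rw [Finset.prod_comm]
    refine Finset.prod_congr rfl fun j _ => ?_
    rw [Finset.prod_eq_single u]
    · simp [G.adj_comm]
    · intro i _ hi
      rw [if_neg fun h => hi h.1]
    · simp
  have h5 : Form.cz y (Form.pull (snd _ _) (neighborSum G u)) =
      ∏ j, if G.Adj u j then c j else 1 := by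
    rw [Form.cz_comm, neighborSum, map_sum, Form.sum_cz, Finset.prod_filter]
    simp only [Form.cz_comm _ y, hc]
  rw [h1, h2, h5]
  simp only [Finset.prod_mul_distrib]
  rw [h3, h4, ← Finset.prod_mul_distrib]
  congr 1
  refine Finset.prod_congr rfl fun j _ => ?_
  rcases lt_trichotomy u j with h | h | h
  · simp [h, h.not_gt]
  · simp [h]
  · simp [h, h.not_gt]

open Classical in
theorem effR_phaseOn {n : ℕ} (G : SimpleGraph (Fin (n + 1))) (u : Fin (n + 1)) (φ : ℝ) :
    effR (phaseOn (G.neighborSet u) φ) = ∏ j with G.Adj u j, Form.phase φ (X (n + 1) j) := by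
  rw [effR_eq, Finset.prod_filter]
  refine Finset.prod_congr rfl fun j _ => ?_
  rw [phaseOn, Set.indicator_apply]
  simp only [SimpleGraph.mem_neighborSet]
  split_ifs
  · rfl
  · exact Form.phase_zero _

/-- A red rotation of the vertex `u` becomes a green phase on the sum of the neighbours of `u`. -/
theorem xR_phaseOn_comp {n : ℕ} (G : SimpleGraph (Fin (n + 1))) (u : Fin (n + 1)) (θ φ : ℝ) :
    xR (phaseOn {u} θ) ≫ (effR (phaseOn (G.neighborSet u) φ) * graphEff G) =
      graphEff G * (Form.phase θ (neighborSum G u) *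
        effR (phaseOn (G.neighborSet u) φ)) := by
  classical
  have h1 : phaseOn {u} θ = fun i => if i = u then θ else 0 := by
    funext i
    rw [phaseOn, Set.indicator_apply]
    rfl
  have h2 : shift u ≫ effR (phaseOn (G.neighborSet u) φ) =
      snd _ _ ≫ effR (phaseOn (G.neighborSet u) φ) := by
    rw [effR_phaseOn, comp_prod, comp_prod]
    refine Finset.prod_congr rfl fun j hj => ?_
    have hj' : j ≠ u := (G.ne_of_adj (Finset.mem_filter.1 hj).2).symm
    rw [Form.comp_phase, Form.comp_phase]
    congr 1
    exact Form.ext (shift_coord_of_ne u j hj')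
  rw [h1, xR_single, Category.assoc, Category.assoc, comp_mul, h2, shift_comp_graphEff,
    ← mul_assoc, ← comp_mul, redState_whisker_mul]
  have h3 := redState_cz θ (neighborSum G u).hom
  change _ ≫ _ ≫ Form.cz ⟨fst (Q 1) (R (n + 1)), inferInstance⟩
    (Form.pull (snd _ _) (neighborSum G u)) = Form.phase θ (neighborSum G u) at h3
  rw [h3, mul_comm (effR _) (graphEff G), mul_assoc, mul_comm (effR _)]

/-- Local complementation toggles the controlled `Z` gates between the neighbours. -/
theorem graphEff_localComplement : (open Classical in graphEff G *
    ∏ j with G.Adj u j, ∏ i ∈ Finset.univ.filter (G.Adj u ·) with i < j,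
      Form.cz (X n i) (X n j)) = graphEff (localComplement G u) := by
  classical
  rw [Finset.prod_filter, graphEff, graphEff, ← Finset.prod_mul_distrib]
  refine Finset.prod_congr rfl fun j _ => ?_
  have h : (if G.Adj u j then ∏ i ∈ Finset.univ.filter (G.Adj u ·) with i < j,
      Form.cz (X n i) (X n j) else 1) =
      ∏ i, if G.Adj u j ∧ G.Adj u i ∧ i < j then Form.cz (X n i) (X n j) else 1 := by
    rw [Finset.filter_filter, Finset.prod_filter]
    split_ifs with h
    · simp [h]
    · simp [h]
  rw [h, ← Finset.prod_mul_distrib]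
  refine Finset.prod_congr rfl fun i _ => ?_
  by_cases hij : i < j
  · have hne := hij.ne
    by_cases h1 : G.Adj i j <;> by_cases h2 : G.Adj u i <;> by_cases h3 : G.Adj u j <;>
      simp [localComplement, Xor, hij, hne, h1, h2, h3, Form.cz_mul_self]
  · simp [hij]

/-- Opposite quarter turns on the sum of the neighbours of `u` and on each of them complement the
edges between the neighbours. -/
theorem graphEff_mul_phase {n : ℕ} (G : SimpleGraph (Fin (n + 1))) (u : Fin (n + 1)) (σ : ℝ)
    (hσ : σ = 1 ∨ σ = -1) :
    graphEff G * (Form.phase (σ * (π / 2)) (neighborSum G u) *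
      effR (phaseOn (G.neighborSet u) (-(σ * (π / 2))))) = graphEff (localComplement G u) := by
  classical
  rw [← graphEff_localComplement, effR_phaseOn]
  congr 1
  have h1 := Form.phase_sum (Finset.univ.filter (G.Adj u ·)) (X (n + 1))
  rcases hσ with rfl | rfl
  · rw [one_mul]
    have h2 : (∏ j with G.Adj u j, ∏ i ∈ Finset.univ.filter (G.Adj u ·) with i < j,
        Form.cz (X (n + 1) i) (X (n + 1) j)) *
        (∏ j with G.Adj u j, ∏ i ∈ Finset.univ.filter (G.Adj u ·) with i < j,
          Form.cz (X (n + 1) i) (X (n + 1) j)) = 1 := by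
      simp only [← Finset.prod_mul_distrib, Form.cz_mul_self, Finset.prod_const_one]
    -- The product of controlled `Z` gates is its own inverse, so that all phases may be negated.
    refine left_inv_eq_right_inv (a := _) ?_ h2
    rw [← h1, neighborSum, mul_mul_mul_comm, Form.phase_mul, ← Finset.prod_mul_distrib]
    simp [Form.phase_mul, Form.phase_zero]
  · rw [neg_one_mul, neg_neg]
    exact h1

end Graph

/-! ### Local complementation -/

/-- The green rotation of a non-empty register. -/
def zR {n : ℕ} (α : Fin (n + 1) → ℝ) : R (n + 1) ⟶ R (n + 1) := rot .green n.succPNat α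

theorem zR_eq {n : ℕ} (α : Fin (n + 1) → ℝ) : zR α = weight (effR α) (𝟙 (R (n + 1))) :=
  rot_green n.succPNat α

theorem isTranspose_zR {n : ℕ} (α : Fin (n + 1) → ℝ) : IsTranspose (zR α) (zR α) :=
  isTranspose_rot .green n.succPNat α

theorem isTranspose_xR {n : ℕ} (α : Fin (n + 1) → ℝ) : IsTranspose (xR α) (xR α) :=
  isTranspose_rot .red n.succPNat α

theorem toEffect_zR_xR {n : ℕ} (D : 𝟙_ Obj ⟶ R (n + 1)) (α β : Fin (n + 1) → ℝ) :
    toEffect ((D ≫ zR α) ≫ xR β) = xR β ≫ (effR α * toEffect D) := by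
  rw [toEffect_comp (isTranspose_xR β), toEffect_comp (isTranspose_zR α), zR_eq,
    weight_comp_effect, Category.id_comp]

theorem stateOf_localComplement {n : ℕ} (G : SimpleGraph (Fin (n + 1))) (u : Fin (n + 1))
    {D D' : Diag [] (reg (n + 1))} (hD : IsGraphStateBox G D)
    (hD' : IsGraphStateBox (localComplement G u) D') (σ : ℝ) (hσ : σ = 1 ∨ σ = -1) :
    (stateOf D ≫ zR (phaseOn (G.neighborSet u) (-(σ * (π / 2))))) ≫
      xR (phaseOn {u} (σ * (π / 2))) = stateOf D' := by
  refine eq_of_toEffect_eq ?_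
  rw [toEffect_zR_xR, toEffect_box hD, toEffect_box hD', mul_scale_effect, comp_scale,
    xR_phaseOn_comp, graphEff_mul_phase G u σ hσ]

end SZX

theorem mainTheorem5 (n : ℕ) (G : SimpleGraph (Fin (n + 1))) (u : Fin (n + 1))
    (D D' : SZX.Diag [] (SZX.reg (n + 1)))
    (hD : SZX.IsGraphStateBox G D) (hD' : SZX.IsGraphStateBox (SZX.localComplement G u) D')
    (ε : ℝ) (hε : ε = 1 ∨ ε = -1) :
    SZX.Derives
      ((D.comp (SZX.Diag.spider .green n.succPNat 1 1
            (SZX.phaseOn (G.neighborSet u) (-(ε * (Real.pi / 2))))) rfl).comp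
          (SZX.Diag.spider .red n.succPNat 1 1 (SZX.phaseOn {u} (ε * (Real.pi / 2)))) rfl)
      D' := by
  exact SZX.mk_eq_iff.1 (SZX.stateOf_localComplement G u hD hD' ε hε)
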